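/- Let $n\ge 3$ be odd. Let $P_U$ be the regular $n$-gon with unit edges $S_1,\dots,S_n$, numbered counter-clockwise, whose lowest edge $S_1$ joins $(0,0)$ to $(1,0)$, and let $P_L$ be its image under a half-turn. The double regular $n$-gon surface is obtained by gluing, by translation, each edge $S_k$ of $P_U$ to the parallel edge of $P_L$, which is also labelled $S_k$. A bi-infinite trajectory is a straight-line trajectory $\tau:\mathbb R\to$ surface of constant non-zero velocity that never meets a vertex; its cutting sequence $s:\mathbb Z\to\{S_1,\dots,S_n\}$ is the sequence of labels of the edges it crosses, in order, and is defined up to a shift of the index. For a bi-infinite sequence $s$, $\mathrm{ksl}(s)$ is the subsequence formed, in the same order, by the sandwiched letters of $s$, i.e. the letters $s_i$ with $s_{i-1}=s_{i+1}$. An affine automorphism with derivative $A$ is a homeomorphism of the surface that preserves the set of vertices and is, away from the vertices, affine with linear part $A$ in the translation charts. Put $$J=\begin{pmatrix}-1&0\\0&1\end{pmatrix},\qquad M_n=\begin{pmatrix}1&2\cot(\pi/n)\\0&1\end{pmatrix},$$ and let $R_\varphi$ be the rotation by $\varphi$. Let $k\in\mathbb Z$, and let (a) $A=R_{k\pi/n}\,(JM_n)\,R_{k\pi/n}^{-1}$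 and $I=\left((k-1)\pi/n,\;k\pi/n\right]$, or (b) $A=R_{k\pi/n}\,(M_nJ)\,R_{k\pi/n}^{-1}$ and $I=\left[k\pi/n,\;(k+1)\pi/n\right)$. Then the surface has an affine automorphism with derivative $A$. Moreover, let $\Phi$ be any such automorphism and let $\tau$ be a bi-infinite trajectory whose velocity is $v=r(\cos\theta,\sin\theta)$ with $r>0$ and $\theta\in I$. Then $\Phi\circ\tau$ is a bi-infinite trajectory with velocity $Av$, $\tau$ has a cutting sequence $s$, the sequence $\mathrm{ksl}(s)$ is again bi-infinite, and the cutting sequence of $\Phi\circ\tau$ is $\mathrm{ksl}(s)$ (up to a shift of the index). In particular ($k=0$), the Veech element $JM_n$ acts on the cutting sequences of the trajectories with $\theta\in(-\pi/n,0]$, and its mirror image $M_nJ$ on those with $\theta\in[0,\pi/n)$, by $s\mapsto\mathrm{ksl}(s)$; the other values of $k$ give the rotated versions of this, which together treat every direction. -/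

import Mathlib

open Filter Topology Matrix

noncomputable section

namespace DoubleGon

/-- The plane. -/
abbrev Plane : Type := Fin 2 → ℝ

/-- The unit vector at angle `θ`. -/
def dir (θ : ℝ) : Plane := ![Real.cos θ, Real.sin θ]

/-- The vertices, counter-clockwise, of the regular `n`-gon with unit edges whose first edge goes
from `(0, 0)` to `(1, 0)` (periodic in `k` with period `n`). -/
def vertex (n k : ℕ) : Plane := ∑ j ∈ Finset.range k, dir (2 * Real.pi * j / n)

/-- The corners of the upper polygon (`true`, horizontal edge at the bottom) and of the lower
polygon (`false`), which is its image under a half-turn. The two polygons are used as abstract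
pieces, so the position of the lower one in the plane does not matter. -/
def corners (n : ℕ) : Bool → Set Plane
  | true => Set.range (vertex n)
  | false => {x | -x ∈ Set.range (vertex n)}

/-- The closed upper and lower polygons. -/
def polygon (n : ℕ) (b : Bool) : Set Plane := convexHull ℝ (corners n b)

/-- The disjoint union of the two closed polygons. -/
abbrev Pieces (n : ℕ) : Type := {x : Bool × Plane // x.2 ∈ polygon n x.1}

/-- The edge with label `k` of the upper polygon (closed segment); label `k : Fin n` is the
`(k+1)`-st edge counter-clockwise, starting with the horizontal one. -/
def edge (n : ℕ) (k : Fin n) : Set Plane := segment ℝ (vertex n k) (vertex n (k + 1))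

/-- Each edge `[a, b]` of the upper polygon is glued to the parallel edge `[-b, -a]` of the lower
polygon by the translation `x ↦ x - a - b`. -/
def Glue (n : ℕ) (p q : Pieces n) : Prop :=
  p.1.1 = true ∧ q.1.1 = false ∧
    ∃ k : Fin n, p.1.2 ∈ edge n k ∧ q.1.2 = p.1.2 - vertex n k - vertex n (k + 1)

/-- The double regular `n`-gon surface, with the quotient topology. -/
abbrev Surface (n : ℕ) : Type := Quot (Glue n)

/-- The projection of the two polygons onto the surface. -/
def proj (n : ℕ) (p : Pieces n) : Surface n := Quot.mk (Glue n) p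

/-- The points of the surface that come from corners of the polygons. -/
def IsVertex (n : ℕ) (x : Surface n) : Prop :=
  ∃ p : Pieces n, proj n p = x ∧ p.1.2 ∈ corners n p.1.1

/-- The points of the surface that lie on the (closed) edge labelled `k`. -/
def OnEdge (n : ℕ) (k : Fin n) (x : Surface n) : Prop :=
  ∃ p : Pieces n, proj n p = x ∧ p.1.1 = true ∧ p.1.2 ∈ edge n k

/-- `y` is reached from `x` by the displacement `u` inside one of the closed polygons.
For `x` not a vertex and `u` small there is exactly one such `y`, and `u ↦ y` is the
local translation chart of the surface centred at `x` (if `x` lies inside an edge, its two halves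
come from the two polygons adjacent to the edge). -/
def Disp (n : ℕ) (x : Surface n) (u : Plane) (y : Surface n) : Prop :=
  ∃ p q : Pieces n, p.1.1 = q.1.1 ∧ q.1.2 = p.1.2 + u ∧ proj n p = x ∧ proj n q = y

/-- Bi-infinite straight-line trajectories of constant velocity `v` that avoid the vertices. -/
def IsTrajectory (n : ℕ) (τ : ℝ → Surface n) (v : Plane) : Prop :=
  ∀ t : ℝ, ¬ IsVertex n (τ t) ∧ ∀ᶠ h in 𝓝 (0 : ℝ), Disp n (τ t) (h • v) (τ (t + h))

/-- `s` is a cutting sequence of `τ`: the bi-infinite sequence of the labels of the edges that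
`τ` crosses, in the order of the crossing times `e`. (It is determined up to a shift.) -/
def IsCuttingSeq (n : ℕ) (τ : ℝ → Surface n) (s : ℤ → Fin n) : Prop :=
  ∃ e : ℤ → ℝ, StrictMono e ∧ Set.range e = {t | ∃ k, OnEdge n k (τ t)} ∧
    ∀ i, OnEdge n (s i) (τ (e i))

/-- `s'` is `ksl(s)`: the subsequence, in the same order, of the sandwiched letters of `s`, i.e.
those that are preceded and followed by the same letter. (It is determined up to a shift.) -/
def IsKsl {α : Type*} (s s' : ℤ → α) : Prop :=
  ∃ f : ℤ → ℤ, StrictMono f ∧ Set.range f = {i | s (i - 1) = s (i + 1)} ∧ ∀ j, s' j = s (f j)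

/-- Affine automorphisms of the surface with derivative `A`: homeomorphisms that preserve the
set of vertices and are affine with linear part `A` in the translation charts elsewhere. -/
structure IsAffineAut (n : ℕ) (Φ : Surface n ≃ₜ Surface n) (A : Matrix (Fin 2) (Fin 2) ℝ) :
    Prop where
  vertex_iff : ∀ x, IsVertex n (Φ x) ↔ IsVertex n x
  affine : ∀ x, ¬ IsVertex n x →
    ∀ᶠ u in 𝓝 (0 : Plane), ∀ y, Disp n x u y → Disp n (Φ x) (A *ᵥ u) (Φ y)

/-- The horizontal flip. -/
def hflip : Matrix (Fin 2) (Fin 2) ℝ := !![-1, 0; 0, 1]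

/-- The shear `M_n`. -/
def shear (n : ℕ) : Matrix (Fin 2) (Fin 2) ℝ := !![1, 2 * Real.cot (Real.pi / n); 0, 1]

/-- The rotation by the angle `φ`. -/
def rot (φ : ℝ) : Matrix (Fin 2) (Fin 2) ℝ :=
  !![Real.cos φ, -Real.sin φ; Real.sin φ, Real.cos φ]

end DoubleGon

end

set_option linter.unusedSectionVars false
noncomputable section

namespace DoubleGon

/-! ### Trigonometry of the regular polygon -/

section Trig

variable {n : ℕ}

/-! Fix two directions, the angles `(K - 1) π / n` and `K π / n`. Chords `V i V j` with `i + j`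
constant are parallel, so the vertices of the polygon can be joined by a zigzag `zig` whose steps
are alternately parallel to the two directions and have lengths `lam q = sin (q π / n) / sin (π /
n)`. It cuts the polygon into `n - 2` triangles, each with an edge of the polygon as third side. On
the surface the two copies of a triangle, one in each polygon, are glued along that edge into a
parallelogram (`rho`) with sides in the two directions; the edge is one of its diagonals. The
parallelograms form a chain indexed by `p`. The two remaining edges, at positions `0` and `n - 1`,
count as degenerate parallelograms at the ends of the chain.

The linear map that fixes the first direction and negates the second maps each parallelogram to a
translate of itself and exchanges its diagonals. These reflections agree where parallelograms meet
(`rhoF_top`, `rhoF_right`, `rhoF_congr`) and give the affine automorphism `reflect`. Up to sign its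
derivative is `A`, and the half-turn, which preserves all labels, accounts for the sign. The surface
has no non-trivial translation (`translation_eq_id`), so every automorphism with derivative `A` is
this one (`eq_reflect`).

A trajectory with velocity in the cone of the two directions enters a parallelogram by the left or
bottom side and leaves by the right or top side. It crosses the diagonal that is an edge exactly
once, so the cutting sequence lists the labels of the positions visited. The right and bottom sides
lead to and come from `p + 1` and `p - 1`, the top and left sides lead to and come from `p - 1` and
`p + 1`. The image trajectory crosses the edge at position `p` exactly when the original one crosses
the other diagonal, that is, when the passage joins opposite sides (`Straight.exists_crossing`,
`straight_of_eq`). By the adjacency of the sides this means that the previous and the next position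
are equal (`Next.straight_iff`): the letter is sandwiched. The positions form a nearest-neighbour
walk in a finite interval, which turns back infinitely often in both time directions
(`exists_turn`), so the sandwiched letters are again bi-infinite. `IsTrajectory.reflect_ksl`
assembles this. -/

/-- The angle `π / n`. -/
def ang (n : ℕ) : ℝ := Real.pi / n

/-- The cross product of two plane vectors. -/
def crs (a b : Plane) : ℝ := a 0 * b 1 - a 1 * b 0

@[simp] theorem dir_zero_apply (θ : ℝ) : dir θ 0 = Real.cos θ := rfl

@[simp] theorem dir_one_apply (θ : ℝ) : dir θ 1 = Real.sin θ := rfl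

theorem plane_ext {x y : Plane} (h0 : x 0 = y 0) (h1 : x 1 = y 1) : x = y := by
  funext i
  fin_cases i
  · exact h0
  · exact h1

theorem crs_dir_dir (a b : ℝ) : crs (dir a) (dir b) = Real.sin (b - a) := by
  simp only [crs, dir_zero_apply, dir_one_apply, Real.sin_sub]; ring

theorem dir_add_pi (a : ℝ) : dir (a + Real.pi) = -dir a := by
  apply plane_ext <;> simp [Real.cos_add_pi, Real.sin_add_pi]

theorem dir_add_int_mul_two_pi (a : ℝ) (k : ℤ) : dir (a + k * (2 * Real.pi)) = dir a := by
  apply plane_ext <;> simp [Real.cos_add_int_mul_two_pi, Real.sin_add_int_mul_two_pi]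

variable [Fact (3 ≤ n)]

theorem three_le : 3 ≤ n := Fact.out

theorem n_pos : (0 : ℝ) < n := by
  have : 3 ≤ n := three_le
  exact_mod_cast (by omega : 0 < n)

theorem ang_pos : 0 < ang n := div_pos Real.pi_pos n_pos

theorem n_mul_ang : (n : ℝ) * ang n = Real.pi := by
  have := (n_pos (n := n)).ne'
  unfold ang; field_simp

theorem sin_ang_pos : 0 < Real.sin (ang n) := by
  apply Real.sin_pos_of_pos_of_lt_pi ang_pos
  have h3 : (3 : ℝ) ≤ n := by exact_mod_cast (three_le (n := n))
  have := n_mul_ang (n := n)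
  have := ang_pos (n := n)
  nlinarith

theorem sin_mul_ang_pos {q : ℝ} (h0 : 0 < q) (h1 : q < n) : 0 < Real.sin (q * ang n) := by
  have h := n_mul_ang (n := n)
  have := ang_pos (n := n)
  apply Real.sin_pos_of_pos_of_lt_pi
  · positivity
  · rw [← h]; gcongr

/-- The vertices of the upper polygon, indexed by the integers modulo `n`. -/
def V (n : ℕ) (j : ℤ) : Plane := (Real.sin (j * ang n) / Real.sin (ang n)) • dir ((j - 1) * ang n)

theorem V_zero : V n 0 = 0 := by simp [V]

theorem V_add_one (j : ℤ) : V n (j + 1) = V n j + dir (2 * j * ang n) := by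
  have hs := (sin_ang_pos (n := n)).ne'
  have e1 : ((j + 1 : ℤ) : ℝ) * ang n = j * ang n + ang n := by push_cast; ring
  have e2 : ((j + 1 : ℤ) - 1 : ℝ) * ang n = j * ang n := by push_cast; ring
  have e3 : ((j : ℝ) - 1) * ang n = j * ang n - ang n := by ring
  have e4 : 2 * (j : ℝ) * ang n = j * ang n + j * ang n := by ring
  have hc := Real.sin_sq_add_cos_sq ((j : ℝ) * ang n)
  unfold V
  rw [e1, e2, e3, e4]
  apply plane_ext
  · simp only [Pi.smul_apply, Pi.add_apply, dir_zero_apply, smul_eq_mul, Real.sin_add,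
      Real.cos_add, Real.cos_sub]
    field_simp; ring
  · simp only [Pi.smul_apply, Pi.add_apply, dir_one_apply, smul_eq_mul, Real.sin_add,
      Real.sin_sub]
    field_simp; ring

/-- The partial sums of the edge directions are chords of the circumscribed circle from the vertex
`0`. The closed form extends the index to all integers and makes the periodicity immediate. -/
theorem vertex_eq_V (k : ℕ) : vertex n k = V n k := by
  induction k with
  | zero => simp [vertex, V_zero]
  | succ k ih =>
    have : vertex n (k + 1) = vertex n k + dir (2 * Real.pi * k / n) := by
      simp [vertex, Finset.sum_range_succ]
    rw [this, ih]
    push_cast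
    rw [V_add_one]
    congr 2
    unfold ang; push_cast; ring

theorem V_add_n (j : ℤ) : V n (j + n) = V n j := by
  have h := n_mul_ang (n := n)
  have e1 : ((j + n : ℤ) : ℝ) * ang n = j * ang n + Real.pi := by push_cast; rw [add_mul, h]
  have e2 : (((j + n : ℤ) : ℝ) - 1) * ang n = (j - 1) * ang n + Real.pi := by
    push_cast; rw [← h]; ring
  unfold V
  rw [e1, e2, dir_add_pi, Real.sin_add_pi, smul_neg, neg_div, neg_smul, neg_neg]

theorem V_periodic : Function.Periodic (V n) (n : ℤ) := V_add_n

theorem V_congr {i j : ℤ} (h : (n : ℤ) ∣ i - j) : V n i = V n j := by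
  obtain ⟨c, hc⟩ := h
  have : i = j + c * n := by linarith
  rw [this]
  exact V_periodic.int_mul c j

/-- The affine functional that vanishes on the line of the edge from `V j` to `V (j + 1)` and is
nonnegative on the polygon. -/
def FF (n : ℕ) (j : ℤ) (x : Plane) : ℝ := crs (dir (2 * j * ang n)) (x - V n j)

theorem FF_comb (j : ℤ) {x y : Plane} {a b : ℝ} (h : a + b = 1) :
    FF n j (a • x + b • y) = a * FF n j x + b * FF n j y := by
  have hb : b = 1 - a := by linarith
  subst hb
  simp only [FF, crs, Pi.add_apply, Pi.sub_apply, Pi.smul_apply, smul_eq_mul]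
  ring

theorem FF_add (j : ℤ) (x u : Plane) :
    FF n j (x + u) = FF n j x + crs (dir (2 * j * ang n)) u := by
  simp only [FF, crs, Pi.add_apply, Pi.sub_apply]; ring

theorem continuous_FF (j : ℤ) : Continuous (FF n j) := by
  unfold FF crs; fun_prop

/-- The distance from a vertex to the line of an edge factors into two sines, one for each end of
the edge. All sign and incidence statements about vertices and edges are read off from this product.
-/
theorem FF_V (i j : ℤ) : FF n j (V n i) =
    Real.sin ((i - j : ℤ) * ang n) * Real.sin ((i - j - 1 : ℤ) * ang n) / Real.sin (ang n) := by
  have hs := (sin_ang_pos (n := n)).ne'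
  have e1 : ((i : ℝ) - 1) * ang n = i * ang n - ang n := by ring
  have e2 : ((j : ℝ) - 1) * ang n = j * ang n - ang n := by ring
  have e3 : 2 * (j : ℝ) * ang n = j * ang n + j * ang n := by ring
  have e4 : ((i - j : ℤ) : ℝ) * ang n = i * ang n - j * ang n := by push_cast; ring
  have e5 : ((i - j - 1 : ℤ) : ℝ) * ang n = i * ang n - j * ang n - ang n := by push_cast; ring
  have hi := Real.sin_sq_add_cos_sq ((i : ℝ) * ang n)
  have hj := Real.sin_sq_add_cos_sq ((j : ℝ) * ang n)
  unfold FF V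
  rw [e1, e2, e3, e4, e5]
  simp only [crs, Pi.sub_apply, Pi.smul_apply, dir_zero_apply, dir_one_apply, smul_eq_mul,
      Real.sin_add, Real.cos_add, Real.sin_sub, Real.cos_sub]
  generalize Real.sin (i * ang n) = si at *
  generalize Real.cos (i * ang n) = ci at *
  generalize Real.sin (j * ang n) = sj at *
  generalize Real.cos (j * ang n) = cj at *
  generalize Real.sin (ang n) = s at *
  generalize Real.cos (ang n) = c at *
  have hc : ci ^ 2 = 1 - si ^ 2 := by linarith
  have hd : cj ^ 2 = 1 - sj ^ 2 := by linarith
  field_simp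
  grind

theorem V_emod (i j : ℤ) : V n i = V n (j + (i - j) % n) := by
  apply V_congr
  have : i - (j + (i - j) % n) = (i - j) - (i - j) % n := by ring
  rw [this]
  exact Int.dvd_self_sub_emod

/-- Only the residue `r` of `i - j` modulo `n` matters. A factor vanishes for `r = 0` and `r = 1`;
otherwise both `r π / n` and `(r - 1) π / n` lie strictly between `0` and `π`. -/
theorem FF_V_nonneg (i j : ℤ) : 0 ≤ FF n j (V n i) := by
  have h3 : 3 ≤ n := three_le
  have h0 : 0 ≤ (i - j) % n := Int.emod_nonneg _ (by omega)
  have h1 : (i - j) % n < n := Int.emod_lt_of_pos _ (by omega)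
  rw [V_emod i j]
  generalize (i - j) % n = r at h0 h1
  rw [FF_V]
  rcases h0.eq_or_lt with rfl | h0
  · simp
  have e : j + r - j = r := by ring
  rw [e]
  have a1 : 0 < Real.sin ((r : ℝ) * ang n) :=
    sin_mul_ang_pos (by exact_mod_cast h0) (by exact_mod_cast h1)
  rcases (by omega : r = 1 ∨ 1 < r) with rfl | h2
  · simp
  have a2 : 0 < Real.sin (((r - 1 : ℤ) : ℝ) * ang n) :=
    sin_mul_ang_pos (by exact_mod_cast (by omega : (0 : ℤ) < r - 1))
      (by exact_mod_cast (by omega : r - 1 < n))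
  have := sin_ang_pos (n := n)
  positivity

theorem FF_V_pos {i j : ℤ} (h : ¬ (n : ℤ) ∣ i - j) (h' : ¬ (n : ℤ) ∣ i - j - 1) :
    0 < FF n j (V n i) := by
  have h3 : 3 ≤ n := three_le
  have h0 : 0 ≤ (i - j) % n := Int.emod_nonneg _ (by omega)
  have h1 : (i - j) % n < n := Int.emod_lt_of_pos _ (by omega)
  have h2 : (i - j) % n ≠ 0 := fun e => h (Int.dvd_of_emod_eq_zero e)
  have h4 : (i - j) % n ≠ 1 := fun e => h' (by rw [← e]; exact Int.dvd_self_sub_emod)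
  rw [V_emod i j]
  generalize (i - j) % n = r at h0 h1 h2 h4
  rw [FF_V]
  have e : j + r - j = r := by ring
  rw [e]
  have a1 : 0 < Real.sin ((r : ℝ) * ang n) :=
    sin_mul_ang_pos (by exact_mod_cast (by omega : (0 : ℤ) < r)) (by exact_mod_cast h1)
  have a2 : 0 < Real.sin (((r - 1 : ℤ) : ℝ) * ang n) :=
    sin_mul_ang_pos (by exact_mod_cast (by omega : (0 : ℤ) < r - 1))
      (by exact_mod_cast (by omega : r - 1 < n))
  have := sin_ang_pos (n := n)
  positivity

theorem FF_V_eq_zero_iff (i j : ℤ) :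
    FF n j (V n i) = 0 ↔ (n : ℤ) ∣ i - j ∨ (n : ℤ) ∣ i - j - 1 := by
  constructor
  · intro h
    by_contra! hc
    exact (FF_V_pos hc.1 hc.2).ne' h
  · rintro (h | h)
    · rw [V_congr h]; simp [FF, crs]
    · rw [V_congr (i := i) (j := j + 1) (by convert h using 1; ring), FF_V]; simp

end Trig

end DoubleGon

end

noncomputable section

namespace DoubleGon

/-! ### The zigzag triangulation of the polygon -/

section Zigzag

variable {n : ℕ} [Fact (3 ≤ n)]

/-- The direction of a chord depends only on `i + j`, which is what makes a zigzag with two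
alternating directions possible. -/
theorem V_sub (i j : ℤ) : V n i - V n j =
    (Real.sin ((i - j : ℤ) * ang n) / Real.sin (ang n)) • dir ((i + j - 1 : ℤ) * ang n) := by
  have hs := (sin_ang_pos (n := n)).ne'
  have e1 : ((i : ℝ) - 1) * ang n = i * ang n - ang n := by ring
  have e2 : ((j : ℝ) - 1) * ang n = j * ang n - ang n := by ring
  have e4 : ((i - j : ℤ) : ℝ) * ang n = i * ang n - j * ang n := by push_cast; ring
  have e5 : ((i + j - 1 : ℤ) : ℝ) * ang n = i * ang n + j * ang n - ang n := by push_cast; ring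
  have hi := Real.sin_sq_add_cos_sq ((i : ℝ) * ang n)
  have hj := Real.sin_sq_add_cos_sq ((j : ℝ) * ang n)
  unfold V
  rw [e1, e2, e4, e5]
  apply plane_ext <;>
  · simp only [Pi.sub_apply, Pi.smul_apply, dir_zero_apply, dir_one_apply, smul_eq_mul,
      Real.sin_add, Real.cos_add, Real.sin_sub, Real.cos_sub]
    generalize Real.sin (i * ang n) = si at *
    generalize Real.cos (i * ang n) = ci at *
    generalize Real.sin (j * ang n) = sj at *
    generalize Real.cos (j * ang n) = cj at *
    generalize Real.sin (ang n) = s at *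
    generalize Real.cos (ang n) = c at *
    have hc : ci ^ 2 = 1 - si ^ 2 := by linarith
    have hd : cj ^ 2 = 1 - sj ^ 2 := by linarith
    field_simp
    grind

/-- The lengths of the diagonals of the zigzag. -/
def lam (n q : ℕ) : ℝ := Real.sin (q * ang n) / Real.sin (ang n)

theorem lam_zero : lam n 0 = 0 := by simp [lam]

theorem lam_one : lam n 1 = 1 := by
  have := (sin_ang_pos (n := n)).ne'
  simp [lam, this]

theorem lam_n : lam n n = 0 := by simp [lam, n_mul_ang]

theorem lam_pos {q : ℕ} (h0 : 0 < q) (h1 : q < n) : 0 < lam n q :=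
  div_pos (sin_mul_ang_pos (by exact_mod_cast h0) (by exact_mod_cast h1)) sin_ang_pos

theorem lam_nonneg {q : ℕ} (h1 : q ≤ n) : 0 ≤ lam n q := by
  rcases Nat.eq_zero_or_pos q with rfl | h0
  · rw [lam_zero]
  rcases h1.eq_or_lt with rfl | h1
  · rw [lam_n]
  exact (lam_pos h0 h1).le

/-- The difference of sines is `2 sin ((q - 1) π / 2n) cos ((q + 1) π / 2n)`, and both angles are in
the first quadrant. The strict inequality later singles out the sides of unit length among the sides
of the parallelograms. -/
theorem one_lt_lam {q : ℕ} (h0 : 2 ≤ q) (h1 : q + 2 ≤ n) : 1 < lam n q := by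
  have hs := sin_ang_pos (n := n)
  rw [lam, one_lt_div hs, ← sub_pos, Real.sin_sub_sin]
  have hq : (2 : ℝ) ≤ q := by exact_mod_cast h0
  have hq' : (q : ℝ) + 2 ≤ n := by exact_mod_cast h1
  have a1 : 0 < Real.sin ((q * ang n - ang n) / 2) := by
    have := sin_mul_ang_pos (n := n) (q := ((q : ℝ) - 1) / 2) (by linarith) (by linarith)
    convert this using 2; ring
  have a2 : 0 < Real.cos ((q * ang n + ang n) / 2) := by
    have := n_mul_ang (n := n)
    have := ang_pos (n := n)
    apply Real.cos_pos_of_mem_Ioo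
    constructor <;> nlinarith
  positivity

theorem one_le_lam {q : ℕ} (h0 : 1 ≤ q) (h1 : q < n) : 1 ≤ lam n q := by
  rcases h0.eq_or_lt with rfl | h0
  · rw [lam_one]
  rcases Nat.lt_or_ge n (q + 2) with h | h
  · have hq : (q : ℝ) * ang n = Real.pi - ang n := by
      have : (n : ℝ) = q + 1 := by exact_mod_cast (by omega : n = q + 1)
      have h := n_mul_ang (n := n)
      rw [this] at h
      linarith
    rw [lam, hq, Real.sin_pi_sub, div_self (sin_ang_pos (n := n)).ne']
  · exact (one_lt_lam h0 h).le

/-- The index, modulo `n`, of the `q`-th vertex of the zigzag that starts at `V m`. -/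
def zidx (m : ℤ) (q : ℕ) : ℤ := if Even q then m + (q / 2 : ℕ) else m - (q / 2 : ℕ)

/-- The vertices of the polygon in the order of the zigzag that starts at `V m`; the first and
the last one are repeated. -/
def zig (n : ℕ) (m : ℤ) (q : ℕ) : Plane := V n (zidx m q)

/-- The directions of the diagonals of the zigzag. -/
def del (n : ℕ) (m : ℤ) (q : ℕ) : Plane :=
  if Even q then -dir ((2 * m - 1) * ang n) else dir (2 * m * ang n)

/-- The indices of consecutive vertices of the zigzag have the sum `2 m` or `2 m + 1`, according to
parity, and differ by `q` in absolute value, so `V_sub` gives the direction and the length. -/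
theorem zig_succ (m : ℤ) (q : ℕ) : zig n m (q + 1) = zig n m q + lam n q • del n m q := by
  rw [← sub_eq_iff_eq_add', zig, zig, V_sub]
  obtain ⟨i, rfl | rfl⟩ := Nat.even_or_odd' q
  · have h1 : ¬ Even (2 * i + 1) := by simp
    have h2 : (2 * i + 1) / 2 = i := by omega
    simp only [zidx, del, lam, h1, h2, if_false, even_two_mul, if_true]
    have e1 : ((m - (i : ℕ) - (m + (2 * i / 2 : ℕ)) : ℤ) : ℝ) * ang n
        = -(((2 * i : ℕ) : ℝ) * ang n) := by
      rw [(by omega : 2 * i / 2 = i)]; push_cast; ring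
    have e2 : ((m - (i : ℕ) + (m + (2 * i / 2 : ℕ)) - 1 : ℤ) : ℝ) * ang n
        = (2 * m - 1) * ang n := by
      rw [(by omega : 2 * i / 2 = i)]; push_cast; ring
    rw [e1, e2, Real.sin_neg, neg_div, neg_smul, smul_neg]
  · have h1 : ¬ Even (2 * i + 1) := by simp
    have h2 : (2 * i + 1) / 2 = i := by omega
    have h3 : Even (2 * i + 1 + 1) := ⟨i + 1, by ring⟩
    have h4 : (2 * i + 1 + 1) / 2 = i + 1 := by omega
    simp only [zidx, del, lam, h1, h2, h3, h4, if_false, if_true]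
    have e1 : ((m + (i + 1 : ℕ) - (m - (i : ℕ)) : ℤ) : ℝ) * ang n
        = (((2 * i + 1 : ℕ) : ℝ) * ang n) := by
      push_cast; ring
    have e2 : ((m + (i + 1 : ℕ) + (m - (i : ℕ)) - 1 : ℤ) : ℝ) * ang n
        = 2 * m * ang n := by
      push_cast; ring
    rw [e1, e2]

theorem del_add_two (m : ℤ) (q : ℕ) : del n m (q + 2) = del n m q := by
  simp [del, Nat.even_add]

/-- The coordinate of a point along `del q`, in the basis of the two directions of the zigzag. -/
def co (n : ℕ) (m : ℤ) (q : ℕ) : Plane →ₗ[ℝ] ℝ where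
  toFun x := crs (if Even q then dir (2 * m * ang n) else dir ((2 * m - 1) * ang n)) x /
    Real.sin (ang n)
  map_add' x y := by simp only [crs, Pi.add_apply]; ring
  map_smul' c x := by simp only [crs, Pi.smul_apply, smul_eq_mul, RingHom.id_apply]; ring

theorem co_apply (m : ℤ) (q : ℕ) (x : Plane) : co n m q x =
    crs (if Even q then dir (2 * m * ang n) else dir ((2 * m - 1) * ang n)) x /
    Real.sin (ang n) := rfl

theorem co_add_two (m : ℤ) (q : ℕ) : co n m (q + 2) = co n m q := by
  ext x; simp [co, Nat.even_add]

theorem co_congr (m : ℤ) {i j : ℕ} (h : Even i ↔ Even j) : co n m i = co n m j :=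
  LinearMap.ext fun x => by simp only [co_apply, h]

theorem continuous_co (m : ℤ) (q : ℕ) : Continuous (co n m q) :=
  LinearMap.continuous_of_finiteDimensional _

theorem crs_neg_right (a b : Plane) : crs a (-b) = -crs a b := by simp [crs]; ring

theorem co_del_self (m : ℤ) (q : ℕ) : co n m q (del n m q) = 1 := by
  have hs := (sin_ang_pos (n := n)).ne'
  rw [co_apply]
  by_cases h : Even q
  · simp only [del, h, if_true, crs_neg_right, crs_dir_dir, ← Real.sin_neg]
    rw [div_eq_one_iff_eq hs]; congr 1; ring
  · simp only [del, h, if_false, crs_dir_dir]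
    rw [div_eq_one_iff_eq hs]; congr 1; ring

theorem co_succ_del (m : ℤ) (q : ℕ) : co n m (q + 1) (del n m q) = 0 := by
  rw [co_apply]
  by_cases h : Even q
  · have : ¬ Even (q + 1) := by simpa [Nat.even_add_one] using h
    simp only [del, h, this, if_true, if_false, crs_neg_right, crs_dir_dir]
    simp
  · have : Even (q + 1) := by simpa [Nat.even_add_one] using h
    simp only [del, h, this, if_true, if_false, crs_dir_dir]
    simp

theorem co_del_succ (m : ℤ) (q : ℕ) : co n m q (del n m (q + 1)) = 0 := by
  rw [← co_add_two, co_succ_del]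

theorem co_ext (m : ℤ) (q : ℕ) {x y : Plane} (h : co n m q x = co n m q y)
    (h' : co n m (q + 1) x = co n m (q + 1) y) : x = y := by
  have hs := (sin_ang_pos (n := n)).ne'
  have key : ∀ i, co n m i x = co n m i y := by
    intro i
    by_cases hq : (Even i ↔ Even q)
    · rw [co_congr m hq, h]
    · rw [co_congr m (j := q + 1) (by rw [Nat.even_add_one]; tauto), h']
  have k0 := key 0
  have k1 := key 1
  simp only [co_apply, div_left_inj' hs] at k0 k1
  simp only [Nat.not_even_one, if_false] at k1
  simp only [Even.zero, if_true] at k0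
  simp only [crs, dir_zero_apply, dir_one_apply] at k0 k1
  have e : (2 * (m : ℝ) - 1) * ang n = 2 * m * ang n - ang n := by ring
  rw [e, Real.cos_sub, Real.sin_sub] at k1
  have hi := Real.sin_sq_add_cos_sq (2 * (m : ℝ) * ang n)
  generalize Real.sin (2 * (m : ℝ) * ang n) = s at *
  generalize Real.cos (2 * (m : ℝ) * ang n) = c at *
  generalize Real.sin (ang n) = s' at *
  generalize Real.cos (ang n) = c' at *
  have k2 : s' * ((x 1 - y 1) * s + (x 0 - y 0) * c) = 0 := by linear_combination k1 - c' * k0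
  have k3 := (mul_eq_zero.1 k2).resolve_left hs
  have hi' : c ^ 2 + s ^ 2 = 1 := by linarith
  apply plane_ext
  · linear_combination c * k3 - s * k0 - (x 0 - y 0) * hi'
  · linear_combination s * k3 + c * k0 - (x 1 - y 1) * hi'

theorem co_zig_succ (m : ℤ) (q : ℕ) :
    co n m q (zig n m (q + 1)) = co n m q (zig n m q) + lam n q := by
  rw [zig_succ, map_add, map_smul, co_del_self, smul_eq_mul, mul_one]

theorem co_succ_zig_succ (m : ℤ) (q : ℕ) :
    co n m (q + 1) (zig n m (q + 1)) = co n m (q + 1) (zig n m q) := by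
  rw [zig_succ, map_add, map_smul, co_succ_del, smul_zero, add_zero]

theorem co_zig_le_succ (m : ℤ) (q i : ℕ) (hi : i ≤ n) :
    co n m q (zig n m i) ≤ co n m q (zig n m (i + 1)) := by
  by_cases hq : (Even q ↔ Even i)
  · rw [co_congr m hq, co_zig_succ]
    linarith [lam_nonneg hi]
  · rw [co_congr m (j := i + 1) (by rw [Nat.even_add_one]; tauto), co_succ_zig_succ]

/-- Each step adds a nonnegative multiple of one of the two basis vectors, so neither coordinate
ever decreases along the zigzag. This monotonicity replaces planar pictures when triangles have to
be separated and vertices located. -/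
theorem co_zig_mono (m : ℤ) (q : ℕ) {i j : ℕ} (hij : i ≤ j) (hj : j ≤ n + 1) :
    co n m q (zig n m i) ≤ co n m q (zig n m j) := by
  induction j, hij using Nat.le_induction with
  | base => rfl
  | succ j hij ih => exact (ih (by omega)).trans (co_zig_le_succ m q j (by omega))

/-- The parametrization of the triangle with apex `zig (p + 1)` along its two zigzag sides. -/
def Tri (n : ℕ) (m : ℤ) (p : ℕ) (s t : ℝ) : Plane :=
  zig n m (p + 1) - s • del n m p + t • del n m (p + 1)

theorem co_Tri (m : ℤ) (p : ℕ) (s t : ℝ) :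
    co n m p (Tri n m p s t) = co n m p (zig n m (p + 1)) - s := by
  simp [Tri, co_del_self, co_del_succ]

theorem co_succ_Tri (m : ℤ) (p : ℕ) (s t : ℝ) :
    co n m (p + 1) (Tri n m p s t) = co n m (p + 1) (zig n m (p + 1)) + t := by
  simp [Tri, co_del_self, co_succ_del]

theorem eq_Tri (m : ℤ) (p : ℕ) (x : Plane) :
    x = Tri n m p (co n m p (zig n m (p + 1)) - co n m p x)
      (co n m (p + 1) x - co n m (p + 1) (zig n m (p + 1))) := by
  apply co_ext (n := n) m p
  · rw [co_Tri]; ring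
  · rw [co_succ_Tri]; ring

theorem Tri_inj {m : ℤ} {p : ℕ} {s t s' t' : ℝ} (h : Tri n m p s t = Tri n m p s' t') :
    s = s' ∧ t = t' := by
  have h1 := congrArg (co n m p) h
  have h2 := congrArg (co n m (p + 1)) h
  rw [co_Tri, co_Tri] at h1
  rw [co_succ_Tri, co_succ_Tri] at h2
  constructor <;> linarith

theorem Tri_zero_zero (m : ℤ) (p : ℕ) : Tri n m p 0 0 = zig n m (p + 1) := by simp [Tri]

theorem Tri_lam_zero (m : ℤ) (p : ℕ) : Tri n m p (lam n p) 0 = zig n m p := by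
  simp [Tri, zig_succ]

theorem Tri_zero_lam (m : ℤ) (p : ℕ) : Tri n m p 0 (lam n (p + 1)) = zig n m (p + 2) := by
  simp [Tri, zig_succ m (p + 1)]

/-- The diagonal shared by two consecutive triangles. -/
theorem Tri_succ (m : ℤ) (p : ℕ) (t : ℝ) :
    Tri n m (p + 1) (lam n (p + 1) - t) 0 = Tri n m p 0 t := by
  rw [Tri, Tri, zig_succ m (p + 1)]
  module

theorem Tri_comb (m : ℤ) (p : ℕ) {s t s' t' a b : ℝ} (h : a + b = 1) :
    a • Tri n m p s t + b • Tri n m p s' t' = Tri n m p (a * s + b * s') (a * t + b * t') := by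
  have hb : b = 1 - a := by linarith
  subst hb
  simp only [Tri]
  module

/-- The index modulo `n` of the edge at position `p`. -/
def eidx (m : ℤ) (p : ℕ) : ℤ := if Even p then m + (p / 2 : ℕ) else m - ((p + 1) / 2 : ℕ)

/-- The label of the edge with index `j` modulo `n`. -/
def lbl (n : ℕ) [Fact (3 ≤ n)] (j : ℤ) : Fin n :=
  ⟨(j % n).toNat, by
    have h3 : 3 ≤ n := three_le
    have h0 : 0 ≤ j % n := Int.emod_nonneg _ (by omega)
    have h1 : j % n < n := Int.emod_lt_of_pos _ (by omega)
    omega⟩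

theorem lbl_dvd (j : ℤ) : (n : ℤ) ∣ j - (lbl n j : ℕ) := by
  have h3 : 3 ≤ n := three_le
  have h0 : 0 ≤ j % n := Int.emod_nonneg _ (by omega)
  have : ((lbl n j : ℕ) : ℤ) = j % n := by simp [lbl, h0]
  rw [this]
  exact Int.dvd_self_sub_emod

theorem lbl_natCast (k : Fin n) : lbl n (k : ℕ) = k := by
  apply Fin.ext
  have h : ((k : ℕ) : ℤ) % n = (k : ℕ) := Int.emod_eq_of_lt (by omega) (by exact_mod_cast k.2)
  simp [lbl, h]

theorem lbl_eq_iff {i j : ℤ} : lbl n i = lbl n j ↔ (n : ℤ) ∣ i - j := by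
  constructor
  · intro h
    have h1 := lbl_dvd (n := n) i
    have h2 := lbl_dvd (n := n) j
    rw [h] at h1
    have := dvd_sub h1 h2
    rwa [sub_sub_sub_cancel_right] at this
  · intro h
    have : i % n = j % n := Int.emod_eq_emod_iff_emod_sub_eq_zero.2 (Int.emod_eq_zero_of_dvd h)
    simp [lbl, this]

theorem vertex_lbl (j : ℤ) : vertex n (lbl n j) = V n j := by
  rw [vertex_eq_V]; exact (V_congr (lbl_dvd j)).symm

theorem vertex_lbl_succ (j : ℤ) : vertex n (lbl n j + 1) = V n (j + 1) := by
  rw [vertex_eq_V]; apply (V_congr _).symm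
  have := lbl_dvd (n := n) j
  push_cast
  convert this using 1; ring

theorem edge_lbl (j : ℤ) : edge n (lbl n j) = segment ℝ (V n j) (V n (j + 1)) := by
  rw [edge, vertex_lbl, vertex_lbl_succ]

/-- The label of the edge at position `p` of the zigzag. -/
def lab (n : ℕ) [Fact (3 ≤ n)] (m : ℤ) (p : ℕ) : Fin n := lbl n (eidx m p)

/-- Vertices two steps apart lie on the same side of the zigzag and are neighbours on the polygon;
the parity of `p` decides which of them comes first counter-clockwise. -/
theorem zig_endpoints (m : ℤ) (p : ℕ) :
    (zig n m p = V n (eidx m p) ∧ zig n m (p + 2) = V n (eidx m p + 1)) ∨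
    (zig n m p = V n (eidx m p + 1) ∧ zig n m (p + 2) = V n (eidx m p)) := by
  obtain ⟨i, rfl | rfl⟩ := Nat.even_or_odd' p
  · left
    have h3 : Even (2 * i + 2) := ⟨i + 1, by ring⟩
    have h4 : (2 * i + 2) / 2 = i + 1 := by omega
    simp only [zig, zidx, eidx, even_two_mul, h3, h4, if_true]
    exact ⟨trivial, by push_cast; congr 1; omega⟩
  · right
    have h1 : ¬ Even (2 * i + 1) := by simp
    have h3 : ¬ Even (2 * i + 1 + 2) := by simp [Nat.even_add]
    have h4 : (2 * i + 1 + 2) / 2 = i + 1 := by omega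
    have h5 : (2 * i + 1 + 1) / 2 = i + 1 := by omega
    have h6 : (2 * i + 1) / 2 = i := by omega
    simp only [zig, zidx, eidx, h1, h3, h4, h5, h6, if_false]
    exact ⟨by push_cast; congr 1; omega, trivial⟩

theorem edge_lab (m : ℤ) (p : ℕ) :
    edge n (lab n m p) = segment ℝ (zig n m p) (zig n m (p + 2)) := by
  rw [lab, edge_lbl]
  rcases zig_endpoints (n := n) m p with ⟨h1, h2⟩ | ⟨h1, h2⟩
  · rw [h1, h2]
  · rw [h1, h2, segment_symm]

theorem vertex_lab_add (m : ℤ) (p : ℕ) :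
    vertex n (lab n m p) + vertex n (lab n m p + 1) = zig n m p + zig n m (p + 2) := by
  rw [lab, vertex_lbl, vertex_lbl_succ]
  rcases zig_endpoints (n := n) m p with ⟨h1, h2⟩ | ⟨h1, h2⟩
  · rw [h1, h2]
  · rw [h1, h2, add_comm]

variable [Fact (Odd n)]

theorem exists_half : ∃ N : ℕ, n = 2 * N + 1 ∧ 1 ≤ N := by
  have h3 : 3 ≤ n := three_le
  obtain ⟨N, hN⟩ : Odd n := Fact.out
  exact ⟨N, hN, by omega⟩

/-- With `n = 2 N + 1`, the even positions have the indices `m, …, m + N` and the odd ones `m - 1,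
…, m - N`. These are `n` consecutive integers. -/
theorem lab_inj {m : ℤ} {p q : ℕ} (hp : p < n) (hq : q < n) (h : lab n m p = lab n m q) :
    p = q := by
  obtain ⟨N, hN, h1⟩ := exists_half (n := n)
  rw [lab, lab, lbl_eq_iff] at h
  have hlt : |eidx m p - eidx m q| < n := by
    rw [abs_lt]
    unfold eidx
    split_ifs <;> constructor <;> omega
  have := Int.eq_zero_of_abs_lt_dvd h hlt
  unfold eidx at this
  split_ifs at this with ha hb hb
  · rw [Nat.even_iff] at ha hb; omega
  · rw [Nat.even_iff] at ha hb; omega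
  · rw [Nat.even_iff] at ha hb; omega
  · rw [Nat.even_iff] at ha hb; omega

theorem exists_lab (m : ℤ) (k : Fin n) : ∃ p < n, lab n m p = k := by
  have hinj : Function.Injective (fun p : Fin n => lab n m p) := fun p q h =>
    Fin.ext (lab_inj p.2 q.2 h)
  obtain ⟨p, hp⟩ := (Finite.injective_iff_surjective.1 hinj) k
  exact ⟨p, p.2, hp⟩

theorem zig_one (m : ℤ) : zig n m 1 = zig n m 0 := by simp [zig_succ m 0, lam_zero]

theorem zig_n_add_one (m : ℤ) : zig n m (n + 1) = zig n m n := by simp [zig_succ m n, lam_n]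

theorem exists_zig (m i : ℤ) : ∃ q, 1 ≤ q ∧ q ≤ n ∧ V n i = zig n m q := by
  obtain ⟨N, hN, h1⟩ := exists_half (n := n)
  obtain ⟨p, hp, h⟩ := exists_lab (n := n) m (lbl n i)
  rw [lab, lbl_eq_iff] at h
  have e : V n i = V n (eidx m p) := (V_congr h).symm
  rcases zig_endpoints (n := n) m p with h | h
  · rcases Nat.eq_zero_or_pos p with rfl | h0
    · exact ⟨1, le_rfl, by omega, by rw [e, zig_one, h.1]⟩
    · exact ⟨p, h0, by omega, by rw [e, h.1]⟩
  · rcases Nat.lt_or_ge (p + 1) n with h0 | h0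
    · exact ⟨p + 2, by omega, by omega, by rw [e, h.2]⟩
    · obtain rfl : n = p + 1 := by omega
      exact ⟨p + 1, by omega, by omega, by rw [e, ← zig_n_add_one, h.2]⟩

end Zigzag

end DoubleGon

end

noncomputable section

namespace DoubleGon

/-! ### The polygon and its edges -/

section Polygon

variable {n : ℕ} [Fact (3 ≤ n)]

theorem mem_corners_iff {x : Plane} : x ∈ corners n true ↔ ∃ j : ℤ, x = V n j := by
  constructor
  · rintro ⟨k, rfl⟩
    exact ⟨k, vertex_eq_V k⟩
  · rintro ⟨j, rfl⟩
    exact ⟨lbl n j, vertex_lbl j⟩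

theorem V_mem_corners (j : ℤ) : V n j ∈ corners n true := mem_corners_iff.2 ⟨j, rfl⟩

theorem corners_subset_polygon : corners n true ⊆ polygon n true := subset_convexHull ℝ _

theorem V_mem_polygon (j : ℤ) : V n j ∈ polygon n true := corners_subset_polygon (V_mem_corners j)

theorem convex_polygon (b : Bool) : Convex ℝ (polygon n b) := convex_convexHull ℝ _

theorem exists_lbl (k : Fin n) : ∃ j : ℤ, k = lbl n j := ⟨k, (lbl_natCast k).symm⟩

theorem edge_subset_polygon (k : Fin n) : edge n k ⊆ polygon n true := by
  obtain ⟨j, rfl⟩ := exists_lbl k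
  rw [edge_lbl]
  exact (convex_polygon true).segment_subset (V_mem_polygon _) (V_mem_polygon _)

theorem FF_eq_zero_of_mem_edge {j : ℤ} {x : Plane} (hx : x ∈ edge n (lbl n j)) :
    FF n j x = 0 := by
  rw [edge_lbl] at hx
  obtain ⟨a, b, -, -, hab, rfl⟩ := hx
  rw [FF_comb j hab, (FF_V_eq_zero_iff j j).2 (by simp), (FF_V_eq_zero_iff (j + 1) j).2 (by simp)]
  simp

/-- The open half-plane together with the edge on its boundary is a convex set that contains all
corners, hence their convex hull. -/
theorem FF_pos_or_mem_edge (j : ℤ) {x : Plane} (hx : x ∈ polygon n true) :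
    0 < FF n j x ∨ x ∈ edge n (lbl n j) := by
  have hconv : Convex ℝ {x | 0 < FF n j x ∨ x ∈ edge n (lbl n j)} := by
    intro x hx y hy a b ha hb hab
    have nonneg : ∀ z, (0 < FF n j z ∨ z ∈ edge n (lbl n j)) → 0 ≤ FF n j z := fun z hz =>
      hz.elim (fun h => h.le) (fun h => (FF_eq_zero_of_mem_edge h).ge)
    rcases ha.eq_or_lt with rfl | ha'
    · obtain rfl : b = 1 := by linarith
      simpa using hy
    rcases hb.eq_or_lt with rfl | hb'
    · obtain rfl : a = 1 := by linarith
      simpa using hx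
    have hx0 := nonneg x hx
    have hy0 := nonneg y hy
    rcases hx with h1 | h1
    · left; rw [FF_comb j hab]; positivity
    rcases hy with h2 | h2
    · left; rw [FF_comb j hab]; positivity
    · right; exact (convex_segment _ _) h1 h2 ha hb hab
  refine convexHull_min ?_ hconv hx
  intro y hy
  obtain ⟨i, rfl⟩ := mem_corners_iff.1 hy
  by_cases h1 : (n : ℤ) ∣ i - j
  · right; rw [V_congr h1, edge_lbl]; exact left_mem_segment _ _ _
  by_cases h2 : (n : ℤ) ∣ i - j - 1
  · right
    rw [V_congr (i := i) (j := j + 1) (by convert h2 using 1; ring), edge_lbl]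
    exact right_mem_segment _ _ _
  · left; exact FF_V_pos h1 h2

theorem FF_nonneg (j : ℤ) {x : Plane} (hx : x ∈ polygon n true) : 0 ≤ FF n j x :=
  (FF_pos_or_mem_edge j hx).elim (fun h => h.le) (fun h => (FF_eq_zero_of_mem_edge h).ge)

theorem mem_edge_iff {j : ℤ} {x : Plane} (hx : x ∈ polygon n true) :
    x ∈ edge n (lbl n j) ↔ FF n j x = 0 :=
  ⟨FF_eq_zero_of_mem_edge, fun h => (FF_pos_or_mem_edge j hx).resolve_left (by simp [h])⟩

theorem corner_of_mem_edge {j : ℤ} {x : Plane} (hx : x ∈ edge n (lbl n j))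
    (hc : x ∈ corners n true) : x = V n j ∨ x = V n (j + 1) := by
  obtain ⟨i, rfl⟩ := mem_corners_iff.1 hc
  have := FF_eq_zero_of_mem_edge hx
  rw [FF_V_eq_zero_iff] at this
  refine this.imp (fun h => V_congr h) (fun h => V_congr ?_)
  convert h using 1; ring

/-- A functional that is nonnegative at both ends of an edge and vanishes at a point strictly
between them vanishes at both ends. As `n` does not divide `2`, this forces the two edges to
coincide. -/
theorem edge_unique {i j : ℤ} {x : Plane} (hi : x ∈ edge n (lbl n i)) (hj : x ∈ edge n (lbl n j))
    (hc : x ∉ corners n true) : lbl n i = lbl n j := by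
  have h3 : 3 ≤ n := three_le
  have h0 := FF_eq_zero_of_mem_edge hj
  rw [edge_lbl] at hi
  obtain ⟨a, b, ha, hb, hab, rfl⟩ := hi
  rcases ha.eq_or_lt with rfl | ha'
  · obtain rfl : b = 1 := by linarith
    exact (hc (by simpa using V_mem_corners _)).elim
  rcases hb.eq_or_lt with rfl | hb'
  · obtain rfl : a = 1 := by linarith
    exact (hc (by simpa using V_mem_corners _)).elim
  rw [FF_comb j hab] at h0
  have p1 := FF_V_nonneg (n := n) i j
  have p2 := FF_V_nonneg (n := n) (i + 1) j
  have z1 : FF n j (V n i) = 0 := by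
    by_contra hne
    have : 0 < FF n j (V n i) := lt_of_le_of_ne p1 (Ne.symm hne)
    nlinarith [mul_pos ha' this, mul_nonneg hb p2]
  have z2 : FF n j (V n (i + 1)) = 0 := by
    by_contra hne
    have : 0 < FF n j (V n (i + 1)) := lt_of_le_of_ne p2 (Ne.symm hne)
    nlinarith [mul_pos hb' this, mul_nonneg ha p1]
  rw [FF_V_eq_zero_iff] at z1 z2
  rw [lbl_eq_iff]
  rcases z1 with z1 | z1
  · exact z1
  rcases z2 with z2 | z2
  · have := dvd_sub z2 z1
    rw [show i + 1 - j - (i - j - 1) = 2 by ring] at this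
    have := Int.le_of_dvd (by norm_num) this
    omega
  · rwa [show i + 1 - j - 1 = i - j by ring] at z2

theorem edge_unique' {k l : Fin n} {x : Plane} (hi : x ∈ edge n k) (hj : x ∈ edge n l)
    (hc : x ∉ corners n true) : k = l := by
  obtain ⟨i, rfl⟩ := exists_lbl k
  obtain ⟨j, rfl⟩ := exists_lbl l
  exact edge_unique hi hj hc

/-- The half-turn about the midpoint of an edge. -/
def turn (n : ℕ) (k : Fin n) (x : Plane) : Plane := vertex n k + vertex n (k + 1) - x

theorem turn_turn (k : Fin n) (x : Plane) : turn n k (turn n k x) = x := by simp [turn]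

theorem turn_lbl (j : ℤ) (x : Plane) : turn n (lbl n j) x = V n j + V n (j + 1) - x := by
  rw [turn, vertex_lbl, vertex_lbl_succ]

theorem turn_mem_edge {k : Fin n} {x : Plane} (hx : x ∈ edge n k) : turn n k x ∈ edge n k := by
  obtain ⟨j, rfl⟩ := exists_lbl k
  rw [turn_lbl]
  rw [edge_lbl] at hx ⊢
  obtain ⟨a, b, ha, hb, hab, rfl⟩ := hx
  refine ⟨b, a, hb, ha, by linarith, ?_⟩
  obtain rfl : b = 1 - a := by linarith
  module

theorem turn_mem_corners {k : Fin n} {x : Plane} (hx : x ∈ edge n k) (hc : x ∈ corners n true) :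
    turn n k x ∈ corners n true := by
  obtain ⟨j, rfl⟩ := exists_lbl k
  rw [turn_lbl]
  rcases corner_of_mem_edge hx hc with rfl | rfl
  · simpa using V_mem_corners _
  · simpa using V_mem_corners _

theorem turn_mem_corners_iff {k : Fin n} {x : Plane} (hx : x ∈ edge n k) :
    turn n k x ∈ corners n true ↔ x ∈ corners n true :=
  ⟨fun h => by simpa [turn_turn] using turn_mem_corners (turn_mem_edge hx) h, turn_mem_corners hx⟩

theorem mem_polygon_false {x : Plane} : x ∈ polygon n false ↔ -x ∈ polygon n true := by
  have : corners n false = -corners n true := rfl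
  rw [polygon, this, convexHull_neg, Set.mem_neg, polygon]

theorem mem_corners_false {x : Plane} : x ∈ corners n false ↔ -x ∈ corners n true := Iff.rfl

/-! #### The triangulation -/

/-- The parameters of the points of the triangle at position `p`. -/
structure InTri (n p : ℕ) (s t : ℝ) : Prop where
  s_nonneg : 0 ≤ s
  s_le : s ≤ lam n p
  t_nonneg : 0 ≤ t
  t_le : t ≤ lam n (p + 1)
  le : s * lam n (p + 1) + t * lam n p ≤ lam n p * lam n (p + 1)

theorem zig_mem_polygon (m : ℤ) (q : ℕ) : zig n m q ∈ polygon n true := V_mem_polygon _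

theorem zig_mem_corners (m : ℤ) (q : ℕ) : zig n m q ∈ corners n true := V_mem_corners _

theorem Tri_mem (m : ℤ) {p : ℕ} (hp : p < n) {s t : ℝ} (h : InTri n p s t) :
    Tri n m p s t ∈ polygon n true := by
  have h3 : 3 ≤ n := three_le
  have hl0 : 0 ≤ lam n p := lam_nonneg hp.le
  have hl1 : 0 ≤ lam n (p + 1) := lam_nonneg hp
  have conv := convex_polygon (n := n) true
  -- One of the two side lengths vanishes only at the positions `0` and `n - 1`, where the triangle
  -- collapses to an edge; otherwise barycentric coordinates apply.
  rcases hl0.eq_or_lt with h0 | h0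
  · have hs : s = 0 := le_antisymm (by rw [h0]; exact h.s_le) h.s_nonneg
    have h1 : 0 < lam n (p + 1) := by
      rcases Nat.eq_zero_or_pos p with rfl | hp0
      · rw [zero_add, lam_one]; norm_num
      · exact absurd h0 (lam_pos hp0 hp).ne
    have e : Tri n m p s t = (1 - t / lam n (p + 1)) • zig n m (p + 1)
        + (t / lam n (p + 1)) • zig n m (p + 2) := by
      rw [hs, zig_succ m (p + 1), Tri]
      have : t = (t / lam n (p + 1)) * lam n (p + 1) := by field_simp
      conv_lhs => rw [this]
      module
    rw [e]
    exact conv (zig_mem_polygon _ _) (zig_mem_polygon _ _)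
      (by have := (div_le_one h1).2 h.t_le; linarith) (div_nonneg h.t_nonneg hl1) (by ring)
  rcases hl1.eq_or_lt with h1 | h1
  · have ht : t = 0 := le_antisymm (by rw [h1]; exact h.t_le) h.t_nonneg
    have e : Tri n m p s t = (1 - s / lam n p) • zig n m (p + 1)
        + (s / lam n p) • zig n m p := by
      rw [ht, zig_succ m p, Tri, zig_succ m p]
      have : s = (s / lam n p) * lam n p := by field_simp
      conv_lhs => rw [this]
      module
    rw [e]
    exact conv (zig_mem_polygon _ _) (zig_mem_polygon _ _)
      (by have := (div_le_one h0).2 h.s_le; linarith) (div_nonneg h.s_nonneg hl0) (by ring)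
  have e : Tri n m p s t = (1 - s / lam n p - t / lam n (p + 1)) • zig n m (p + 1)
      + (s / lam n p) • zig n m p + (t / lam n (p + 1)) • zig n m (p + 2) := by
    have e1 : s • del n m p = (s / lam n p) • (lam n p • del n m p) := by
      rw [smul_smul]; congr 1; field_simp
    have e2 : t • del n m (p + 1) = (t / lam n (p + 1)) • (lam n (p + 1) • del n m (p + 1)) := by
      rw [smul_smul]; congr 1; field_simp
    rw [zig_succ m (p + 1), Tri, e1, e2, zig_succ m p]
    module
  have hw : 0 ≤ 1 - s / lam n p - t / lam n (p + 1) := by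
    have := h.le
    have e3 : 1 - s / lam n p - t / lam n (p + 1) =
      (lam n p * lam n (p + 1) - (s * lam n (p + 1) + t * lam n p)) / (lam n p * lam n (p + 1)) := by
      field_simp; ring
    rw [e3]; apply div_nonneg <;> [linarith; positivity]
  rw [e]
  have := conv.sum_mem (t := Finset.univ (α := Fin 3))
    (w := ![1 - s / lam n p - t / lam n (p + 1), s / lam n p, t / lam n (p + 1)])
    (z := ![zig n m (p + 1), zig n m p, zig n m (p + 2)])
    (by
      intro i _; fin_cases i
      · exact hw
      · exact div_nonneg h.s_nonneg hl0
      · exact div_nonneg h.t_nonneg hl1)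
    (by simp [Fin.sum_univ_three]; ring)
    (by intro i _; fin_cases i <;> exact zig_mem_polygon _ _)
  simpa [Fin.sum_univ_three] using this

theorem FF_zig_pos (m : ℤ) {p : ℕ} (h1 : 1 ≤ p) (h2 : p + 2 ≤ n) :
    0 < FF n (eidx m p) (zig n m (p + 1)) := by
  have key : ∀ d : ℤ, 0 < d → d < n → ¬ (n : ℤ) ∣ d := fun d hd hd' h => by
    have := Int.le_of_dvd hd h
    omega
  rw [zig]
  obtain ⟨i, rfl | rfl⟩ := Nat.even_or_odd' p
  · have a1 : ¬ Even (2 * i + 1) := by simp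
    have a2 : (2 * i + 1) / 2 = i := by omega
    have a3 : 2 * i / 2 = i := by omega
    simp only [zidx, eidx, a1, a2, a3, even_two_mul, if_true, if_false]
    apply FF_V_pos
    · rw [← Int.dvd_neg]; apply key <;> omega
    · rw [← Int.dvd_neg]; apply key <;> omega
  · have a1 : ¬ Even (2 * i + 1) := by simp
    have a4 : Even (2 * i + 1 + 1) := ⟨i + 1, by ring⟩
    have a2 : (2 * i + 1 + 1) / 2 = i + 1 := by omega
    simp only [zidx, eidx, a1, a2, a4, if_true, if_false]
    apply FF_V_pos
    · apply key <;> push_cast <;> omega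
    · apply key <;> push_cast <;> omega

theorem FF_zig_eidx (m : ℤ) (p : ℕ) : FF n (eidx m p) (zig n m p) = 0 ∧
    FF n (eidx m p) (zig n m (p + 2)) = 0 := by
  rcases zig_endpoints (n := n) m p with ⟨h1, h2⟩ | ⟨h1, h2⟩ <;> rw [h1, h2] <;> constructor <;>
    · rw [FF_V_eq_zero_iff]; simp

/-- Both sides are affine in the parameters, vanish at the two ends of the third side and agree at
the apex. The factor `lam p * lam (p + 1)` avoids divisions by lengths that may vanish. -/
theorem FF_Tri (m : ℤ) (p : ℕ) (s t : ℝ) :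
    FF n (eidx m p) (Tri n m p s t) * (lam n p * lam n (p + 1)) =
    FF n (eidx m p) (zig n m (p + 1)) *
      (lam n p * lam n (p + 1) - (s * lam n (p + 1) + t * lam n p)) := by
  obtain ⟨h1, h2⟩ := FF_zig_eidx (n := n) m p
  have e : zig n m p = zig n m (p + 1) + (-lam n p) • del n m p := by
    rw [zig_succ m p]; module
  have e' : Tri n m p s t = zig n m (p + 1) + (-s) • del n m p + t • del n m (p + 1) := by
    rw [Tri]; module
  have lin : ∀ (a u : Plane) (c : ℝ), crs a (c • u) = c * crs a u := by
    intro a u c; simp [crs]; ring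
  rw [zig_succ m (p + 1), FF_add, lin] at h2
  rw [e, FF_add, lin] at h1
  rw [e', FF_add, FF_add, lin, lin]
  linear_combination s * lam n (p + 1) * h1 + t * lam n p * h2

variable [Fact (Odd n)]

theorem exists_Tri_of_FF (m : ℤ) {x : Plane} (hx : ∀ j, 0 ≤ FF n j x) :
    ∃ p s t, 1 ≤ p ∧ p + 2 ≤ n ∧ InTri n p s t ∧ x = Tri n m p s t := by
  obtain ⟨N, hN, hN1⟩ := exists_half (n := n)
  have hs := sin_ang_pos (n := n)
  -- `co (q + 1)` is constant along the `q`-th step of the zigzag, so the sign of `G q` tells on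
  -- which side of that step `x` lies. The steps `1` and `n - 1` are edges of the polygon, which
  -- fixes the signs of `G 1` and `G (n - 1)`.
  let G : ℕ → ℝ := fun q => co n m (q + 1) x - co n m (q + 1) (zig n m q)
  have G1 : 0 ≤ G 1 := by
    have := hx m
    have e : FF n m x = Real.sin (ang n) * G 1 := by
      simp only [G]
      rw [← map_sub, co_apply, zig_one]
      simp only [zig, zidx, FF]
      simp
      field_simp
    rw [e] at this
    exact nonneg_of_mul_nonneg_right this hs
  have Gn : G (n - 1) ≤ 0 := by
    have := hx (m + N)
    have e : FF n (m + N) x = -(Real.sin (ang n) * G (n - 1)) := by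
      have e0 : n - 1 = 2 * N := by omega
      -- This uses `2 (m + N) = (2 m - 1) + n`: the last edge is parallel to the even steps because
      -- `n` is odd.
      have e1 : 2 * ((m + N : ℤ) : ℝ) * ang n = (2 * m - 1) * ang n + Real.pi := by
        have h : (n : ℝ) = 2 * N + 1 := by exact_mod_cast hN
        rw [← n_mul_ang (n := n)]
        rw [h]; push_cast; ring
      have e2 : ¬ Even (2 * N + 1) := by simp
      have e3 : 2 * N / 2 = N := by omega
      simp only [G, e0]
      rw [← map_sub, co_apply]
      simp only [zig, zidx, FF, e1, dir_add_pi, e2, e3, if_false, even_two_mul, if_true]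
      simp [crs]
      field_simp
      ring
    rw [e] at this
    have h2 : Real.sin (ang n) * G (n - 1) ≤ 0 := by linarith
    exact nonpos_of_mul_nonpos_right h2 hs
  -- A discrete intermediate value argument: `x` lies between two consecutive steps of the zigzag.
  -- The third inequality of the triangle is then the one for its polygon edge.
  obtain ⟨p, hp1, hp2, hG, hG'⟩ : ∃ p, 1 ≤ p ∧ p + 2 ≤ n ∧ 0 ≤ G p ∧ G (p + 1) ≤ 0 := by
    by_contra! hc
    have key : ∀ q, q + 2 ≤ n → 0 < G (q + 1) ∨ q = 0 := by
      intro q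
      induction q with
      | zero => intro _; right; rfl
      | succ q ih =>
        intro hq
        left
        refine hc (q + 1) (by omega) (by omega) ?_
        rcases ih (by omega) with h | rfl
        · exact h.le
        · exact G1
    rcases key (n - 2) (by omega) with h | h
    · rw [show n - 2 + 1 = n - 1 by omega] at h; linarith
    · omega
  have hl0 : 0 < lam n p := lam_pos (by omega) (by omega)
  have hl1 : 0 < lam n (p + 1) := lam_pos (by omega) (by omega)
  have ht : 0 ≤ co n m (p + 1) x - co n m (p + 1) (zig n m (p + 1)) := by
    rw [co_succ_zig_succ]; exact hG
  have hs' : 0 ≤ co n m p (zig n m (p + 1)) - co n m p x := by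
    have : G (p + 1) = co n m p x - co n m p (zig n m (p + 1)) := by
      simp only [G]; rw [show p + 1 + 1 = p + 2 by ring, co_add_two]
    linarith
  have ex := eq_Tri (n := n) m p x
  generalize co n m (p + 1) x - co n m (p + 1) (zig n m (p + 1)) = t at ht ex
  generalize co n m p (zig n m (p + 1)) - co n m p x = s at hs' ex
  have hF := FF_Tri (n := n) m p s t
  rw [← ex] at hF
  have h0 := FF_zig_pos (n := n) m hp1 hp2
  have hle : s * lam n (p + 1) + t * lam n p ≤ lam n p * lam n (p + 1) := by
    have : 0 ≤ FF n (eidx m p) (zig n m (p + 1)) *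
      (lam n p * lam n (p + 1) - (s * lam n (p + 1) + t * lam n p)) := by
      rw [← hF]; exact mul_nonneg (hx _) (by positivity)
    have := nonneg_of_mul_nonneg_right this h0
    linarith
  refine ⟨p, s, t, hp1, hp2, ⟨hs', ?_, ht, ?_, hle⟩, ex⟩
  · have : s * lam n (p + 1) ≤ lam n p * lam n (p + 1) := by nlinarith [mul_nonneg ht hl0.le]
    exact le_of_mul_le_mul_right this hl1
  · have : t * lam n p ≤ lam n (p + 1) * lam n p := by nlinarith [mul_nonneg hs' hl1.le]
    exact le_of_mul_le_mul_right this hl0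

theorem exists_Tri (m : ℤ) {x : Plane} (hx : x ∈ polygon n true) :
    ∃ p s t, 1 ≤ p ∧ p + 2 ≤ n ∧ InTri n p s t ∧ x = Tri n m p s t :=
  exists_Tri_of_FF m fun j => FF_nonneg j hx

theorem mem_polygon_of_FF {x : Plane} (hx : ∀ j, 0 ≤ FF n j x) : x ∈ polygon n true := by
  obtain ⟨p, s, t, h1, h2, h, rfl⟩ := exists_Tri_of_FF 0 hx
  exact Tri_mem _ (by omega) h

end Polygon

end DoubleGon

end

noncomputable section

namespace DoubleGon

/-! ### Points of the surface -/

section Points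

variable {n : ℕ} [Fact (3 ≤ n)]

/-- The sign that turns the upper polygon into the polygon `b`. -/
def sgn (b : Bool) : ℝ := if b then 1 else -1

@[simp] theorem sgn_true : sgn true = 1 := rfl

@[simp] theorem sgn_false : sgn false = -1 := rfl

@[simp] theorem sgn_mul_self (b : Bool) : sgn b * sgn b = 1 := by cases b <;> simp

@[simp] theorem sgn_not (b : Bool) : sgn (!b) = -sgn b := by cases b <;> simp

@[simp] theorem sgn_smul_sgn_smul (b : Bool) (x : Plane) : sgn b • sgn b • x = x := by
  rw [smul_smul, sgn_mul_self, one_smul]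

theorem sgn_smul_mem {b : Bool} {x : Plane} : sgn b • x ∈ polygon n b ↔ x ∈ polygon n true := by
  cases b <;> simp [mem_polygon_false]

theorem sgn_smul_mem_corners {b : Bool} {x : Plane} :
    sgn b • x ∈ corners n b ↔ x ∈ corners n true := by
  cases b <;> simp [mem_corners_false]

/-- The point of the polygon `b` that corresponds to the point `x` of the upper polygon. -/
def piece (b : Bool) (x : Plane) (hx : x ∈ polygon n true) : Pieces n :=
  ⟨(b, sgn b • x), sgn_smul_mem.2 hx⟩

open Classical in
/-- The point of the surface that comes from the point of the polygon `b` corresponding to the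
point `x` of the upper polygon. -/
def pt (n : ℕ) [Fact (3 ≤ n)] (b : Bool) (x : Plane) : Surface n :=
  if hx : x ∈ polygon n true then proj n (piece b x hx)
  else proj n (piece true (V n 0) (V_mem_polygon 0))

theorem pt_of_mem {b : Bool} {x : Plane} (hx : x ∈ polygon n true) :
    pt n b x = proj n (piece b x hx) := dif_pos hx

/-- The point of the upper polygon that corresponds to a point of one of the two polygons. -/
def base (p : Pieces n) : Plane := sgn p.1.1 • p.1.2

theorem base_mem (p : Pieces n) : base p ∈ polygon n true := by
  rw [base, ← sgn_smul_mem (b := p.1.1), sgn_smul_sgn_smul]; exact p.2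

theorem proj_eq_pt (p : Pieces n) : proj n p = pt n p.1.1 (base p) := by
  rw [pt_of_mem (base_mem p)]
  congr 1
  apply Subtype.ext
  simp [piece, base]

theorem exists_pt (X : Surface n) : ∃ b x, x ∈ polygon n true ∧ X = pt n b x := by
  induction X using Quot.ind with
  | _ p => exact ⟨p.1.1, base p, base_mem p, proj_eq_pt p⟩

/-- The relation between points of the polygons that are equal on the surface. -/
def Same (n : ℕ) (b : Bool) (x : Plane) (b' : Bool) (y : Plane) : Prop :=
  (b = b' ∧ x = y) ∨ (b' = !b ∧ ∃ k, x ∈ edge n k ∧ y = turn n k x) ∨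
    (x ∈ corners n true ∧ y ∈ corners n true)

theorem Same.symm {b b' : Bool} {x y : Plane} (h : Same n b x b' y) : Same n b' y b x := by
  rcases h with ⟨rfl, rfl⟩ | ⟨rfl, k, hk, rfl⟩ | ⟨h1, h2⟩
  · exact Or.inl ⟨rfl, rfl⟩
  · exact Or.inr (Or.inl ⟨by simp, k, turn_mem_edge hk, by rw [turn_turn]⟩)
  · exact Or.inr (Or.inr ⟨h2, h1⟩)

theorem Same.corner_iff {b b' : Bool} {x y : Plane} (h : Same n b x b' y) :
    x ∈ corners n true ↔ y ∈ corners n true := by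
  rcases h with ⟨rfl, rfl⟩ | ⟨rfl, k, hk, rfl⟩ | ⟨h1, h2⟩
  · rfl
  · exact (turn_mem_corners_iff hk).symm
  · exact iff_of_true h1 h2

/-- Away from the corners a point lies on at most one edge, so two successive gluings undo each
other; the corners form a single class. -/
theorem Same.trans {b b' b'' : Bool} {x y z : Plane} (h : Same n b x b' y)
    (h' : Same n b' y b'' z) : Same n b x b'' z := by
  by_cases hc : x ∈ corners n true
  · exact Or.inr (Or.inr ⟨hc, h'.corner_iff.1 (h.corner_iff.1 hc)⟩)
  have hcy : y ∉ corners n true := fun hy => hc (h.corner_iff.2 hy)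
  rcases h with ⟨rfl, rfl⟩ | ⟨rfl, k, hk, rfl⟩ | ⟨h1, h2⟩
  · exact h'
  · rcases h' with ⟨rfl, rfl⟩ | ⟨rfl, l, hl, rfl⟩ | ⟨h1, h2⟩
    · exact Or.inr (Or.inl ⟨rfl, k, hk, rfl⟩)
    · obtain rfl := edge_unique' (turn_mem_edge hk) hl hcy
      exact Or.inl ⟨by simp, by rw [turn_turn]⟩
    · exact absurd h1 hcy
  · exact absurd h1 hc

/-- After the lower polygon has been turned onto the upper one, the translation `x ↦ x - a - b`
becomes `x ↦ a + b - x`, the half-turn about the midpoint of the edge. -/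
theorem Glue.same {p q : Pieces n} (h : Glue n p q) : Same n p.1.1 (base p) q.1.1 (base q) := by
  obtain ⟨h1, h2, k, hk, hq⟩ := h
  refine Or.inr (Or.inl ⟨by rw [h1, h2]; rfl, k, ?_, ?_⟩)
  · simpa [base, h1] using hk
  · simp only [base, h1, h2, hq, turn]; simp; abel

theorem same_of_proj_eq {p q : Pieces n} (h : proj n p = proj n q) :
    Same n p.1.1 (base p) q.1.1 (base q) := by
  have h' := Quot.eqvGen_exact h
  clear h
  induction h' with
  | rel p q h => exact h.same
  | refl p => exact Or.inl ⟨rfl, rfl⟩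
  | symm p q _ ih => exact ih.symm
  | trans p q r _ _ ih1 ih2 => exact ih1.trans ih2

theorem pt_turn {b : Bool} {k : Fin n} {x : Plane} (hx : x ∈ edge n k) :
    pt n (!b) (turn n k x) = pt n b x := by
  have h1 := edge_subset_polygon k hx
  have h2 := edge_subset_polygon k (turn_mem_edge hx)
  rw [pt_of_mem h1, pt_of_mem h2]
  cases b
  · apply Quot.sound
    refine ⟨rfl, rfl, k, ?_, ?_⟩
    · simpa [piece] using turn_mem_edge hx
    · simp [piece, turn]; abel
  · symm
    apply Quot.sound
    refine ⟨rfl, rfl, k, ?_, ?_⟩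
    · simpa [piece] using hx
    · simp [piece, turn]; abel

variable [Fact (Odd n)]

theorem pt_V_not_succ (b : Bool) (j : ℤ) : pt n (!b) (V n (j + 1)) = pt n b (V n j) := by
  rw [← pt_turn (b := b) (k := lbl n j) (x := V n j), turn_lbl]
  · congr 1; simp
  · rw [edge_lbl]; exact left_mem_segment _ _ _

/-- Each gluing moves to the next corner and changes the polygon. Once around the polygon is an odd
number `n` of gluings, so the same corner is reached in the other polygon; hence the surface has
only one vertex. -/
theorem pt_V_not (b : Bool) (j : ℤ) : pt n (!b) (V n j) = pt n b (V n j) := by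
  obtain ⟨N, hN, -⟩ := exists_half (n := n)
  have key : ∀ i : ℕ, pt n b (V n (j + 2 * i)) = pt n b (V n j) := by
    intro i
    induction i with
    | zero => simp
    | succ i ih =>
      have h1 := pt_V_not_succ b (j + 2 * i) (n := n)
      have h2 := pt_V_not_succ (!b) (j + 2 * i + 1) (n := n)
      rw [Bool.not_not] at h2
      push_cast
      rw [show j + 2 * ((i : ℤ) + 1) = j + 2 * i + 1 + 1 by ring, h2, h1, ih]
  have h := pt_V_not_succ b (j + 2 * N) (n := n)
  rw [key, show j + 2 * (N : ℤ) + 1 = j + n by rw [hN]; push_cast; ring, V_add_n] at h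
  exact h

theorem pt_V_eq (b : Bool) (j : ℤ) : pt n b (V n j) = pt n true (V n 0) := by
  have step : ∀ b (j : ℤ), pt n b (V n (j + 1)) = pt n b (V n j) := by
    intro b j
    rw [← pt_V_not, pt_V_not_succ]
  have key : ∀ j : ℤ, pt n b (V n j) = pt n b (V n 0) := by
    intro j
    induction j using Int.induction_on with
    | zero => rfl
    | succ i ih => rw [step, ih]
    | pred i ih => rw [← ih, ← step]; simp
  rw [key]
  cases b
  · exact pt_V_not true 0
  · rfl

theorem pt_corner {b b' : Bool} {x y : Plane} (hx : x ∈ corners n true)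
    (hy : y ∈ corners n true) : pt n b x = pt n b' y := by
  obtain ⟨i, rfl⟩ := mem_corners_iff.1 hx
  obtain ⟨j, rfl⟩ := mem_corners_iff.1 hy
  rw [pt_V_eq, pt_V_eq b']

theorem pt_eq_iff {b b' : Bool} {x y : Plane} (hx : x ∈ polygon n true)
    (hy : y ∈ polygon n true) : pt n b x = pt n b' y ↔ Same n b x b' y := by
  constructor
  · intro h
    rw [pt_of_mem hx, pt_of_mem hy] at h
    simpa [piece, base] using same_of_proj_eq h
  · rintro (⟨rfl, rfl⟩ | ⟨rfl, k, hk, rfl⟩ | ⟨h1, h2⟩)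
    · rfl
    · rw [pt_turn hk]
    · exact pt_corner h1 h2

theorem isVertex_pt {b : Bool} {x : Plane} (hx : x ∈ polygon n true) :
    IsVertex n (pt n b x) ↔ x ∈ corners n true := by
  constructor
  · rintro ⟨p, hp, hc⟩
    rw [proj_eq_pt, pt_eq_iff (base_mem p) hx] at hp
    rw [← hp.corner_iff, ← sgn_smul_mem_corners (b := p.1.1)]
    simpa [base] using hc
  · intro h
    refine ⟨piece b x hx, (pt_of_mem hx).symm, ?_⟩
    exact sgn_smul_mem_corners.2 h

theorem pt_inj {b : Bool} {x y : Plane} (hx : x ∈ polygon n true) (hy : y ∈ polygon n true)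
    (hc : x ∉ corners n true) (h : pt n b x = pt n b y) : x = y := by
  rcases (pt_eq_iff hx hy).1 h with h | ⟨h, -⟩ | ⟨h, -⟩
  · exact h.2
  · simp at h
  · exact absurd h hc

theorem onEdge_pt_of_mem {b : Bool} {k : Fin n} {x : Plane} (hx : x ∈ edge n k) :
    OnEdge n k (pt n b x) := by
  cases b
  · rw [← pt_turn hx]
    have h := edge_subset_polygon k (turn_mem_edge hx)
    refine ⟨piece true (turn n k x) h, ?_, rfl, ?_⟩
    · rw [← pt_of_mem]; rfl
    · simpa [piece] using turn_mem_edge hx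
  · exact ⟨piece true x (edge_subset_polygon k hx), (pt_of_mem _).symm, rfl, by simpa [piece]⟩

theorem onEdge_pt_iff {b : Bool} {k : Fin n} {x : Plane} (hx : x ∈ polygon n true)
    (hc : x ∉ corners n true) : OnEdge n k (pt n b x) ↔ x ∈ edge n k := by
  refine ⟨?_, onEdge_pt_of_mem⟩
  rintro ⟨p, hp, hb, hk⟩
  rw [proj_eq_pt, hb, pt_eq_iff (base_mem p) hx] at hp
  have hk' : base p ∈ edge n k := by simpa [base, hb] using hk
  have hcp : base p ∉ corners n true := fun h => hc (hp.corner_iff.1 h)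
  rcases hp with ⟨-, h⟩ | ⟨-, l, hl, h⟩ | ⟨h, -⟩
  · rwa [← h]
  · obtain rfl := edge_unique' hl hk' hcp
    rw [h]; exact turn_mem_edge hl
  · exact absurd h hcp

theorem onEdge_unique {k l : Fin n} {X : Surface n} (hX : ¬ IsVertex n X) (hk : OnEdge n k X)
    (hl : OnEdge n l X) : k = l := by
  obtain ⟨b, x, hx, rfl⟩ := exists_pt X
  rw [isVertex_pt hx] at hX
  rw [onEdge_pt_iff hx hX] at hk hl
  exact edge_unique' hk hl hX

theorem disp_iff {X Y : Surface n} {u : Plane} : Disp n X u Y ↔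
    ∃ b x, x ∈ polygon n true ∧ x + sgn b • u ∈ polygon n true ∧ X = pt n b x ∧
      Y = pt n b (x + sgn b • u) := by
  constructor
  · rintro ⟨p, q, hpq, hu, rfl, rfl⟩
    have e : base q = base p + sgn p.1.1 • u := by
      rw [base, base, ← hpq, hu, smul_add]
    refine ⟨p.1.1, base p, base_mem p, ?_, proj_eq_pt p, ?_⟩
    · rw [← e]; exact base_mem q
    · rw [← e, hpq]; exact proj_eq_pt q
  · rintro ⟨b, x, hx, hy, rfl, rfl⟩
    refine ⟨piece b x hx, piece b _ hy, rfl, ?_, (pt_of_mem hx).symm, (pt_of_mem hy).symm⟩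
    simp [piece, smul_add]

theorem disp_pt {b : Bool} {x y u : Plane} (hx : x ∈ polygon n true) (hy : y ∈ polygon n true)
    (h : y = x + sgn b • u) : Disp n (pt n b x) u (pt n b y) :=
  disp_iff.2 ⟨b, x, hx, h ▸ hy, rfl, by rw [h]⟩

theorem Disp.symm {X Y : Surface n} {u : Plane} (h : Disp n X u Y) : Disp n Y (-u) X := by
  obtain ⟨p, q, h1, h2, h3, h4⟩ := h
  exact ⟨q, p, h1.symm, by rw [h2]; simp, h4, h3⟩

theorem continuousOn_pt (b : Bool) : ContinuousOn (pt n b) (polygon n true) := by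
  rw [continuousOn_iff_continuous_domRestrict]
  have : (polygon n true).domRestrict (pt n b) = fun x => proj n (piece b x.1 x.2) := by
    funext x; exact pt_of_mem x.2
  rw [this]
  apply continuous_quot_mk.comp
  unfold piece
  fun_prop

theorem continuous_of_pt {Z : Type*} [TopologicalSpace Z] {f : Surface n → Z}
    (h : ∀ b, ContinuousOn (fun x => f (pt n b x)) (polygon n true)) : Continuous f := by
  have hq : IsQuotientMap (Quot.mk (Glue n)) := isQuotientMap_quot_mk
  rw [hq.continuous_iff]
  have h1 : Continuous (fun q : Bool × polygon n true => f (pt n q.1 q.2.1)) := by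
    rw [continuous_prod_of_discrete_left]
    intro b
    exact (continuousOn_iff_continuous_domRestrict.1 (h b))
  have hsg : Continuous sgn := continuous_of_discreteTopology
  have h2 : Continuous (fun p : Pieces n => ((p.1.1, ⟨base p, base_mem p⟩) :
      Bool × polygon n true)) := by
    unfold base
    fun_prop
  convert h1.comp h2 using 1
  funext p
  exact congrArg f (proj_eq_pt p)

/-! #### The half-turn -/

theorem exists_halfTurn : ∃ ι : Surface n ≃ₜ Surface n,
    ∀ b x, x ∈ polygon n true → ι (pt n b x) = pt n (!b) x := by
  have key : ∀ X : Surface n, ∃ Y, ∀ b x, x ∈ polygon n true → X = pt n b x → Y = pt n (!b) x := by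
    intro X
    obtain ⟨b, x, hx, rfl⟩ := exists_pt X
    refine ⟨pt n (!b) x, fun b' y hy h => ?_⟩
    rw [pt_eq_iff hx hy] at h
    rw [pt_eq_iff hx hy]
    rcases h with ⟨rfl, rfl⟩ | ⟨rfl, k, hk, rfl⟩ | ⟨h1, h2⟩
    · exact Or.inl ⟨rfl, rfl⟩
    · exact Or.inr (Or.inl ⟨rfl, k, hk, rfl⟩)
    · exact Or.inr (Or.inr ⟨h1, h2⟩)
  choose f hf using key
  have hf' : ∀ b x, x ∈ polygon n true → f (pt n b x) = pt n (!b) x := fun b x hx =>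
    hf _ b x hx rfl
  have hinv : Function.Involutive f := by
    intro X
    obtain ⟨b, x, hx, rfl⟩ := exists_pt X
    rw [hf' b x hx, hf' _ x hx, Bool.not_not]
  have hcont : Continuous f := continuous_of_pt fun b =>
    (continuousOn_pt (!b)).congr fun x hx => hf' b x hx
  exact ⟨⟨hinv.toPerm f, hcont, hcont⟩, hf'⟩

/-- The half-turn, which exchanges the two polygons. -/
def halfTurn (n : ℕ) [Fact (3 ≤ n)] [Fact (Odd n)] : Surface n ≃ₜ Surface n :=
  exists_halfTurn.choose

theorem halfTurn_pt {b : Bool} {x : Plane} (hx : x ∈ polygon n true) :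
    halfTurn n (pt n b x) = pt n (!b) x := exists_halfTurn.choose_spec b x hx

theorem halfTurn_halfTurn (X : Surface n) : halfTurn n (halfTurn n X) = X := by
  obtain ⟨b, x, hx, rfl⟩ := exists_pt X
  rw [halfTurn_pt hx, halfTurn_pt hx, Bool.not_not]

theorem isVertex_halfTurn (X : Surface n) : IsVertex n (halfTurn n X) ↔ IsVertex n X := by
  obtain ⟨b, x, hx, rfl⟩ := exists_pt X
  rw [halfTurn_pt hx, isVertex_pt hx, isVertex_pt hx]

theorem OnEdge.halfTurn {k : Fin n} {X : Surface n} (h : OnEdge n k X) :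
    OnEdge n k (halfTurn n X) := by
  obtain ⟨p, rfl, hb, hk⟩ := h
  have hk' : base p ∈ edge n k := by simpa [base, hb] using hk
  rw [proj_eq_pt, halfTurn_pt (base_mem p)]
  exact onEdge_pt_of_mem hk'

theorem onEdge_halfTurn {k : Fin n} {X : Surface n} :
    OnEdge n k (halfTurn n X) ↔ OnEdge n k X :=
  ⟨fun h => by simpa [halfTurn_halfTurn] using h.halfTurn, OnEdge.halfTurn⟩

theorem Disp.halfTurn {X Y : Surface n} {u : Plane} (h : Disp n X u Y) :
    Disp n (halfTurn n X) (-u) (halfTurn n Y) := by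
  obtain ⟨b, x, hx, hy, rfl, rfl⟩ := disp_iff.1 h
  rw [halfTurn_pt hx, halfTurn_pt hy]
  exact disp_pt hx hy (by simp)

end Points

end DoubleGon

end

noncomputable section

namespace DoubleGon

/-! ### Local structure and straight paths -/

section Paths

variable {n : ℕ} [Fact (3 ≤ n)]

theorem FF_congr {i j : ℤ} (h : (n : ℤ) ∣ i - j) : FF n i = FF n j := by
  obtain ⟨c, hc⟩ := h
  have hi : i = j + c * n := by linarith
  funext x
  rw [FF, FF, V_congr ⟨c, hc⟩]
  congr 1
  rw [hi, ← dir_add_int_mul_two_pi (2 * (j : ℝ) * ang n) c, ← n_mul_ang (n := n)]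
  congr 1; push_cast; ring

theorem eventually_FF_pos (x : Plane) : ∀ᶠ y in 𝓝 x, ∀ i : ℤ, 0 < FF n i x → 0 < FF n i y := by
  have h : ∀ᶠ y in 𝓝 x, ∀ k : Fin n, 0 < FF n (k : ℕ) x → 0 < FF n (k : ℕ) y := by
    rw [eventually_all]
    intro k
    by_cases hk : 0 < FF n (k : ℕ) x
    · filter_upwards [(continuous_FF _).continuousAt.eventually (lt_mem_nhds hk)] with y hy _
      exact hy
    · exact Eventually.of_forall fun y h => absurd h hk
  filter_upwards [h] with y hy i hi
  have e : FF n i = FF n ((lbl n i : ℕ) : ℤ) := FF_congr (lbl_dvd i)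
  rw [e] at hi ⊢
  exact hy _ hi

theorem exists_FF_eq_zero_of_corner {x : Plane} (hx : x ∈ corners n true) (j : ℤ) :
    ∃ i, lbl n i ≠ lbl n j ∧ FF n i x = 0 := by
  have h3 : 3 ≤ n := three_le
  obtain ⟨l, rfl⟩ := mem_corners_iff.1 hx
  by_cases h : lbl n l = lbl n j
  · refine ⟨l - 1, ?_, (FF_V_eq_zero_iff _ _).2 (by simp)⟩
    rw [← h, Ne, lbl_eq_iff]
    intro hd
    rw [show l - 1 - l = -1 by ring, Int.dvd_neg] at hd
    have := Int.le_of_dvd (by norm_num) hd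
    omega
  · exact ⟨l, h, (FF_V_eq_zero_iff _ _).2 (by simp)⟩

theorem FF_pos_of_edge {x : Plane} {j i : ℤ} (hx : x ∈ edge n (lbl n j))
    (hc : x ∉ corners n true) (hi : lbl n i ≠ lbl n j) : 0 < FF n i x := by
  rcases FF_pos_or_mem_edge i (edge_subset_polygon _ hx) with h | h
  · exact h
  · exact absurd (edge_unique h hx hc) hi

theorem FF_turn (j : ℤ) (x : Plane) : FF n j (turn n (lbl n j) x) = -FF n j x := by
  rw [turn_lbl, V_add_one]
  simp only [FF, crs, Pi.add_apply, Pi.sub_apply]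
  ring

theorem turn_add (k : Fin n) (x u : Plane) : turn n k (x + u) = turn n k x - u := by
  simp only [turn]; abel

variable [Fact (Odd n)]

theorem mem_polygon_of_FF_edge {y : Plane} {j : ℤ} (h : ∀ i, lbl n i ≠ lbl n j → 0 < FF n i y)
    (hj : 0 ≤ FF n j y) : y ∈ polygon n true := by
  apply mem_polygon_of_FF
  intro i
  by_cases hi : lbl n i = lbl n j
  · rw [FF_congr (lbl_eq_iff.1 hi)]; exact hj
  · exact (h i hi).le

theorem interior_or_edge {X : Surface n} (hX : ¬ IsVertex n X) :
    ∃ b x, x ∈ polygon n true ∧ x ∉ corners n true ∧ X = pt n b x ∧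
      ((∀ i, 0 < FF n i x) ∨ ∃ j, x ∈ edge n (lbl n j)) := by
  obtain ⟨b, x, hx, rfl⟩ := exists_pt X
  rw [isVertex_pt hx] at hX
  refine ⟨b, x, hx, hX, rfl, ?_⟩
  by_cases h : ∃ j, x ∈ edge n (lbl n j)
  · exact Or.inr h
  · left
    intro i
    exact (FF_pos_or_mem_edge i hx).resolve_right fun hi => h ⟨i, hi⟩

theorem eq_of_pt_eq_interior {b b' : Bool} {x y : Plane} (hx : ∀ i, 0 < FF n i x)
    (hy : y ∈ polygon n true) (h : pt n b x = pt n b' y) : b = b' ∧ x = y := by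
  have hxP : x ∈ polygon n true := mem_polygon_of_FF fun i => (hx i).le
  rcases (pt_eq_iff hxP hy).1 h with h | ⟨-, k, hk, -⟩ | ⟨h, -⟩
  · exact h
  · obtain ⟨j, rfl⟩ := exists_lbl k
    exact absurd (FF_eq_zero_of_mem_edge hk) (hx j).ne'
  · obtain ⟨i, -, hi⟩ := exists_FF_eq_zero_of_corner h 0
    exact absurd hi (hx i).ne'

/-- A displacement inside a chart is determined by the chart, uniformly near its centre. -/
theorem exists_chart {X : Surface n} (hX : ¬ IsVertex n X) :
    ∃ δ > 0, ∃ c : Plane → Surface n, c 0 = X ∧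
      ∀ u w Y, ‖u‖ < δ → ‖w‖ < δ → Disp n (c u) w Y → Y = c (u + w) := by
  obtain ⟨b, x, hx, hc, rfl, h_int | ⟨j, hj⟩⟩ := interior_or_edge hX
  · obtain ⟨ε, hε, hball⟩ := Metric.eventually_nhds_iff.1 (eventually_FF_pos (n := n) x)
    refine ⟨ε, hε, fun u => pt n b (x + sgn b • u), by simp, fun u w Y hu hw hD => ?_⟩
    obtain ⟨b', y, hy, hyw, h1, rfl⟩ := disp_iff.1 hD
    have hi : ∀ i, 0 < FF n i (x + sgn b • u) := fun i => by
      refine hball ?_ i (h_int i)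
      rw [dist_eq_norm, add_sub_cancel_left, norm_smul]
      cases b <;> simpa using hu
    obtain ⟨rfl, rfl⟩ := eq_of_pt_eq_interior hi hy h1
    simp only [smul_add, add_assoc]
  · have hx' := turn_mem_edge hj
    have hc' : turn n (lbl n j) x ∉ corners n true := fun h => hc ((turn_mem_corners_iff hj).1 h)
    obtain ⟨ε, hε, hball⟩ := Metric.eventually_nhds_iff.1 (eventually_FF_pos (n := n) x)
    obtain ⟨ε', hε', hball'⟩ := Metric.eventually_nhds_iff.1
      (eventually_FF_pos (n := n) (turn n (lbl n j) x))
    -- The chart at a point of an edge uses the polygon `b` on the inner side of the edge and the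
    -- glued point of the other polygon beyond it; the two formulas agree on the edge itself.
    let c : Plane → Surface n := fun u => if 0 ≤ FF n j (x + sgn b • u) then
      pt n b (x + sgn b • u) else pt n (!b) (turn n (lbl n j) (x + sgn b • u))
    have near : ∀ u, ‖u‖ < ε → ∀ i, lbl n i ≠ lbl n j → 0 < FF n i (x + sgn b • u) := by
      intro u hu i hi
      refine hball ?_ i (FF_pos_of_edge hj hc hi)
      rw [dist_eq_norm, add_sub_cancel_left, norm_smul]
      cases b <;> simpa using hu
    have near' : ∀ u, ‖u‖ < ε' → ∀ i, lbl n i ≠ lbl n j →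
        0 < FF n i (turn n (lbl n j) (x + sgn b • u)) := by
      intro u hu i hi
      refine hball' ?_ i (FF_pos_of_edge hx' hc' hi)
      rw [turn_add, dist_eq_norm, sub_sub_cancel_left, norm_neg, norm_smul]
      cases b <;> simpa using hu
    have cpos : ∀ u, 0 ≤ FF n j (x + sgn b • u) → c u = pt n b (x + sgn b • u) := fun u h =>
      if_pos h
    have cneg : ∀ u, ‖u‖ < ε → FF n j (x + sgn b • u) ≤ 0 →
        c u = pt n (!b) (turn n (lbl n j) (x + sgn b • u)) := by
      intro u hu h
      rcases h.lt_or_eq with h | h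
      · exact if_neg (not_le.2 h)
      · have hP : x + sgn b • u ∈ polygon n true := mem_polygon_of_FF_edge (near u hu) h.ge
        rw [cpos u h.ge, pt_turn ((mem_edge_iff hP).2 h)]
    -- Halving the radius keeps `u + w` inside the ball where only the functional of this edge can
    -- change sign.
    refine ⟨min ε ε' / 2, by positivity, c, ?_, fun u w Y hu hw hD => ?_⟩
    · rw [cpos 0]
      · simp
      · simp [FF_eq_zero_of_mem_edge hj]
    have hmin1 := min_le_left ε ε'
    have hmin2 := min_le_right ε ε'
    have hu1 : ‖u‖ < ε := by linarith [norm_nonneg u]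
    have hu2 : ‖u‖ < ε' := by linarith [norm_nonneg u]
    have huw : ‖u + w‖ < ε := lt_of_le_of_lt (norm_add_le _ _) (by linarith)
    obtain ⟨b', y, hy, hyw, h1, rfl⟩ := disp_iff.1 hD
    have eadd : x + sgn b • (u + w) = x + sgn b • u + sgn b • w := by rw [smul_add, add_assoc]
    rcases le_or_gt 0 (FF n j (x + sgn b • u)) with h0 | h0
    · have hP := mem_polygon_of_FF_edge (near u hu1) h0
      rw [cpos u h0, pt_eq_iff hP hy] at h1
      rcases h1 with ⟨rfl, rfl⟩ | ⟨rfl, k, hk, rfl⟩ | ⟨h, -⟩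
      · rw [cpos (u + w), eadd]
        rw [eadd]; exact FF_nonneg _ hyw
      · obtain ⟨i, rfl⟩ := exists_lbl k
        have hij : lbl n i = lbl n j := by
          by_contra hne
          exact (near u hu1 i hne).ne' (FF_eq_zero_of_mem_edge hk)
        rw [hij] at hyw ⊢
        have e : turn n (lbl n j) (x + sgn b • u) + sgn (!b) • w
            = turn n (lbl n j) (x + sgn b • (u + w)) := by
          rw [eadd, turn_add _ (x + sgn b • u)]; simp; abel
        rw [e] at hyw ⊢
        have := FF_nonneg j hyw
        rw [FF_turn] at this
        rw [cneg (u + w) huw (by linarith)]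
      · obtain ⟨i, hi, hi0⟩ := exists_FF_eq_zero_of_corner h j
        exact absurd hi0 (near u hu1 i hi).ne'
    · rw [cneg u hu1 h0.le] at h1
      have h_int : ∀ i, 0 < FF n i (turn n (lbl n j) (x + sgn b • u)) := by
        intro i
        by_cases hi : lbl n i = lbl n j
        · rw [FF_congr (lbl_eq_iff.1 hi), FF_turn]; linarith
        · exact near' u hu2 i hi
      obtain ⟨rfl, rfl⟩ := eq_of_pt_eq_interior h_int hy h1
      have e : turn n (lbl n j) (x + sgn b • u) + sgn (!b) • w
            = turn n (lbl n j) (x + sgn b • (u + w)) := by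
          rw [eadd, turn_add _ (x + sgn b • u)]; simp; abel
      rw [e] at hyw ⊢
      have := FF_nonneg j hyw
      rw [FF_turn] at this
      rw [cneg (u + w) huw (by linarith)]

/-- Near a point that is not a vertex, edges are met only along the edge through the point. -/
theorem eventually_onEdge {X : Surface n} (hX : ¬ IsVertex n X) :
    (∀ᶠ u in 𝓝 (0 : Plane), ∀ Y, Disp n X u Y → ∀ k, ¬ OnEdge n k Y) ∨
    ∃ j b x, x ∉ corners n true ∧ x ∈ edge n (lbl n j) ∧ X = pt n b x ∧
      ∀ᶠ u in 𝓝 (0 : Plane), ∀ Y, Disp n X u Y → ∀ k, OnEdge n k Y →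
        crs (dir (2 * j * ang n)) u = 0 := by
  have tend : ∀ (b : Bool) (x : Plane), Tendsto (fun u => x + sgn b • u) (𝓝 (0 : Plane)) (𝓝 x) := by
    intro b x
    have : Continuous (fun u : Plane => x + sgn b • u) := by fun_prop
    simpa using this.tendsto 0
  obtain ⟨b, x, hx, hc, rfl, h_int | ⟨j, hj⟩⟩ := interior_or_edge hX
  · left
    filter_upwards [(tend b x).eventually (eventually_FF_pos (n := n) x)] with u hu Y hD k hk
    obtain ⟨b', y, hy, hyw, h1, rfl⟩ := disp_iff.1 hD
    obtain ⟨rfl, rfl⟩ := eq_of_pt_eq_interior h_int hy h1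
    have hcw : x + sgn b • u ∉ corners n true := fun h => by
      obtain ⟨i, -, hi⟩ := exists_FF_eq_zero_of_corner h 0
      exact (hu i (h_int i)).ne' hi
    rw [onEdge_pt_iff hyw hcw] at hk
    obtain ⟨i, rfl⟩ := exists_lbl k
    exact (hu i (h_int i)).ne' (FF_eq_zero_of_mem_edge hk)
  · right
    refine ⟨j, b, x, hc, hj, rfl, ?_⟩
    have key : ∀ (b : Bool) (x : Plane), x ∈ edge n (lbl n j) → x ∉ corners n true →
        ∀ᶠ u in 𝓝 (0 : Plane), x + sgn b • u ∈ polygon n true → ∀ k,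
          OnEdge n k (pt n b (x + sgn b • u)) → crs (dir (2 * j * ang n)) u = 0 := by
      intro b x hj hc
      filter_upwards [(tend b x).eventually (eventually_FF_pos (n := n) x)] with u hu hyw k hk
      have hcw : x + sgn b • u ∉ corners n true := fun h => by
        obtain ⟨i, hi, hi0⟩ := exists_FF_eq_zero_of_corner h j
        exact (hu i (FF_pos_of_edge hj hc hi)).ne' hi0
      rw [onEdge_pt_iff hyw hcw] at hk
      obtain ⟨i, rfl⟩ := exists_lbl k
      have h0 := FF_eq_zero_of_mem_edge hk
      by_cases hi : lbl n i = lbl n j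
      · rw [FF_congr (lbl_eq_iff.1 hi), FF_add, FF_eq_zero_of_mem_edge hj, zero_add] at h0
        simp only [crs, Pi.smul_apply, smul_eq_mul] at h0 ⊢
        cases b
        · simp only [sgn_false] at h0; linarith
        · simp only [sgn_true] at h0; linarith
      · exact absurd h0 (hu i (FF_pos_of_edge hj hc hi)).ne'
    have hc' : turn n (lbl n j) x ∉ corners n true := fun h => hc ((turn_mem_corners_iff hj).1 h)
    filter_upwards [key b x hj hc, key (!b) _ (turn_mem_edge hj) hc'] with u h1 h2 Y hD k hk
    obtain ⟨b', y, hy, hyw, h, rfl⟩ := disp_iff.1 hD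
    rcases (pt_eq_iff hx hy).1 h with ⟨rfl, rfl⟩ | ⟨rfl, l, hl, rfl⟩ | ⟨h, -⟩
    · exact h1 hyw k hk
    · obtain rfl := edge_unique' hl hj hc
      exact h2 hyw k hk
    · exact absurd h hc

/-- A curve on `[0, S]` that moves with constant velocity `v` in the charts. -/
def IsPath (n : ℕ) (γ : ℝ → Surface n) (v : Plane) (S : ℝ) : Prop :=
  ∀ t ∈ Set.Icc 0 S, ∀ᶠ h in 𝓝 (0 : ℝ), t + h ∈ Set.Icc 0 S → Disp n (γ t) (h • v) (γ (t + h))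

/-- In a chart the velocity determines the path both forwards and backwards from any nearby point,
so equality of the two paths propagates locally in both directions, and the interval is connected.
-/
theorem IsPath.eq {γ₁ γ₂ : ℝ → Surface n} {v : Plane} {S : ℝ} (h₁ : IsPath n γ₁ v S)
    (h₂ : IsPath n γ₂ v S) (hv : ∀ t ∈ Set.Icc 0 S, ¬ IsVertex n (γ₁ t)) (h0 : γ₁ 0 = γ₂ 0) :
    ∀ t ∈ Set.Icc 0 S, γ₁ t = γ₂ t := by
  intro t ht
  have hS : (0 : ℝ) ∈ Set.Icc 0 S := ⟨le_rfl, ht.1.trans ht.2⟩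
  refine isPreconnected_Icc.induction₂' (fun x y => γ₁ x = γ₂ x → γ₁ y = γ₂ y) ?_ ?_ hS ht h0
  · intro x hx
    obtain ⟨δ, hδ, c, hc0, hc⟩ := exists_chart (hv x hx)
    have tend : Tendsto (fun y : ℝ => y - x) (𝓝[Set.Icc 0 S] x) (𝓝 0) := by
      have : Continuous (fun y : ℝ => y - x) := by fun_prop
      have := this.tendsto x
      rw [sub_self] at this
      exact this.mono_left nhdsWithin_le_nhds
    have hsmall : ∀ᶠ h in 𝓝 (0 : ℝ), ‖h • v‖ < δ := by
      have : Continuous (fun h : ℝ => ‖h • v‖) := by fun_prop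
      exact this.continuousAt.eventually (gt_mem_nhds (by simpa using hδ))
    filter_upwards [tend.eventually (h₁ x hx), tend.eventually (h₂ x hx), tend.eventually hsmall,
      self_mem_nhdsWithin] with y a1 a2 a3 hy
    rw [add_sub_cancel] at a1 a2
    have b1 := a1 hy
    have b2 := a2 hy
    have e1 : γ₁ y = c ((y - x) • v) := by
      have := hc 0 ((y - x) • v) (γ₁ y) (by simpa using hδ) a3 (by rw [hc0]; exact b1)
      rwa [zero_add] at this
    constructor
    · intro hx
      rw [e1]
      have := hc 0 ((y - x) • v) (γ₂ y) (by simpa using hδ) a3 (by rw [hc0, hx]; exact b2)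
      rw [zero_add] at this
      exact this.symm
    · intro hxy
      have b3 := b2.symm
      rw [← hxy, e1] at b3
      have := hc _ _ _ a3 (by rwa [norm_neg]) b3
      rw [this, add_neg_cancel, hc0]
  · intro x y z _ _ _ h1 h2 h
    exact h2 (h1 h)

theorem isPath_pt {b : Bool} {x v : Plane} {S : ℝ} (hx : x ∈ polygon n true)
    (hy : x + S • (sgn b • v) ∈ polygon n true) (hS : 0 ≤ S) :
    IsPath n (fun r => pt n b (x + r • (sgn b • v))) v S := by
  have hmem : ∀ r ∈ Set.Icc 0 S, x + r • (sgn b • v) ∈ polygon n true := by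
    intro r hr
    rcases hS.eq_or_lt with rfl | hS
    · obtain rfl : r = 0 := le_antisymm hr.2 hr.1
      simpa using hx
    · have := (convex_polygon true).add_smul_mem hx hy (t := r / S)
        ⟨div_nonneg hr.1 hS.le, (div_le_one hS).2 hr.2⟩
      rwa [smul_smul, div_mul_cancel₀ _ hS.ne'] at this
  intro t ht
  refine Eventually.of_forall fun h hh => ?_
  refine disp_pt (hmem _ ht) (hmem _ hh) ?_
  rw [add_smul, add_assoc, smul_comm h]

theorem IsTrajectory.isPath {τ : ℝ → Surface n} {v : Plane} (h : IsTrajectory n τ v) (T S : ℝ) :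
    IsPath n (fun r => τ (T + r)) v S := fun t _ => by
  filter_upwards [(h (T + t)).2] with r hr _
  rwa [← add_assoc]

theorem IsTrajectory.eq_pt {τ : ℝ → Surface n} {v : Plane} (h : IsTrajectory n τ v) {T S : ℝ}
    {b : Bool} {x : Plane} (hx : x ∈ polygon n true)
    (hy : x + S • (sgn b • v) ∈ polygon n true) (hS : 0 ≤ S) (hT : τ T = pt n b x) :
    τ (T + S) = pt n b (x + S • (sgn b • v)) :=
  (h.isPath T S).eq (isPath_pt hx hy hS) (fun t _ => (h _).1) (by simpa using hT) S ⟨hS, le_rfl⟩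

/-- Crossing times are isolated, since the trajectory is transverse to every edge that it meets.
This is what later prevents crossing times from accumulating. -/
theorem IsTrajectory.eventually_not_onEdge {τ : ℝ → Surface n} {v : Plane}
    (h : IsTrajectory n τ v) (hv : v ≠ 0) (T : ℝ) :
    ∀ᶠ r in 𝓝[≠] (0 : ℝ), ∀ k, ¬ OnEdge n k (τ (T + r)) := by
  have tend : Tendsto (fun r : ℝ => r • v) (𝓝[≠] 0) (𝓝 0) := by
    have : Continuous (fun r : ℝ => r • v) := by fun_prop
    have := this.tendsto 0
    rw [zero_smul] at this
    exact this.mono_left nhdsWithin_le_nhds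
  have hD := (h T).2
  rcases eventually_onEdge (h T).1 with he | ⟨j, b, x, hc, hj, hX, he⟩
  · filter_upwards [tend.eventually he, hD.filter_mono nhdsWithin_le_nhds] with r h1 h2
    exact h1 _ h2
  -- A velocity parallel to the unit edge would carry the point along it to an endpoint, which is a
  -- vertex; `q` and `p` are the distances to the two endpoints.
  · by_cases hcr : crs (dir (2 * j * ang n)) v = 0
    · exfalso
      obtain ⟨c, hcv⟩ : ∃ c : ℝ, v = c • dir (2 * j * ang n) := by
        have hsq := Real.cos_sq_add_sin_sq (2 * j * ang n)
        refine ⟨Real.cos (2 * j * ang n) * v 0 + Real.sin (2 * j * ang n) * v 1, ?_⟩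
        simp only [crs, dir_zero_apply, dir_one_apply] at hcr
        apply plane_ext
        · simp only [Pi.smul_apply, smul_eq_mul, dir_zero_apply]
          linear_combination -v 0 * hsq - Real.sin (2 * j * ang n) * hcr
        · simp only [Pi.smul_apply, smul_eq_mul, dir_one_apply]
          linear_combination -v 1 * hsq + Real.cos (2 * j * ang n) * hcr
      have hc0 : c ≠ 0 := by rintro rfl; simp at hcv; exact hv hcv
      have hx := edge_subset_polygon _ hj
      have hj' := hj
      rw [edge_lbl, V_add_one] at hj'
      obtain ⟨p, q, hp, hq, hpq, hxe⟩ := hj'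
      have hit : ∀ S : ℝ, 0 ≤ S → x + S • (sgn b • v) ∈ corners n true → False := by
        intro S hS hcor
        have := h.eq_pt hx (corners_subset_polygon hcor) hS hX
        apply (h (T + S)).1
        rw [this, isVertex_pt (corners_subset_polygon hcor)]
        exact hcor
      have hsb : sgn b * c ≠ 0 := by cases b <;> simpa using hc0
      have ex : x = V n j + q • dir (2 * j * ang n) := by
        rw [← hxe, (by linarith : p = 1 - q)]; module
      rcases lt_or_gt_of_ne hsb with hneg | hpos
      · apply hit (-(q / (sgn b * c))) (by
          rw [← div_neg]; exact div_nonneg hq (by linarith))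
        have : x + (-(q / (sgn b * c))) • (sgn b • v) = V n j := by
          rw [hcv, ex, smul_smul (sgn b), smul_smul]
          have : -(q / (sgn b * c)) * (sgn b * c) = -q := by rw [neg_mul, div_mul_cancel₀ _ hsb]
          rw [this]; module
        rw [this]; exact V_mem_corners _
      · apply hit (p / (sgn b * c)) (div_nonneg hp hpos.le)
        have : x + (p / (sgn b * c)) • (sgn b • v) = V n (j + 1) := by
          rw [hcv, ex, smul_smul (sgn b), smul_smul, V_add_one]
          have : p / (sgn b * c) * (sgn b * c) = p := div_mul_cancel₀ _ hsb
          rw [this, (by linarith : p = 1 - q)]; module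
        rw [this]; exact V_mem_corners _
    · filter_upwards [tend.eventually he, hD.filter_mono nhdsWithin_le_nhds,
        self_mem_nhdsWithin] with r h1 h2 hr k hk
      have := h1 _ h2 k hk
      have e : crs (dir (2 * j * ang n)) (r • v) = r * crs (dir (2 * j * ang n)) v := by
        simp only [crs, Pi.smul_apply, smul_eq_mul]; ring
      rw [e] at this
      exact (mul_ne_zero hr hcr) this

end Paths

end DoubleGon

end

noncomputable section

namespace DoubleGon

/-! ### The parallelograms

The triangles at position `p` of the two polygons form a parallelogram with sides `lam p` and
`lam (p + 1)`, of which the edge at position `p` is a diagonal. -/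

section Parallelograms

variable {n : ℕ} [Fact (3 ≤ n)]

/-- The polygon that contains the lower half of the parallelogram at position `p`. -/
def par (p : ℕ) : Bool := decide (Even p)

theorem par_succ (p : ℕ) : par (p + 1) = !par p := by
  by_cases h : Even p <;> simp [par, h, Nat.even_add_one]

/-- The direction of the sides of length `lam p` of the parallelograms at positions `p` and
`p - 1`. -/
def drc (n : ℕ) (m : ℤ) (p : ℕ) : Plane := -(sgn (par p) • del n m p)

theorem drc_add_two (m : ℤ) (p : ℕ) : drc n m (p + 2) = drc n m p := by
  rw [drc, drc, del_add_two, par_succ, par_succ, Bool.not_not]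

/-- The parametrization of the parallelogram at position `p`. -/
def rho (n : ℕ) [Fact (3 ≤ n)] (m : ℤ) (p : ℕ) (s t : ℝ) : Surface n :=
  if s * lam n (p + 1) + t * lam n p ≤ lam n p * lam n (p + 1) then pt n (par p) (Tri n m p s t)
  else pt n (!par p) (Tri n m p (lam n p - s) (lam n (p + 1) - t))

/-- The parameters of the points of the parallelogram at position `p`. -/
structure InRect (n p : ℕ) (s t : ℝ) : Prop where
  s_nonneg : 0 ≤ s
  s_le : s ≤ lam n p
  t_nonneg : 0 ≤ t
  t_le : t ≤ lam n (p + 1)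

theorem InTri.inRect {p : ℕ} {s t : ℝ} (h : InTri n p s t) : InRect n p s t :=
  ⟨h.s_nonneg, h.s_le, h.t_nonneg, h.t_le⟩

theorem InRect.compl {p : ℕ} {s t : ℝ} (h : InRect n p s t) :
    InRect n p (lam n p - s) (lam n (p + 1) - t) :=
  ⟨by linarith [h.s_le], by linarith [h.s_nonneg], by linarith [h.t_le], by linarith [h.t_nonneg]⟩

theorem InRect.lower {p : ℕ} {s t : ℝ} (h : InRect n p s t)
    (hle : s * lam n (p + 1) + t * lam n p ≤ lam n p * lam n (p + 1)) : InTri n p s t :=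
  ⟨h.s_nonneg, h.s_le, h.t_nonneg, h.t_le, hle⟩

theorem InRect.upper {p : ℕ} {s t : ℝ} (h : InRect n p s t)
    (hle : lam n p * lam n (p + 1) ≤ s * lam n (p + 1) + t * lam n p) :
    InTri n p (lam n p - s) (lam n (p + 1) - t) :=
  h.compl.lower (by linarith)

theorem InRect.lower_or_upper {p : ℕ} {s t : ℝ} (h : InRect n p s t) :
    InTri n p s t ∨ InTri n p (lam n p - s) (lam n (p + 1) - t) :=
  (le_total _ _).imp h.lower h.upper

theorem rho_lower (m : ℤ) {p : ℕ} {s t : ℝ} (h : InTri n p s t) :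
    rho n m p s t = pt n (par p) (Tri n m p s t) := if_pos h.le

theorem turn_Tri (m : ℤ) (p : ℕ) (s t : ℝ) :
    turn n (lab n m p) (Tri n m p s t) = Tri n m p (lam n p - s) (lam n (p + 1) - t) := by
  rw [turn, vertex_lab_add, zig_succ m (p + 1), Tri, Tri]
  nth_rewrite 2 3 [zig_succ m p]
  nth_rewrite 1 [zig_succ m p]
  module

variable [Fact (Odd n)]

theorem Tri_mem_edge (m : ℤ) {p : ℕ} (hp : p < n) {s t : ℝ} (h : InTri n p s t)
    (he : s * lam n (p + 1) + t * lam n p = lam n p * lam n (p + 1)) :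
    Tri n m p s t ∈ edge n (lab n m p) := by
  have hP := Tri_mem m hp h
  rw [lab, mem_edge_iff hP]
  obtain ⟨z1, z2⟩ := FF_zig_eidx (n := n) m p
  have lin : ∀ (a u : Plane) (c : ℝ), crs a (c • u) = c * crs a u := by
    intro a u c; simp [crs]; ring
  rcases Nat.eq_zero_or_pos p with rfl | h0
  · have hs : s = 0 := le_antisymm (by have := h.s_le; rwa [lam_zero] at this) h.s_nonneg
    rw [zig_succ, FF_add, lin, zig_one, z1, lam_one, zero_add, one_mul] at z2
    rw [hs, Tri, zero_smul, sub_zero, FF_add, lin, zig_one, z1, z2, mul_zero, add_zero]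
  rcases Nat.lt_or_ge (p + 1) n with h1 | h1
  · have hF := FF_Tri (n := n) m p s t
    rw [he, sub_self, mul_zero] at hF
    have := lam_pos h0 hp
    have := lam_pos (n := n) (q := p + 1) (by omega) h1
    exact (mul_eq_zero.1 hF).resolve_right (by positivity)
  · obtain rfl : n = p + 1 := by omega
    have ht : t = 0 := le_antisymm (by have := h.t_le; rwa [lam_n] at this) h.t_nonneg
    have e : Tri (p + 1) m p s t = zig (p + 1) m (p + 1) + (-s) • del (p + 1) m p := by
      rw [ht, Tri]; module
    have e' : zig (p + 1) m p = zig (p + 1) m (p + 1) + (-lam (p + 1) p) • del (p + 1) m p := by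
      rw [zig_succ m p]; module
    rw [show p + 2 = p + 1 + 1 by ring, zig_n_add_one] at z2
    rw [e', FF_add, lin, z2, zero_add] at z1
    rw [e, FF_add, lin, z2, zero_add]
    have := (lam_pos h0 hp).ne'
    have := (mul_eq_zero.1 z1).resolve_left (by simpa using this)
    rw [this, mul_zero]

/-- On the common diagonal both formulas apply, and they agree because the gluing along this edge is
the half-turn that exchanges the two triangles. -/
theorem rho_upper (m : ℤ) {p : ℕ} (hp : p < n) {s t : ℝ}
    (h : InTri n p (lam n p - s) (lam n (p + 1) - t)) :
    rho n m p s t = pt n (!par p) (Tri n m p (lam n p - s) (lam n (p + 1) - t)) := by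
  by_cases hle : s * lam n (p + 1) + t * lam n p ≤ lam n p * lam n (p + 1)
  · have hr := h.inRect.compl
    rw [sub_sub_cancel, sub_sub_cancel] at hr
    have hl := hr.lower hle
    have := h.le
    rw [rho_lower m hl, ← turn_Tri, pt_turn]
    exact Tri_mem_edge m hp hl (by linarith)
  · exact if_neg hle

theorem exists_rho (m : ℤ) (X : Surface n) :
    ∃ p s t, 1 ≤ p ∧ p + 2 ≤ n ∧ InRect n p s t ∧ X = rho n m p s t := by
  obtain ⟨b, x, hx, rfl⟩ := exists_pt X
  obtain ⟨p, s, t, h1, h2, h, rfl⟩ := exists_Tri m hx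
  by_cases hb : b = par p
  · exact ⟨p, s, t, h1, h2, h.inRect, by rw [rho_lower m h, hb]⟩
  · refine ⟨p, _, _, h1, h2, h.inRect.compl, ?_⟩
    rw [rho_upper m (by omega), sub_sub_cancel, sub_sub_cancel, Bool.eq_not_of_ne hb]
    rwa [sub_sub_cancel, sub_sub_cancel]

theorem halfTurn_rho (m : ℤ) {p : ℕ} (hp : p < n) {s t : ℝ} (h : InRect n p s t) :
    halfTurn n (rho n m p s t) = rho n m p (lam n p - s) (lam n (p + 1) - t) := by
  rcases h.lower_or_upper with hl | hu
  · rw [rho_lower m hl, halfTurn_pt (Tri_mem m hp hl), rho_upper m hp] <;>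
      rw [sub_sub_cancel, sub_sub_cancel]
    exact hl
  · rw [rho_upper m hp hu, halfTurn_pt (Tri_mem m hp hu), rho_lower m hu, Bool.not_not]

/-- The right side lies in the polygon `par (p + 1)`, along the zigzag step shared by the triangles
`p` and `p + 1`. With `rho_top` this describes the chain: the right side of `p` is the bottom of `p
+ 1`, and the top of `p + 1` is the left side of `p`. -/
theorem rho_right (m : ℤ) {p : ℕ} (hp : p + 1 < n) {t : ℝ} (h0 : 0 ≤ t) (h1 : t ≤ lam n (p + 1)) :
    rho n m p (lam n p) t = rho n m (p + 1) t 0 := by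
  have hl0 : 0 ≤ lam n p := lam_nonneg (by omega)
  have hl2 : 0 ≤ lam n (p + 1 + 1) := lam_nonneg (by omega)
  have hR : InRect n p (lam n p) t := ⟨hl0, le_rfl, h0, h1⟩
  have hR' : InRect n (p + 1) t 0 := ⟨h0, h1, le_rfl, hl2⟩
  rw [rho_upper m (by omega) (hR.upper (by nlinarith)), rho_lower m (hR'.lower (by nlinarith)),
    par_succ, sub_self, ← Tri_succ, sub_sub_cancel]

theorem rho_top (m : ℤ) {p : ℕ} (hp : p + 1 < n) {s : ℝ} (h0 : 0 ≤ s) (h1 : s ≤ lam n (p + 1)) :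
    rho n m (p + 1) s (lam n (p + 2)) = rho n m p 0 s := by
  have hl0 : 0 ≤ lam n p := lam_nonneg (by omega)
  have hl2 : 0 ≤ lam n (p + 2) := lam_nonneg (by omega)
  have hR : InRect n (p + 1) s (lam n (p + 2)) := ⟨h0, h1, hl2, le_rfl⟩
  have hR' : InRect n p 0 s := ⟨le_rfl, hl0, h0, h1⟩
  rw [rho_upper m (by omega) (hR.upper (by
    rw [show p + 1 + 1 = p + 2 by ring]; nlinarith)), rho_lower m (hR'.lower (by nlinarith)),
    par_succ, Bool.not_not, ← Tri_succ, show p + 1 + 1 = p + 2 by ring, sub_self]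

theorem Tri_disp (m : ℤ) (p : ℕ) (s t s' t' : ℝ) : Tri n m p s' t' = Tri n m p s t +
    sgn (par p) • ((s' - s) • drc n m p + (t' - t) • drc n m (p + 1)) := by
  simp only [drc, par_succ, sgn_not, Tri]
  cases par p <;> simp <;> module

/-- The parametrization of a parallelogram is a local translation. -/
theorem rho_disp (m : ℤ) {p : ℕ} (hp : p < n) {s t : ℝ} (h : InRect n p s t) :
    ∀ᶠ w in 𝓝 (s, t), InRect n p w.1 w.2 → Disp n (rho n m p s t)
      ((w.1 - s) • drc n m p + (w.2 - t) • drc n m (p + 1)) (rho n m p w.1 w.2) := by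
  have low : ∀ s' t', InTri n p s t → InTri n p s' t' → Disp n (rho n m p s t)
      ((s' - s) • drc n m p + (t' - t) • drc n m (p + 1)) (rho n m p s' t') := by
    intro s' t' h h'
    rw [rho_lower m h, rho_lower m h']
    exact disp_pt (Tri_mem m hp h) (Tri_mem m hp h') (Tri_disp m p s t s' t')
  have upp : ∀ s' t', InTri n p (lam n p - s) (lam n (p + 1) - t) →
      InTri n p (lam n p - s') (lam n (p + 1) - t') → Disp n (rho n m p s t)
      ((s' - s) • drc n m p + (t' - t) • drc n m (p + 1)) (rho n m p s' t') := by
    intro s' t' h h'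
    rw [rho_upper m hp h, rho_upper m hp h']
    refine disp_pt (Tri_mem m hp h) (Tri_mem m hp h') ?_
    rw [Tri_disp m p (lam n p - s) (lam n (p + 1) - t), sgn_not]
    module
  have hcont : Continuous (fun w : ℝ × ℝ => w.1 * lam n (p + 1) + w.2 * lam n p) := by fun_prop
  rcases lt_trichotomy (s * lam n (p + 1) + t * lam n p) (lam n p * lam n (p + 1)) with h1 | h1 | h1
  · filter_upwards [hcont.continuousAt.eventually (gt_mem_nhds h1)] with w hw hR
    exact low _ _ (h.lower h1.le) (hR.lower hw.le)
  · refine Eventually.of_forall fun w hR => ?_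
    rcases hR.lower_or_upper with h2 | h2
    · exact low _ _ (h.lower h1.le) h2
    · exact upp _ _ (h.upper h1.ge) h2
  · filter_upwards [hcont.continuousAt.eventually (lt_mem_nhds h1)] with w hw hR
    exact upp _ _ (h.upper h1.le) (hR.upper hw.le)

/-- By `co_zig_mono`, a vertex before the apex has both coordinates at most those of `zig p`, and a
vertex after it at least those of `zig (p + 2)`. In the triangle only these two points satisfy such
bounds. -/
theorem Tri_mem_corners (m : ℤ) {p : ℕ} (hp : p < n) {s t : ℝ} (h : InTri n p s t)
    (hc : Tri n m p s t ∈ corners n true) :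
    (s = 0 ∧ t = 0) ∨ (s = lam n p ∧ t = 0) ∨ (s = 0 ∧ t = lam n (p + 1)) := by
  obtain ⟨i, hi⟩ := mem_corners_iff.1 hc
  obtain ⟨q, -, hq2, hq⟩ := exists_zig (n := n) m i
  rw [hq] at hi
  have c1 := congrArg (co n m p) hi
  have c2 := congrArg (co n m (p + 1)) hi
  rw [co_Tri] at c1
  rw [co_succ_Tri] at c2
  have e1 := co_zig_succ (n := n) m p
  have e2 := co_succ_zig_succ (n := n) m p
  have e3 := co_zig_succ (n := n) m (p + 1)
  have e4 := co_succ_zig_succ (n := n) m (p + 1)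
  rw [show p + 1 + 1 = p + 2 by ring] at e3 e4
  rw [co_add_two] at e4
  have := h.s_nonneg
  have := h.t_nonneg
  have := h.s_le
  have := h.t_le
  rcases lt_trichotomy q (p + 1) with hlt | rfl | hlt
  · have m1 := co_zig_mono (n := n) m p (i := q) (j := p) (by omega) (by omega)
    have m2 := co_zig_mono (n := n) m (p + 1) (i := q) (j := p) (by omega) (by omega)
    right; left; constructor <;> linarith
  · left; constructor <;> linarith
  · have m1 := co_zig_mono (n := n) m p (i := p + 2) (j := q) (by omega) (by omega)
    have m2 := co_zig_mono (n := n) m (p + 1) (i := p + 2) (j := q) (by omega) (by omega)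
    right; right; constructor <;> linarith

/-- The four corners of a parallelogram. -/
def IsCrn (n p : ℕ) (s t : ℝ) : Prop := (s = 0 ∨ s = lam n p) ∧ (t = 0 ∨ t = lam n (p + 1))

theorem isVertex_rho_iff (m : ℤ) {p : ℕ} (hp : p < n) {s t : ℝ} (h : InRect n p s t) :
    IsVertex n (rho n m p s t) ↔ IsCrn n p s t := by
  constructor
  · intro hv
    rcases h.lower_or_upper with h1 | h1
    · rw [rho_lower m h1, isVertex_pt (Tri_mem m hp h1)] at hv
      rcases Tri_mem_corners m hp h1 hv with ⟨a, b⟩ | ⟨a, b⟩ | ⟨a, b⟩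
      · exact ⟨Or.inl a, Or.inl b⟩
      · exact ⟨Or.inr a, Or.inl b⟩
      · exact ⟨Or.inl a, Or.inr b⟩
    · rw [rho_upper m hp h1, isVertex_pt (Tri_mem m hp h1)] at hv
      rcases Tri_mem_corners m hp h1 hv with ⟨a, b⟩ | ⟨a, b⟩ | ⟨a, b⟩
      · exact ⟨Or.inr (by linarith), Or.inr (by linarith)⟩
      · exact ⟨Or.inl (by linarith), Or.inr (by linarith)⟩
      · exact ⟨Or.inr (by linarith), Or.inl (by linarith)⟩
  · have hl0 : 0 ≤ lam n p := lam_nonneg (by omega)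
    have hl1 : 0 ≤ lam n (p + 1) := lam_nonneg (by omega)
    have key : ∀ {s t}, InTri n p s t → Tri n m p s t ∈ corners n true →
        IsVertex n (rho n m p s t) := fun h1 h2 => by
      rwa [rho_lower m h1, isVertex_pt (Tri_mem m hp h1)]
    rintro ⟨rfl | rfl, rfl | rfl⟩
    · exact key (h.lower (by nlinarith)) (by rw [Tri_zero_zero]; exact zig_mem_corners _ _)
    · exact key (h.lower (by nlinarith)) (by rw [Tri_zero_lam]; exact zig_mem_corners _ _)
    · exact key (h.lower (by nlinarith)) (by rw [Tri_lam_zero]; exact zig_mem_corners _ _)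
    · have hu := h.upper (by nlinarith)
      rw [rho_upper m hp hu, isVertex_pt (Tri_mem m hp hu), sub_self, sub_self, Tri_zero_zero]
      exact zig_mem_corners _ _

theorem isVertex_unique {X Y : Surface n} (hX : IsVertex n X) (hY : IsVertex n Y) : X = Y := by
  obtain ⟨b, x, hx, rfl⟩ := exists_pt X
  obtain ⟨b', y, hy, rfl⟩ := exists_pt Y
  rw [isVertex_pt hx] at hX
  rw [isVertex_pt hy] at hY
  exact pt_corner hX hY

/-- Two triangles of the zigzag meet only along their common diagonal. -/
theorem Tri_eq_Tri {m : ℤ} {p p' : ℕ} (hpp : p < p') (hp' : p' < n) {s t s' t' : ℝ}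
    (h : InTri n p s t) (h' : InTri n p' s' t') (he : Tri n m p s t = Tri n m p' s' t')
    (hc : Tri n m p s t ∉ corners n true) :
    p' = p + 1 ∧ s = 0 ∧ t' = 0 ∧ s' = lam n (p + 1) - t := by
  rcases (by omega : p' = p + 1 ∨ p + 2 ≤ p') with rfl | hge
  · have c1 := congrArg (co n m p) he
    have c2 := congrArg (co n m (p + 1)) he
    rw [← co_add_two m p, co_add_two m p, co_Tri, ← co_add_two m p, co_succ_Tri] at c1
    rw [co_succ_Tri, co_Tri] at c2
    have e3 := co_zig_succ (n := n) m (p + 1)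
    have e4 := co_succ_zig_succ (n := n) m (p + 1)
    rw [show p + 1 + 1 = p + 2 by ring] at *
    rw [co_add_two] at *
    have := h.s_nonneg
    have := h'.t_nonneg
    refine ⟨rfl, ?_, ?_, ?_⟩ <;> linarith
  · exfalso
    apply hc
    -- In both coordinates the triangle `p` lies below `zig (p + 2)` and the triangle `p'` above it,
    -- so this vertex is the only possible common point.
    have : Tri n m p s t = zig n m (p + 2) := by
      have c1 := congrArg (co n m p) he
      have c2 := congrArg (co n m (p + 1)) he
      rw [co_Tri] at c1
      rw [co_succ_Tri] at c2
      have lowb : ∀ q, co n m q (zig n m p') ≤ co n m q (Tri n m p' s' t') := by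
        have := h'.s_le
        have := h'.t_nonneg
        intro q
        by_cases hq : Even q ↔ Even p'
        · rw [co_congr m hq, co_Tri, co_zig_succ]; linarith
        · have hq' : Even q ↔ Even (p' + 1) := by rw [Nat.even_add_one]; tauto
          rw [co_congr m hq', co_succ_Tri, co_succ_zig_succ]; linarith
      have l1 := lowb p
      have l2 := lowb (p + 1)
      have m1 := co_zig_mono (n := n) m p (i := p + 2) (j := p') (by omega) (by omega)
      have m2 := co_zig_mono (n := n) m (p + 1) (i := p + 2) (j := p') (by omega) (by omega)
      have e3 := co_zig_succ (n := n) m (p + 1)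
      have e4 := co_succ_zig_succ (n := n) m (p + 1)
      rw [show p + 1 + 1 = p + 2 by ring] at e3 e4
      rw [co_add_two] at e4
      have := h.s_nonneg
      have := h.t_le
      have hs : s = 0 := by linarith
      have ht : t = lam n (p + 1) := by linarith
      rw [hs, ht, Tri_zero_lam]
    rw [this]; exact zig_mem_corners _ _

/-- The edges that meet a triangle of the zigzag outside the corners. -/
theorem Tri_mem_edge_cases {m : ℤ} {p q : ℕ} (h1 : 1 ≤ p) (h2 : p + 2 ≤ n) (hq : q < n) {s t : ℝ}
    (h : InTri n p s t) (hc : Tri n m p s t ∉ corners n true)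
    (he : Tri n m p s t ∈ edge n (lab n m q)) :
    (q = p ∧ s * lam n (p + 1) + t * lam n p = lam n p * lam n (p + 1)) ∨
    (q = 0 ∧ p = 1 ∧ t = 0) ∨ (q + 1 = n ∧ p + 2 = n ∧ s = 0) := by
  have corner : ∀ {q s' t'}, (s' = 0 ∧ t' = 0) ∨ (s' = lam n q ∧ t' = 0) ∨
      (s' = 0 ∧ t' = lam n (q + 1)) → Tri n m p s t = Tri n m q s' t' → False := by
    rintro q s' t' (⟨rfl, rfl⟩ | ⟨rfl, rfl⟩ | ⟨rfl, rfl⟩) e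
    · exact hc (by rw [e, Tri_zero_zero]; exact zig_mem_corners _ _)
    · exact hc (by rw [e, Tri_lam_zero]; exact zig_mem_corners _ _)
    · exact hc (by rw [e, Tri_zero_lam]; exact zig_mem_corners _ _)
  have he' := he
  rw [edge_lab] at he'
  obtain ⟨a, b, ha, hb, hab, hx⟩ := he'
  rcases Nat.eq_zero_or_pos q with rfl | hq0
  · right; left
    have hl1 := lam_pos (n := n) (q := 1) (by omega) (by omega)
    have hl2 := lam_pos (n := n) (q := 2) (by omega) (by omega)
    have e : Tri n m p s t = Tri n m 1 (a * lam n 1) 0 := by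
      rw [← hx, ← zig_one, ← Tri_lam_zero, zero_add, ← Tri_zero_zero m 1, Tri_comb m 1 hab]
      simp
    have hT : InTri n 1 (a * lam n 1) 0 :=
      ⟨by positivity, by nlinarith, le_rfl, hl2.le, by
        have := mul_le_mul_of_nonneg_right (by linarith : a ≤ 1) (mul_pos hl1 hl2).le
        rw [show 1 + 1 = 2 by rfl]; linarith⟩
    rcases h1.eq_or_lt with rfl | hlt
    · exact ⟨rfl, rfl, (Tri_inj e).2⟩
    · obtain ⟨-, h0, -⟩ := Tri_eq_Tri hlt (by omega) hT h e.symm (by rwa [← e])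
      exact (corner (Or.inl ⟨h0, rfl⟩) e).elim
  rcases (by omega : q + 1 = n ∨ q + 1 < n) with hqn | hqn
  · right; right
    obtain ⟨r, rfl⟩ : ∃ r, q = r + 1 := ⟨q - 1, by omega⟩
    have hl1 := lam_pos (n := n) (q := r) (by omega) (by omega)
    have hl2 := lam_pos (n := n) (q := r + 1) (by omega) (by omega)
    have e : Tri n m p s t = Tri n m r 0 (b * lam n (r + 1)) := by
      have e1 : zig n m (r + 1 + 2) = zig n m (r + 2) := by
        rw [zig_succ m (r + 1 + 1), hqn, lam_n, zero_smul, add_zero]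
      rw [← hx, e1, ← Tri_zero_lam, ← Tri_zero_zero m r, Tri_comb m r hab]
      simp
    have hT : InTri n r 0 (b * lam n (r + 1)) :=
      ⟨le_rfl, hl1.le, by positivity, by nlinarith, by
        have := mul_le_mul_of_nonneg_right (by linarith : b ≤ 1) (mul_pos hl1 hl2).le
        linarith⟩
    rcases (by omega : p < r ∨ p = r) with hlt | rfl
    · obtain ⟨-, -, h0, -⟩ := Tri_eq_Tri hlt (by omega) h hT e hc
      exact (corner (Or.inl ⟨rfl, h0⟩) e).elim
    · exact ⟨hqn, by omega, (Tri_inj e).1⟩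
  · left
    have hl1 := lam_pos (n := n) (q := q) (by omega) (by omega)
    have hl2 := lam_pos (n := n) (q := q + 1) (by omega) (by omega)
    have e : Tri n m p s t = Tri n m q (a * lam n q) (b * lam n (q + 1)) := by
      rw [← hx, ← Tri_lam_zero, ← Tri_zero_lam m q, Tri_comb m q hab]
      simp
    have hsum : a * lam n q * lam n (q + 1) + b * lam n (q + 1) * lam n q =
        lam n q * lam n (q + 1) := by
      rw [(by linarith : b = 1 - a)]; ring
    have hT : InTri n q (a * lam n q) (b * lam n (q + 1)) :=
      ⟨by positivity, by nlinarith, by positivity, by nlinarith, hsum.le⟩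
    rcases lt_trichotomy p q with hlt | rfl | hlt
    · obtain ⟨-, -, h0, -⟩ := Tri_eq_Tri hlt (by omega) h hT e hc
      have hb0 : b = 0 := (mul_eq_zero.1 h0).resolve_right hl2.ne'
      exact (corner (Or.inr (Or.inl ⟨by rw [(by linarith : a = 1)]; ring, h0⟩)) e).elim
    · obtain ⟨rfl, rfl⟩ := Tri_inj e
      exact ⟨rfl, hsum⟩
    · obtain ⟨-, h0, -⟩ := Tri_eq_Tri hlt (by omega) hT h e.symm (by rwa [← e])
      have ha0 : a = 0 := (mul_eq_zero.1 h0).resolve_right hl1.ne'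
      exact (corner (Or.inr (Or.inr ⟨h0, by rw [(by linarith : b = 1)]; ring⟩)) e).elim

/-- The edges that meet a parallelogram outside the vertices. -/
theorem onEdge_rho_cases {m : ℤ} {p : ℕ} (h1 : 1 ≤ p) (h2 : p + 2 ≤ n) {s t : ℝ}
    (h : InRect n p s t) (hc : ¬ IsCrn n p s t) {k : Fin n} (hk : OnEdge n k (rho n m p s t)) :
    (k = lab n m p ∧ s * lam n (p + 1) + t * lam n p = lam n p * lam n (p + 1)) ∨
    (p = 1 ∧ k = lab n m 0 ∧ (t = 0 ∨ t = lam n (p + 1))) ∨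
    (p + 2 = n ∧ k = lab n m (p + 1) ∧ (s = 0 ∨ s = lam n p)) := by
  obtain ⟨q, hq, rfl⟩ := exists_lab m k
  have hp : p < n := by omega
  rw [← isVertex_rho_iff m hp h] at hc
  rcases h.lower_or_upper with h3 | h3
  · rw [rho_lower m h3] at hk hc
    have hP := Tri_mem m hp h3
    rw [isVertex_pt hP] at hc
    rw [onEdge_pt_iff hP hc] at hk
    rcases Tri_mem_edge_cases h1 h2 hq h3 hc hk with ⟨rfl, he⟩ | ⟨rfl, rfl, ht⟩ | ⟨hq1, hp2, hs⟩
    · exact Or.inl ⟨rfl, he⟩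
    · exact Or.inr (Or.inl ⟨rfl, rfl, Or.inl ht⟩)
    · exact Or.inr (Or.inr ⟨hp2, by congr 1; omega, Or.inl hs⟩)
  · rw [rho_upper m hp h3] at hk hc
    have hP := Tri_mem m hp h3
    rw [isVertex_pt hP] at hc
    rw [onEdge_pt_iff hP hc] at hk
    rcases Tri_mem_edge_cases h1 h2 hq h3 hc hk with ⟨rfl, he⟩ | ⟨rfl, rfl, ht⟩ | ⟨hq1, hp2, hs⟩
    · exact Or.inl ⟨rfl, by linarith⟩
    · exact Or.inr (Or.inl ⟨rfl, rfl, Or.inr (by linarith)⟩)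
    · exact Or.inr (Or.inr ⟨hp2, by congr 1; omega, Or.inr (by linarith)⟩)

theorem onEdge_rho_of_eq {m : ℤ} {p : ℕ} (hp : p < n) {s t : ℝ} (h : InRect n p s t)
    (he : s * lam n (p + 1) + t * lam n p = lam n p * lam n (p + 1)) :
    OnEdge n (lab n m p) (rho n m p s t) := by
  rw [rho_lower m (h.lower he.le)]
  exact onEdge_pt_of_mem (Tri_mem_edge m hp (h.lower he.le) he)

end Parallelograms

end DoubleGon

end

noncomputable section

namespace DoubleGon

/-! ### The affine reflection of the surface -/

section Reflection

variable {n : ℕ} [Fact (3 ≤ n)] [Fact (Odd n)]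

/-- The reflected parametrization of the parallelogram at position `p`. -/
def rhoF (n : ℕ) [Fact (3 ≤ n)] (m : ℤ) (p : ℕ) (s t : ℝ) : Surface n :=
  if Even p then rho n m p s (lam n (p + 1) - t) else rho n m p (lam n p - s) t

theorem halfTurn_rhoF (m : ℤ) {p : ℕ} (hp : p < n) {s t : ℝ} (h : InRect n p s t) :
    halfTurn n (rhoF n m p s t) = rhoF n m p (lam n p - s) (lam n (p + 1) - t) := by
  unfold rhoF
  split_ifs
  · exact halfTurn_rho m hp ⟨h.s_nonneg, h.s_le, h.compl.t_nonneg, h.compl.t_le⟩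
  · exact halfTurn_rho m hp ⟨h.compl.s_nonneg, h.compl.s_le, h.t_nonneg, h.t_le⟩

theorem IsCrn.rhoF {m : ℤ} {p : ℕ} (hp : p < n) {s t : ℝ} (h : InRect n p s t)
    (hc : IsCrn n p s t) : IsVertex n (rhoF n m p s t) := by
  unfold DoubleGon.rhoF
  split_ifs
  · rw [isVertex_rho_iff m hp ⟨h.s_nonneg, h.s_le, h.compl.t_nonneg, h.compl.t_le⟩]
    exact ⟨hc.1, hc.2.symm.imp (fun h => by linarith) (fun h => by linarith)⟩
  · rw [isVertex_rho_iff m hp ⟨h.compl.s_nonneg, h.compl.s_le, h.t_nonneg, h.t_le⟩]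
    exact ⟨hc.1.symm.imp (fun h => by linarith) (fun h => by linarith), hc.2⟩

/-- A side in the negated direction is reversed in place, so the same gluing is used again. A side
in the fixed direction is exchanged with the opposite one, so top and left become bottom and right,
and `rho_right` takes over. -/
theorem rhoF_top (m : ℤ) {p : ℕ} (hp : p + 1 < n) {s : ℝ} (h0 : 0 ≤ s)
    (h1 : s ≤ lam n (p + 1)) : rhoF n m (p + 1) s (lam n (p + 2)) = rhoF n m p 0 s := by
  unfold rhoF
  by_cases h : Even p
  · have h' : ¬ Even (p + 1) := by rw [Nat.even_add_one]; tauto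
    rw [if_neg h', if_pos h, rho_top m hp (by linarith) (by linarith)]
  · have h' : Even (p + 1) := by rw [Nat.even_add_one]; tauto
    rw [if_pos h', if_neg h, sub_zero, rho_right m hp h0 h1, show p + 1 + 1 = p + 2 by ring,
      sub_self]

theorem rhoF_right (m : ℤ) {p : ℕ} (hp : p + 1 < n) {t : ℝ} (h0 : 0 ≤ t)
    (h1 : t ≤ lam n (p + 1)) : rhoF n m p (lam n p) t = rhoF n m (p + 1) t 0 := by
  unfold rhoF
  by_cases h : Even p
  · have h' : ¬ Even (p + 1) := by rw [Nat.even_add_one]; tauto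
    rw [if_neg h', if_pos h, rho_right m hp (by linarith) (by linarith)]
  · have h' : Even (p + 1) := by rw [Nat.even_add_one]; tauto
    rw [if_pos h', if_neg h, sub_self, sub_zero, ← rho_top m hp h0 h1]

theorem par_eq_par_not_succ {p q : ℕ} (h : par p = par q) : p ≠ q + 1 := by
  rintro rfl
  rw [par_succ] at h
  simp at h

/-- The reflection does not depend on the parallelogram used to describe a point. The possible
coincidences come from a zigzag step shared by two triangles, from the edge that is the diagonal of
one parallelogram, and from the two end edges. -/
theorem rhoF_congr_of_lower {m : ℤ} {p p' : ℕ} (h1 : 1 ≤ p) (h2 : p + 2 ≤ n) (h1' : 1 ≤ p')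
    (h2' : p' + 2 ≤ n) {s t s' t' : ℝ} (h : InTri n p s t) (h' : InRect n p' s' t')
    (he : rho n m p s t = rho n m p' s' t') : rhoF n m p s t = rhoF n m p' s' t' := by
  have hp : p < n := by omega
  have hp' : p' < n := by omega
  by_cases hv : IsVertex n (rho n m p s t)
  · have hv' := hv
    rw [isVertex_rho_iff m hp h.inRect] at hv
    rw [he, isVertex_rho_iff m hp' h'] at hv'
    exact isVertex_unique (hv.rhoF hp h.inRect) (hv'.rhoF hp' h')
  have hP := Tri_mem m hp h
  rcases h'.lower_or_upper with hl | hu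
  · have hP' := Tri_mem m hp' hl
    rw [rho_lower m h, isVertex_pt hP] at hv
    rw [rho_lower m h, rho_lower m hl, pt_eq_iff hP hP'] at he
    have hv' := fun hc => hv (he.corner_iff.2 hc)
    rcases he with ⟨hb, hx⟩ | ⟨hb, k, hk, hx⟩ | ⟨hc, -⟩
    · rcases lt_trichotomy p p' with hlt | rfl | hlt
      · obtain ⟨rfl, -⟩ := Tri_eq_Tri hlt hp' h hl hx hv
        exact absurd rfl (par_eq_par_not_succ hb.symm)
      · obtain ⟨rfl, rfl⟩ := Tri_inj hx
        rfl
      · obtain ⟨rfl, -⟩ := Tri_eq_Tri hlt hp hl h hx.symm hv'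
        exact absurd rfl (par_eq_par_not_succ hb)
    · exfalso
      have hk' := turn_mem_edge hk
      rw [← hx] at hk'
      obtain ⟨q, hq, rfl⟩ := exists_lab m k
      have hpp : p = p' := by
        rcases Tri_mem_edge_cases h1 h2 hq h hv hk with ⟨a1, a2⟩ | ⟨a1, a2, a3⟩ | ⟨a1, a2, a3⟩ <;>
        rcases Tri_mem_edge_cases h1' h2' hq hl hv' hk' with ⟨b1, b2⟩ | ⟨b1, b2, b3⟩ | ⟨b1, b2, b3⟩ <;>
        omega
      rw [hpp] at hb
      simp at hb
    · exact absurd hc hv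
  · have hP' := Tri_mem m hp' hu
    rw [rho_lower m h, isVertex_pt hP] at hv
    rw [rho_lower m h, rho_upper m hp' hu, pt_eq_iff hP hP'] at he
    have hv' := fun hc => hv (he.corner_iff.2 hc)
    rcases he with ⟨hb, hx⟩ | ⟨hb, k, hk, hx⟩ | ⟨hc, -⟩
    · rcases lt_trichotomy p p' with hlt | rfl | hlt
      · obtain ⟨rfl, rfl, a1, a2⟩ := Tri_eq_Tri hlt hp' h hu hx hv
        obtain rfl : s' = t := by linarith
        obtain rfl : t' = lam n (p + 1 + 1) := by linarith
        exact (rhoF_top m hp' h'.s_nonneg h'.s_le).symm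
      · simp at hb
      · obtain ⟨rfl, a1, rfl, a2⟩ := Tri_eq_Tri hlt hp hu h hx.symm hv'
        obtain rfl : s = t' := by linarith
        obtain rfl : s' = lam n p' := by linarith
        exact (rhoF_right m hp h'.t_nonneg h'.t_le).symm
    · have hk' := turn_mem_edge hk
      rw [← hx] at hk'
      obtain ⟨q, hq, rfl⟩ := exists_lab m k
      rcases Tri_mem_edge_cases h1 h2 hq h hv hk with ⟨rfl, a2⟩ | ⟨rfl, rfl, rfl⟩ | ⟨a1, a2, rfl⟩
      · rcases Tri_mem_edge_cases h1' h2' hq hu hv' hk' with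
          ⟨rfl, b2⟩ | ⟨b1, b2, b3⟩ | ⟨b1, b2, b3⟩
        · rw [turn_Tri] at hx
          obtain ⟨c1, c2⟩ := Tri_inj hx
          obtain rfl : s = s' := by linarith
          obtain rfl : t = t' := by linarith
          rfl
        · omega
        · omega
      · rcases Tri_mem_edge_cases h1' h2' hq hu hv' hk' with
          ⟨b1, b2⟩ | ⟨-, rfl, b3⟩ | ⟨b1, b2, b3⟩
        · omega
        · have e : Tri n m 1 (lam n 1 - s') (lam n (1 + 1) - t') = Tri n m 1 (lam n 1 - s) 0 := by
            rw [hx, turn, vertex_lab_add, Tri, Tri, zig_succ m 1, ← zig_one]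
            module
          obtain ⟨c1, c2⟩ := Tri_inj e
          obtain rfl : s = s' := by linarith
          obtain rfl : t' = lam n 2 := by linarith
          -- The edge at position `0` is both the bottom and the top of the parallelogram `1`; the
          -- degenerate parallelogram `0` links the two.
          have f1 := rhoF_right m hp h.s_nonneg h.s_le (p := 0)
          have f2 := rhoF_top m hp h.s_nonneg h.s_le (p := 0)
          rw [lam_zero] at f1
          rw [zero_add] at f1 f2
          rw [← f1, ← f2]
        · omega
      · rcases Tri_mem_edge_cases h1' h2' hq hu hv' hk' with
          ⟨b1, b2⟩ | ⟨b1, b2, b3⟩ | ⟨b1, b2, b3⟩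
        · omega
        · omega
        · obtain rfl : p = p' := by omega
          obtain rfl : q = p + 1 := by omega
          have e : Tri n m p (lam n p - s') (lam n (p + 1) - t')
              = Tri n m p 0 (lam n (p + 1) - t) := by
            have e1 : zig n m (p + 1 + 2) = zig n m (p + 2) := by
              rw [zig_succ m (p + 1 + 1), show p + 1 + 1 = n by omega, lam_n, zero_smul, add_zero]
            rw [hx, turn, vertex_lab_add, Tri, Tri, e1, zig_succ m (p + 1)]
            module
          obtain ⟨c1, c2⟩ := Tri_inj e
          obtain rfl : t = t' := by linarith
          obtain rfl : s' = lam n p := by linarith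
          -- Likewise, the edge at position `n - 1` is both the left and the right side of the
          -- parallelogram `n - 2`.
          have f1 := rhoF_right m (p := p) (by omega) h.t_nonneg h.t_le
          have f2 := rhoF_top m (p := p) (by omega) h.t_nonneg h.t_le
          rw [a2, lam_n] at f2
          rw [f1, f2]
    · exact absurd hc hv

theorem rhoF_congr {m : ℤ} {p p' : ℕ} (h1 : 1 ≤ p) (h2 : p + 2 ≤ n) (h1' : 1 ≤ p')
    (h2' : p' + 2 ≤ n) {s t s' t' : ℝ} (h : InRect n p s t) (h' : InRect n p' s' t')
    (he : rho n m p s t = rho n m p' s' t') : rhoF n m p s t = rhoF n m p' s' t' := by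
  rcases h.lower_or_upper with hl | hu
  · exact rhoF_congr_of_lower h1 h2 h1' h2' hl h' he
  · have hp : p < n := by omega
    have hp' : p' < n := by omega
    have he' := congrArg (halfTurn n) he
    rw [halfTurn_rho m hp h, halfTurn_rho m hp' h'] at he'
    have := rhoF_congr_of_lower h1 h2 h1' h2' hu h'.compl he'
    rw [← halfTurn_rhoF m hp h, ← halfTurn_rhoF m hp' h'] at this
    exact (halfTurn n).injective this

theorem continuousOn_rho (m : ℤ) {p : ℕ} (hp : p < n) :
    ContinuousOn (fun w : ℝ × ℝ => rho n m p w.1 w.2) {w | InRect n p w.1 w.2} := by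
  have hT : Continuous (fun w : ℝ × ℝ => Tri n m p w.1 w.2) := by unfold Tri; fun_prop
  have hc : ∀ w : ℝ × ℝ, InRect n p w.1 w.2 ↔
      (0 ≤ w.1 ∧ w.1 ≤ lam n p) ∧ (0 ≤ w.2 ∧ w.2 ≤ lam n (p + 1)) := fun w =>
    ⟨fun h => ⟨⟨h.1, h.2⟩, h.3, h.4⟩, fun h => ⟨h.1.1, h.1.2, h.2.1, h.2.2⟩⟩
  have hclosed : IsClosed {w : ℝ × ℝ | InRect n p w.1 w.2} := by
    simp only [hc]
    exact ((isClosed_le continuous_const continuous_fst).inter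
      (isClosed_le continuous_fst continuous_const)).inter
      ((isClosed_le continuous_const continuous_snd).inter
      (isClosed_le continuous_snd continuous_const))
  have e : {w : ℝ × ℝ | InRect n p w.1 w.2} =
      ({w : ℝ × ℝ | InRect n p w.1 w.2} ∩
        {w | w.1 * lam n (p + 1) + w.2 * lam n p ≤ lam n p * lam n (p + 1)}) ∪
      ({w : ℝ × ℝ | InRect n p w.1 w.2} ∩
        {w | lam n p * lam n (p + 1) ≤ w.1 * lam n (p + 1) + w.2 * lam n p}) := by
    rw [← Set.inter_union_distrib_left, eq_comm, Set.inter_eq_left]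
    intro w _
    rcases le_total (w.1 * lam n (p + 1) + w.2 * lam n p) (lam n p * lam n (p + 1)) with h | h
    · exact Or.inl h
    · exact Or.inr h
  rw [e]
  apply ContinuousOn.union_of_isClosed
  · refine ContinuousOn.congr (f := fun w : ℝ × ℝ => pt n (par p) (Tri n m p w.1 w.2)) ?_
      fun w hw => rho_lower m (InRect.lower hw.1 hw.2)
    exact (continuousOn_pt _).comp hT.continuousOn fun w hw => Tri_mem m hp (InRect.lower hw.1 hw.2)
  · refine ContinuousOn.congr (f := fun w : ℝ × ℝ => pt n (!par p)
      (Tri n m p (lam n p - w.1) (lam n (p + 1) - w.2))) ?_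
      fun w hw => rho_upper m hp (InRect.upper hw.1 hw.2)
    refine (continuousOn_pt _).comp (Continuous.continuousOn ?_)
      fun w hw => Tri_mem m hp (InRect.upper hw.1 hw.2)
    unfold Tri; fun_prop
  · exact hclosed.inter (isClosed_le (by fun_prop) (by fun_prop))
  · exact hclosed.inter (isClosed_le (by fun_prop) (by fun_prop))

theorem continuousOn_rhoF (m : ℤ) {p : ℕ} (hp : p < n) :
    ContinuousOn (fun w : ℝ × ℝ => rhoF n m p w.1 w.2) {w | InRect n p w.1 w.2} := by
  unfold rhoF
  by_cases h : Even p
  · simp only [h, if_true]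
    exact (continuousOn_rho m hp).comp (f := fun w : ℝ × ℝ => (w.1, lam n (p + 1) - w.2))
      (by fun_prop) fun w hw => ⟨hw.s_nonneg, hw.s_le, hw.compl.t_nonneg, hw.compl.t_le⟩
  · simp only [h, if_false]
    exact (continuousOn_rho m hp).comp (f := fun w : ℝ × ℝ => (lam n p - w.1, w.2))
      (by fun_prop) fun w hw => ⟨hw.compl.s_nonneg, hw.compl.s_le, hw.t_nonneg, hw.t_le⟩

/-- The triangle at position `p`. -/
def triSet (n : ℕ) (m : ℤ) (p : ℕ) : Set Plane :=
  {x | InTri n p (co n m p (zig n m (p + 1)) - co n m p x)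
    (co n m (p + 1) x - co n m (p + 1) (zig n m (p + 1)))}

theorem isClosed_triSet (m : ℤ) (p : ℕ) : IsClosed (triSet n m p) := by
  have c1 : Continuous fun x => co n m p (zig n m (p + 1)) - co n m p x :=
    continuous_const.sub (continuous_co m p)
  have c2 : Continuous fun x => co n m (p + 1) x - co n m (p + 1) (zig n m (p + 1)) :=
    (continuous_co m (p + 1)).sub continuous_const
  have : triSet n m p = (({x | 0 ≤ co n m p (zig n m (p + 1)) - co n m p x} ∩
      {x | co n m p (zig n m (p + 1)) - co n m p x ≤ lam n p}) ∩
      ({x | 0 ≤ co n m (p + 1) x - co n m (p + 1) (zig n m (p + 1))} ∩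
      {x | co n m (p + 1) x - co n m (p + 1) (zig n m (p + 1)) ≤ lam n (p + 1)})) ∩
      {x | (co n m p (zig n m (p + 1)) - co n m p x) * lam n (p + 1) +
      (co n m (p + 1) x - co n m (p + 1) (zig n m (p + 1))) * lam n p ≤
      lam n p * lam n (p + 1)} := by
    ext x
    exact ⟨fun h => ⟨⟨⟨h.1, h.2⟩, ⟨h.3, h.4⟩⟩, h.5⟩,
      fun h => ⟨h.1.1.1, h.1.1.2, h.1.2.1, h.1.2.2, h.2⟩⟩
  rw [this]
  exact (((isClosed_le continuous_const c1).inter (isClosed_le c1 continuous_const)).inter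
    ((isClosed_le continuous_const c2).inter (isClosed_le c2 continuous_const))).inter
    (isClosed_le ((c1.mul continuous_const).add (c2.mul continuous_const)) continuous_const)

theorem exists_triSet (m : ℤ) {x : Plane} (hx : x ∈ polygon n true) :
    ∃ p, 1 ≤ p ∧ p + 2 ≤ n ∧ x ∈ triSet n m p := by
  obtain ⟨p, s, t, h1, h2, h, rfl⟩ := exists_Tri m hx
  refine ⟨p, h1, h2, ?_⟩
  rw [triSet, Set.mem_ofPred_eq, co_Tri, co_succ_Tri]
  simpa using h

/-- The first parameter of the point of the parallelogram at position `p` given by the point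
`x` of the polygon `b`. -/
def parS (n : ℕ) (m : ℤ) (p : ℕ) (b : Bool) (x : Plane) : ℝ :=
  if b = par p then co n m p (zig n m (p + 1)) - co n m p x
  else lam n p - (co n m p (zig n m (p + 1)) - co n m p x)

/-- The second parameter of the point of the parallelogram at position `p` given by the point
`x` of the polygon `b`. -/
def parT (n : ℕ) (m : ℤ) (p : ℕ) (b : Bool) (x : Plane) : ℝ :=
  if b = par p then co n m (p + 1) x - co n m (p + 1) (zig n m (p + 1))
  else lam n (p + 1) - (co n m (p + 1) x - co n m (p + 1) (zig n m (p + 1)))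

theorem inRect_par {m : ℤ} {p : ℕ} {b : Bool} {x : Plane} (hx : x ∈ triSet n m p) :
    InRect n p (parS n m p b x) (parT n m p b x) := by
  have := InTri.inRect hx
  unfold parS parT
  split_ifs
  · exact this
  · exact this.compl

theorem pt_eq_rho {m : ℤ} {p : ℕ} (hp : p < n) {b : Bool} {x : Plane} (hx : x ∈ triSet n m p) :
    pt n b x = rho n m p (parS n m p b x) (parT n m p b x) := by
  unfold parS parT
  split_ifs with h
  · rw [rho_lower m hx, ← eq_Tri, h]
  · rw [rho_upper m hp, sub_sub_cancel, sub_sub_cancel, ← eq_Tri, Bool.eq_not_of_ne h]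
    rw [sub_sub_cancel, sub_sub_cancel]; exact hx

theorem exists_refl (m : ℤ) : ∃ Φ : Surface n ≃ₜ Surface n, ∀ p s t, 1 ≤ p → p + 2 ≤ n →
    InRect n p s t → Φ (rho n m p s t) = rhoF n m p s t := by
  have key : ∀ X : Surface n, ∃ Y, ∀ p s t, 1 ≤ p → p + 2 ≤ n → InRect n p s t →
      X = rho n m p s t → Y = rhoF n m p s t := by
    intro X
    obtain ⟨p, s, t, h1, h2, h, rfl⟩ := exists_rho m X
    exact ⟨rhoF n m p s t, fun p' s' t' h1' h2' h' he => rhoF_congr h1 h2 h1' h2' h h' he⟩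
  choose f hf using key
  have hf' : ∀ p s t, 1 ≤ p → p + 2 ≤ n → InRect n p s t → f (rho n m p s t) = rhoF n m p s t :=
    fun p s t h1 h2 h => hf _ p s t h1 h2 h rfl
  have hinv : Function.Involutive f := by
    intro X
    obtain ⟨p, s, t, h1, h2, h, rfl⟩ := exists_rho m X
    rw [hf' p s t h1 h2 h]
    unfold rhoF
    split_ifs with he
    · rw [hf' _ _ _ h1 h2 ⟨h.s_nonneg, h.s_le, h.compl.t_nonneg, h.compl.t_le⟩, rhoF, if_pos he,
        sub_sub_cancel]
    · rw [hf' _ _ _ h1 h2 ⟨h.compl.s_nonneg, h.compl.s_le, h.t_nonneg, h.t_le⟩, rhoF, if_neg he,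
        sub_sub_cancel]
  have hcont : Continuous f := by
    refine continuous_of_pt fun b => ?_
    -- Continuity is pasted over the finite closed cover by triangles; since `f` is an involution,
    -- the inverse needs no separate argument.
    let K : Fin n → Set Plane := fun p => {x | 1 ≤ (p : ℕ) ∧ (p : ℕ) + 2 ≤ n ∧ x ∈ triSet n m p}
    have hK : ∀ p, IsClosed (K p) := by
      intro p
      by_cases hp : 1 ≤ (p : ℕ) ∧ (p : ℕ) + 2 ≤ n
      · have : K p = triSet n m p := by ext x; simp [K, hp.1, hp.2]
        rw [this]; exact isClosed_triSet m p
      · have : K p = ∅ := by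
          ext x; simp only [K, Set.mem_ofPred_eq, Set.mem_empty_iff_false, iff_false]
          exact fun h => hp ⟨h.1, h.2.1⟩
        rw [this]; exact isClosed_empty
    have hKc : ∀ p, ContinuousOn (fun x => f (pt n b x)) (K p) := by
      intro p
      refine ContinuousOn.congr
        (f := fun x => rhoF n m p (parS n m p b x) (parT n m p b x)) ?_ fun x hx => ?_
      · have hcs : Continuous (parS n m p b) := by
          have c1 := continuous_co (n := n) m p
          unfold parS; split_ifs <;> fun_prop
        have hct : Continuous (parT n m p b) := by
          have c1 := continuous_co (n := n) m (p + 1)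
          unfold parT; split_ifs <;> fun_prop
        exact (continuousOn_rhoF m p.2).comp (f := fun x => (parS n m p b x, parT n m p b x))
          (hcs.prodMk hct).continuousOn fun x hx => inRect_par hx.2.2
      · rw [pt_eq_rho p.2 hx.2.2, hf' _ _ _ hx.1 hx.2.1 (inRect_par hx.2.2)]
    have hlf : LocallyFinite K := locallyFinite_of_finite K
    refine (hlf.continuousOn_iUnion hK fun {p} => hKc p).mono fun x hx => ?_
    obtain ⟨p, h1, h2, h⟩ := exists_triSet m hx
    exact Set.mem_iUnion.2 ⟨⟨p, by omega⟩, h1, h2, h⟩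
  exact ⟨⟨hinv.toPerm f, hcont, hcont⟩, hf'⟩

/-- The affine reflection of the surface that reflects each parallelogram of the zigzag. -/
def reflect (n : ℕ) [Fact (3 ≤ n)] [Fact (Odd n)] (m : ℤ) : Surface n ≃ₜ Surface n :=
  (exists_refl m).choose

theorem reflect_rho (m : ℤ) {p : ℕ} {s t : ℝ} (h1 : 1 ≤ p) (h2 : p + 2 ≤ n)
    (h : InRect n p s t) : reflect n m (rho n m p s t) = rhoF n m p s t :=
  (exists_refl m).choose_spec p s t h1 h2 h

theorem isVertex_rhoF_iff (m : ℤ) {p : ℕ} (hp : p < n) {s t : ℝ} (h : InRect n p s t) :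
    IsVertex n (rhoF n m p s t) ↔ IsCrn n p s t := by
  refine ⟨fun hv => ?_, IsCrn.rhoF hp h⟩
  unfold rhoF at hv
  split_ifs at hv
  · rw [isVertex_rho_iff m hp ⟨h.s_nonneg, h.s_le, h.compl.t_nonneg, h.compl.t_le⟩] at hv
    exact ⟨hv.1, hv.2.symm.imp (fun h => by linarith) (fun h => by linarith)⟩
  · rw [isVertex_rho_iff m hp ⟨h.compl.s_nonneg, h.compl.s_le, h.t_nonneg, h.t_le⟩] at hv
    exact ⟨hv.1.symm.imp (fun h => by linarith) (fun h => by linarith), hv.2⟩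

theorem isVertex_reflect (m : ℤ) (X : Surface n) :
    IsVertex n (reflect n m X) ↔ IsVertex n X := by
  obtain ⟨p, s, t, h1, h2, h, rfl⟩ := exists_rho m X
  rw [reflect_rho m h1 h2 h, isVertex_rhoF_iff m (by omega) h, isVertex_rho_iff m (by omega) h]

theorem eq_drc (m : ℤ) (p : ℕ) (u : Plane) :
    u = (-(sgn (par p) * co n m p u)) • drc n m p +
      (sgn (par p) * co n m (p + 1) u) • drc n m (p + 1) := by
  apply co_ext (n := n) m p <;>
  · simp only [drc, par_succ, sgn_not]
    cases par p <;> simp [co_del_self, co_del_succ, co_succ_del]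

/-- The condition on `A` says that it fixes the even directions and negates the odd ones. This is
the linear part of what `rhoF` does to the two parameters. -/
theorem reflect_disp {m : ℤ} {A : Matrix (Fin 2) (Fin 2) ℝ}
    (hA : ∀ p, A *ᵥ drc n m p = sgn (par p) • drc n m p) {p : ℕ} (h1 : 1 ≤ p) (h2 : p + 2 ≤ n)
    {s t : ℝ} (h : InRect n p s t) : ∀ᶠ u in 𝓝 (0 : Plane),
      InRect n p (s - sgn (par p) * co n m p u) (t + sgn (par p) * co n m (p + 1) u) →
      Disp n (reflect n m (rho n m p s t)) (A *ᵥ u) (reflect n m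
        (rho n m p (s - sgn (par p) * co n m p u) (t + sgn (par p) * co n m (p + 1) u))) := by
  have c1 := continuous_co (n := n) m p
  have c2 := continuous_co (n := n) m (p + 1)
  have hAu : ∀ u, A *ᵥ u = (-(co n m p u)) • drc n m p - co n m (p + 1) u • drc n m (p + 1) := by
    intro u
    conv_lhs => rw [eq_drc (n := n) m p u]
    rw [mulVec_add, mulVec_smul, mulVec_smul, hA, hA, par_succ, sgn_not]
    cases par p <;> simp [sub_eq_add_neg]
  by_cases he : Even p
  · have hpar : par p = true := by simp [par, he]
    have hd := rho_disp m (by omega : p < n) (s := s) (t := lam n (p + 1) - t)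
      ⟨h.s_nonneg, h.s_le, h.compl.t_nonneg, h.compl.t_le⟩
    have tend : Tendsto (fun u : Plane => (s - co n m p u, lam n (p + 1) - (t + co n m (p + 1) u)))
        (𝓝 0) (𝓝 (s, lam n (p + 1) - t)) := by
      have : Continuous (fun u : Plane =>
        (s - co n m p u, lam n (p + 1) - (t + co n m (p + 1) u))) := by fun_prop
      simpa using this.tendsto 0
    filter_upwards [tend.eventually hd] with u hu hR
    rw [reflect_rho m h1 h2 h, reflect_rho m h1 h2 hR, rhoF, rhoF, if_pos he, if_pos he]
    rw [hpar, sgn_true, one_mul, one_mul] at hR ⊢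
    have := hu ⟨hR.s_nonneg, hR.s_le, hR.compl.t_nonneg, hR.compl.t_le⟩
    convert this using 1
    rw [hAu]; module
  · have hpar : par p = false := by simp [par, he]
    have hd := rho_disp m (by omega : p < n) (s := lam n p - s) (t := t)
      ⟨h.compl.s_nonneg, h.compl.s_le, h.t_nonneg, h.t_le⟩
    have tend : Tendsto (fun u : Plane => (lam n p - (s + co n m p u), t - co n m (p + 1) u))
        (𝓝 0) (𝓝 (lam n p - s, t)) := by
      have : Continuous (fun u : Plane =>
        (lam n p - (s + co n m p u), t - co n m (p + 1) u)) := by fun_prop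
      simpa using this.tendsto 0
    filter_upwards [tend.eventually hd] with u hu hR
    rw [reflect_rho m h1 h2 h, reflect_rho m h1 h2 hR, rhoF, rhoF, if_neg he, if_neg he]
    have e1 : s - sgn (par p) * co n m p u = s + co n m p u := by rw [hpar, sgn_false]; ring
    have e2 : t + sgn (par p) * co n m (p + 1) u = t - co n m (p + 1) u := by
      rw [hpar, sgn_false]; ring
    rw [e1, e2] at hR ⊢
    have := hu ⟨hR.compl.s_nonneg, hR.compl.s_le, hR.t_nonneg, hR.t_le⟩
    convert this using 1
    rw [hAu]; module

theorem isAffineAut_reflect {m : ℤ} {A : Matrix (Fin 2) (Fin 2) ℝ}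
    (hA : ∀ p, A *ᵥ drc n m p = sgn (par p) • drc n m p) : IsAffineAut n (reflect n m) A where
  vertex_iff := isVertex_reflect m
  affine X hX := by
    have key : ∀ b : Bool, ∀ᶠ u in 𝓝 (0 : Plane), ∀ x ∈ polygon n true, X = pt n b x →
        x + sgn b • u ∈ polygon n true →
        Disp n (reflect n m X) (A *ᵥ u) (reflect n m (pt n b (x + sgn b • u))) := by
      intro b
      by_cases hb : ∃ x ∈ polygon n true, X = pt n b x
      swap
      · exact Eventually.of_forall fun u x hx he => absurd ⟨x, hx, he⟩ hb
      obtain ⟨x, hx, rfl⟩ := hb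
      rw [isVertex_pt hx] at hX
      -- There are finitely many triangles. Those that do not contain `x` are closed and are avoided
      -- by small displacements; in the others `reflect_disp` applies.
      have hall : ∀ p : Fin n, ∀ᶠ u in 𝓝 (0 : Plane), 1 ≤ (p : ℕ) → (p : ℕ) + 2 ≤ n →
          x + sgn b • u ∈ triSet n m p →
          Disp n (reflect n m (pt n b x)) (A *ᵥ u) (reflect n m (pt n b (x + sgn b • u))) := by
        intro p
        by_cases hp : 1 ≤ (p : ℕ) ∧ (p : ℕ) + 2 ≤ n
        swap
        · exact Eventually.of_forall fun u h1 h2 => absurd ⟨h1, h2⟩ hp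
        by_cases hxp : x ∈ triSet n m p
        · filter_upwards [reflect_disp hA hp.1 hp.2 (inRect_par (b := b) hxp)] with u hu _ _ hy
          rw [pt_eq_rho p.2 hxp, pt_eq_rho p.2 hy]
          have hR := inRect_par (b := b) hy
          have e1 : parS n m p b (x + sgn b • u)
              = parS n m p b x - sgn (par p) * co n m p u := by
            unfold parS
            split_ifs with hb
            · rw [map_add, map_smul, hb, smul_eq_mul]; ring
            · rw [map_add, map_smul, Bool.eq_not_of_ne hb, sgn_not, smul_eq_mul]; ring
          have e2 : parT n m p b (x + sgn b • u)
              = parT n m p b x + sgn (par p) * co n m (p + 1) u := by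
            unfold parT
            split_ifs with hb
            · rw [map_add, map_smul, hb, smul_eq_mul]; ring
            · rw [map_add, map_smul, Bool.eq_not_of_ne hb, sgn_not, smul_eq_mul]; ring
          rw [e1, e2] at hR ⊢
          exact hu hR
        · have tend : Tendsto (fun u : Plane => x + sgn b • u) (𝓝 0) (𝓝 x) := by
            have : Continuous (fun u : Plane => x + sgn b • u) := by fun_prop
            simpa using this.tendsto 0
          filter_upwards [tend.eventually ((isClosed_triSet m p).isOpen_compl.mem_nhds hxp)]
            with u hu _ _ hy
          exact absurd hy hu
      filter_upwards [eventually_all.2 hall] with u hu x' hx' he hy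
      obtain rfl := pt_inj hx hx' hX he
      obtain ⟨p, h1, h2, h⟩ := exists_triSet m hy
      exact hu ⟨p, by omega⟩ h1 h2 h
    filter_upwards [key true, key false] with u h1 h2 Y hD
    obtain ⟨b, x, hx, hy, he, rfl⟩ := disp_iff.1 hD
    cases b
    · exact h2 x hx he hy
    · exact h1 x hx he hy

end Reflection

end DoubleGon

end

noncomputable section

namespace DoubleGon

/-! ### Uniqueness of affine automorphisms -/

section Uniqueness

variable {n : ℕ} [Fact (3 ≤ n)] [Fact (Odd n)]

/-- The field `affine` of `IsAffineAut` only transports displacements that exist. Their local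
existence and uniqueness make it possible to invert an automorphism in `IsAffineAut.symm`. -/
theorem eventually_exists_disp {X : Surface n} (hX : ¬ IsVertex n X) :
    ∀ᶠ u in 𝓝 (0 : Plane), ∃ Y, Disp n X u Y := by
  have tend : ∀ (b : Bool) (x : Plane), Tendsto (fun u => x + sgn b • u) (𝓝 (0 : Plane)) (𝓝 x) := by
    intro b x
    have : Continuous (fun u : Plane => x + sgn b • u) := by fun_prop
    simpa using this.tendsto 0
  obtain ⟨b, x, hx, hc, rfl, h_int | ⟨j, hj⟩⟩ := interior_or_edge hX
  · filter_upwards [(tend b x).eventually (eventually_FF_pos (n := n) x)] with u hu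
    exact ⟨_, disp_pt hx (mem_polygon_of_FF fun i => (hu i (h_int i)).le) rfl⟩
  · have hc' : turn n (lbl n j) x ∉ corners n true := fun h => hc ((turn_mem_corners_iff hj).1 h)
    have hj' := turn_mem_edge hj
    filter_upwards [(tend b x).eventually (eventually_FF_pos (n := n) x),
      (tend (!b) _).eventually (eventually_FF_pos (n := n) (turn n (lbl n j) x))] with u hu hu'
    rcases le_total 0 (FF n j (x + sgn b • u)) with h | h
    · exact ⟨_, disp_pt hx (mem_polygon_of_FF_edge
        (fun i hi => hu i (FF_pos_of_edge hj hc hi)) h) rfl⟩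
    · rw [← pt_turn hj]
      refine ⟨_, disp_pt (edge_subset_polygon _ hj') (mem_polygon_of_FF_edge
        (fun i hi => hu' i (FF_pos_of_edge hj' hc' hi)) ?_) rfl⟩
      have e : turn n (lbl n j) x + sgn (!b) • u = turn n (lbl n j) (x + sgn b • u) := by
        rw [turn_add, sgn_not, neg_smul, sub_eq_add_neg]
      rw [e, FF_turn]
      linarith

theorem eventually_disp_unique {X : Surface n} (hX : ¬ IsVertex n X) :
    ∀ᶠ u in 𝓝 (0 : Plane), ∀ Y Y', Disp n X u Y → Disp n X u Y' → Y = Y' := by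
  obtain ⟨δ, hδ, c, hc0, hc⟩ := exists_chart hX
  filter_upwards [Metric.ball_mem_nhds (0 : Plane) hδ] with u hu Y Y' h h'
  rw [mem_ball_zero_iff] at hu
  rw [hc 0 u Y (by simpa using hδ) hu (by rwa [hc0]),
    hc 0 u Y' (by simpa using hδ) hu (by rwa [hc0])]

theorem tendsto_mulVec_zero (A : Matrix (Fin 2) (Fin 2) ℝ) :
    Tendsto (fun u : Plane => A *ᵥ u) (𝓝 0) (𝓝 0) := by
  have : Continuous (fun u : Plane => A *ᵥ u) := by fun_prop
  simpa using this.tendsto 0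

theorem IsAffineAut.trans {Φ Ψ : Surface n ≃ₜ Surface n} {A B : Matrix (Fin 2) (Fin 2) ℝ}
    (hΦ : IsAffineAut n Φ A) (hΨ : IsAffineAut n Ψ B) : IsAffineAut n (Φ.trans Ψ) (B * A) where
  vertex_iff X := (hΨ.vertex_iff _).trans (hΦ.vertex_iff X)
  affine X hX := by
    have h2 := hΨ.affine (Φ X) (by rwa [hΦ.vertex_iff])
    filter_upwards [hΦ.affine X hX, (tendsto_mulVec_zero A).eventually h2] with u a1 a2 Y hD
    rw [← mulVec_mulVec]
    exact a2 _ (a1 Y hD)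

theorem IsAffineAut.symm {Φ : Surface n ≃ₜ Surface n} {A B : Matrix (Fin 2) (Fin 2) ℝ}
    (hΦ : IsAffineAut n Φ A) (hAB : A * B = 1) : IsAffineAut n Φ.symm B where
  vertex_iff X := by
    rw [← hΦ.vertex_iff, Φ.apply_symm_apply]
  affine X hX := by
    have hX' : ¬ IsVertex n (Φ.symm X) := by
      rwa [← hΦ.vertex_iff, Φ.apply_symm_apply]
    filter_upwards [eventually_disp_unique hX, (tendsto_mulVec_zero B).eventually
      (eventually_exists_disp hX'), (tendsto_mulVec_zero B).eventually (hΦ.affine _ hX')]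
      with u a1 ⟨Z, hZ⟩ a3 Y hD
    have h := a3 Z hZ
    rw [Φ.apply_symm_apply, mulVec_mulVec, hAB, one_mulVec] at h
    rw [a1 _ _ hD h, Φ.symm_apply_apply]
    exact hZ

theorem isAffineAut_halfTurn : IsAffineAut n (halfTurn n) (-1) where
  vertex_iff := isVertex_halfTurn
  affine X _ := Eventually.of_forall fun u Y hD => by
    rw [neg_mulVec, one_mulVec]; exact hD.halfTurn

theorem IsAffineAut.isPath {Φ : Surface n ≃ₜ Surface n} {A : Matrix (Fin 2) (Fin 2) ℝ}
    (hΦ : IsAffineAut n Φ A) {γ : ℝ → Surface n} {v : Plane} {S : ℝ} (h : IsPath n γ v S)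
    (hv : ∀ t ∈ Set.Icc 0 S, ¬ IsVertex n (γ t)) : IsPath n (Φ ∘ γ) (A *ᵥ v) S := by
  intro t ht
  have tend : Tendsto (fun r : ℝ => r • v) (𝓝 0) (𝓝 0) := by
    have : Continuous (fun r : ℝ => r • v) := by fun_prop
    simpa using this.tendsto 0
  filter_upwards [h t ht, tend.eventually (hΦ.affine _ (hv t ht))] with r h1 h2 hr
  rw [← mulVec_smul]
  exact h2 _ (h1 hr)

theorem IsAffineAut.isTrajectory {Φ : Surface n ≃ₜ Surface n} {A : Matrix (Fin 2) (Fin 2) ℝ}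
    (hΦ : IsAffineAut n Φ A) {τ : ℝ → Surface n} {v : Plane} (h : IsTrajectory n τ v) :
    IsTrajectory n (Φ ∘ τ) (A *ᵥ v) := by
  intro t
  have tend : Tendsto (fun r : ℝ => r • v) (𝓝 0) (𝓝 0) := by
    have : Continuous (fun r : ℝ => r • v) := by fun_prop
    simpa using this.tendsto 0
  refine ⟨fun hv => (h t).1 ((hΦ.vertex_iff _).1 hv), ?_⟩
  filter_upwards [(h t).2, tend.eventually (hΦ.affine _ (h t).1)] with r h1 h2
  rw [← mulVec_smul]
  exact h2 _ h1

theorem InRect.segment {p : ℕ} {s t a b S : ℝ} (h : InRect n p s t)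
    (h' : InRect n p (s + S * a) (t + S * b)) {r : ℝ} (hr : r ∈ Set.Icc 0 S) :
    InRect n p (s + r * a) (t + r * b) := by
  have key : ∀ x y c : ℝ, 0 ≤ x → x ≤ y → 0 ≤ x + S * c → x + S * c ≤ y →
      0 ≤ x + r * c ∧ x + r * c ≤ y := by
    intro x y c h1 h2 h3 h4
    obtain ⟨hr0, hr1⟩ := hr
    rcases le_total 0 c with hc | hc
    · constructor <;> nlinarith [mul_nonneg hr0 hc, mul_le_mul_of_nonneg_right hr1 hc]
    · constructor <;> nlinarith [mul_nonneg_of_nonpos_of_nonpos hc (neg_nonpos.2 hr0),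
        mul_le_mul_of_nonpos_right hr1 hc]
  have k1 := key s (lam n p) a h.s_nonneg h.s_le h'.s_nonneg h'.s_le
  have k2 := key t (lam n (p + 1)) b h.t_nonneg h.t_le h'.t_nonneg h'.t_le
  exact ⟨k1.1, k1.2, k2.1, k2.2⟩

theorem isPath_rho (m : ℤ) {p : ℕ} (hp : p < n) {s t a b S : ℝ} (h : InRect n p s t)
    (h' : InRect n p (s + S * a) (t + S * b)) :
    IsPath n (fun r => rho n m p (s + r * a) (t + r * b)) (a • drc n m p + b • drc n m (p + 1)) S := by
  intro r hr
  have hd := rho_disp m hp (h.segment h' hr)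
  have tend : Tendsto (fun e : ℝ => (s + (r + e) * a, t + (r + e) * b)) (𝓝 0)
      (𝓝 (s + r * a, t + r * b)) := by
    have : Continuous (fun e : ℝ => (s + (r + e) * a, t + (r + e) * b)) := by fun_prop
    simpa using this.tendsto 0
  filter_upwards [tend.eventually hd] with e he hr'
  convert he (h.segment h' hr') using 1
  module

theorem drc_odd (m : ℤ) {p : ℕ} (hp : Odd p) : drc n m p = drc n m 1 := by
  obtain ⟨i, rfl⟩ := hp
  induction i with
  | zero => rfl
  | succ i ih => rw [show 2 * (i + 1) + 1 = 2 * i + 1 + 2 by ring, drc_add_two, ih]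

/-- A translation of the surface fixes the midpoint of the edge at position `0`. -/
theorem translation_fix_mid (m : ℤ) {Ψ : Surface n ≃ₜ Surface n} (hΨ : IsAffineAut n Ψ 1) :
    Ψ (rho n m 1 (1 / 2) 0) = rho n m 1 (1 / 2) 0 := by
  have h3 : 3 ≤ n := three_le
  have hl1 : lam n 1 = 1 := lam_one
  have hl2 : 0 ≤ lam n 2 := lam_nonneg (by omega)
  have hmid : InRect n 1 (1 / 2) 0 := ⟨by norm_num, by rw [hl1]; norm_num, le_rfl, hl2⟩
  have hsymm := hΨ.symm (B := 1) (by simp)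
  obtain ⟨p, s, t, h1, h2, h, hy⟩ := exists_rho m (Ψ (rho n m 1 (1 / 2) 0))
  have hp : p < n := by omega
  have hyv : ¬ IsCrn n p s t := by
    rw [← isVertex_rho_iff m hp h, ← hy, hΨ.vertex_iff, isVertex_rho_iff m (by omega) hmid]
    rintro ⟨h | h, -⟩
    · norm_num at h
    · rw [hl1] at h; norm_num at h
  -- A path of length `1 / 2` along the direction of the edge at position `0`, starting at the image
  -- point and free of vertices, would be carried back to half of that edge, which ends at a vertex.
  -- So neither direction allows such a path.
  have nofree : ∀ a b ε : ℝ, (ε = 1 ∨ ε = -1) →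
      a • drc n m p + b • drc n m (p + 1) = ε • drc n m 1 →
      InRect n p (s + 1 / 2 * a) (t + 1 / 2 * b) →
      (∀ r ∈ Set.Icc (0 : ℝ) (1 / 2), ¬ IsCrn n p (s + r * a) (t + r * b)) → False := by
    intro a b ε hε hd hend hnc
    have p1 := isPath_rho m hp h hend
    have hnv : ∀ r ∈ Set.Icc (0 : ℝ) (1 / 2), ¬ IsVertex n (rho n m p (s + r * a) (t + r * b)) :=
      fun r hr => by
        rw [isVertex_rho_iff m hp (h.segment hend hr)]; exact hnc r hr
    have p2 := hsymm.isPath p1 hnv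
    rw [one_mulVec, hd] at p2
    have hend' : InRect n 1 (1 / 2 + 1 / 2 * ε) (0 + 1 / 2 * 0) := by
      rcases hε with rfl | rfl
      · exact ⟨by norm_num, by rw [hl1]; norm_num, by norm_num, by simpa using hl2⟩
      · exact ⟨by norm_num, by rw [hl1]; norm_num, by norm_num, by simpa using hl2⟩
    have p3 := isPath_rho m (by omega : 1 < n) hmid hend'
    rw [zero_smul, add_zero] at p3
    have hv2 : ∀ r ∈ Set.Icc (0 : ℝ) (1 / 2),
        ¬ IsVertex n ((Ψ.symm ∘ fun r => rho n m p (s + r * a) (t + r * b)) r) := fun r hr => by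
      rw [Function.comp_apply, hsymm.vertex_iff]; exact hnv r hr
    have heq := p2.eq p3 hv2 (by simp [← hy]) (1 / 2) ⟨by norm_num, le_rfl⟩
    apply hv2 (1 / 2) ⟨by norm_num, le_rfl⟩
    rw [heq, isVertex_rho_iff m (by omega) hend']
    refine ⟨?_, Or.inl (by norm_num)⟩
    rw [hl1]
    rcases hε with rfl | rfl
    · right; norm_num
    · left; norm_num
  have hq1 : 1 ≤ lam n p := one_le_lam h1 (by omega)
  have hq2 : 1 ≤ lam n (p + 1) := one_le_lam (by omega) (by omega)
  have := h.s_nonneg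
  have := h.s_le
  have := h.t_nonneg
  have := h.t_le
  rcases Nat.even_or_odd p with he | ho
  · exfalso
    have hd : drc n m (p + 1) = drc n m 1 := drc_odd m he.add_one
    have hdir : ∀ ε : ℝ, (0 : ℝ) • drc n m p + ε • drc n m (p + 1) = ε • drc n m 1 := by
      intro ε; rw [hd, zero_smul, zero_add]
    -- Here `p` is even and `n` is odd, so `3 ≤ p + 1 ≤ n - 2`.
    have hbig : s = 0 ∨ s = lam n p → 1 < lam n (p + 1) := fun _ => by
      obtain ⟨N, hN, -⟩ := exists_half (n := n)
      obtain ⟨i, hi⟩ := he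
      exact one_lt_lam (by omega) (by omega)
    by_cases hs : s = 0 ∨ s = lam n p
    · have hb := hbig hs
      have ht0 : t ≠ 0 := fun e => hyv ⟨hs, Or.inl e⟩
      have ht1 : t ≠ lam n (p + 1) := fun e => hyv ⟨hs, Or.inr e⟩
      have ht0' : 0 < t := lt_of_le_of_ne h.t_nonneg (Ne.symm ht0)
      have ht1' : t < lam n (p + 1) := lt_of_le_of_ne h.t_le ht1
      by_cases hlt : t + 1 / 2 < lam n (p + 1)
      · refine nofree 0 1 1 (Or.inl rfl) (hdir 1)
          ⟨by linarith, by linarith, by linarith, by linarith⟩ ?_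
        rintro r ⟨hr0, hr1⟩ ⟨-, hc | hc⟩ <;> linarith
      · refine nofree 0 (-1) (-1) (Or.inr rfl) (hdir _)
          ⟨by linarith, by linarith, by linarith, by linarith⟩ ?_
        rintro r ⟨hr0, hr1⟩ ⟨-, hc | hc⟩ <;> linarith
    · by_cases hlt : t ≤ 1 / 2
      · refine nofree 0 1 1 (Or.inl rfl) (hdir 1)
          ⟨by linarith, by linarith, by linarith, by linarith⟩ ?_
        rintro r - ⟨hc, -⟩
        rw [mul_zero, add_zero] at hc
        exact hs hc
      · refine nofree 0 (-1) (-1) (Or.inr rfl) (hdir _)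
          ⟨by linarith, by linarith, by linarith, by linarith⟩ ?_
        rintro r - ⟨hc, -⟩
        rw [mul_zero, add_zero] at hc
        exact hs hc
  · have hd : drc n m p = drc n m 1 := drc_odd m ho
    have hdir : ∀ ε : ℝ, ε • drc n m p + (0 : ℝ) • drc n m (p + 1) = ε • drc n m 1 := by
      intro ε; rw [hd, zero_smul, add_zero]
    by_cases ht : t = 0 ∨ t = lam n (p + 1)
    · have hs0 : s ≠ 0 := fun e => hyv ⟨Or.inl e, ht⟩
      have hs1 : s ≠ lam n p := fun e => hyv ⟨Or.inr e, ht⟩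
      have hs0' : 0 < s := lt_of_le_of_ne h.s_nonneg (Ne.symm hs0)
      have hs1' : s < lam n p := lt_of_le_of_ne h.s_le hs1
      have hA : ¬ s + 1 / 2 < lam n p := fun hlt => by
        refine nofree 1 0 1 (Or.inl rfl) (hdir 1)
          ⟨by linarith, by linarith, by linarith, by linarith⟩ ?_
        rintro r ⟨hr0, hr1⟩ ⟨hc | hc, -⟩ <;> linarith
      have hB : ¬ 1 / 2 < s := fun hlt => by
        refine nofree (-1) 0 (-1) (Or.inr rfl) (hdir _)
          ⟨by linarith, by linarith, by linarith, by linarith⟩ ?_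
        rintro r ⟨hr0, hr1⟩ ⟨hc | hc, -⟩ <;> linarith
      -- There is at most `1 / 2` of room on either side, while the side has length at least `1`; so
      -- its length is exactly `1`, which leaves only `p = 1`.
      have hs : s = 1 / 2 := by linarith
      have hp1 : p = 1 := by
        by_contra hne
        have := one_lt_lam (n := n) (q := p) (by omega) h2
        linarith
      subst hp1 hs
      rw [hy]
      rcases ht with rfl | rfl
      · rfl
      · have f1 := rho_right m (n := n) (p := 0) (by omega) (t := 1 / 2) (by norm_num)
          (by rw [zero_add, hl1]; norm_num)
        have f2 := rho_top m (n := n) (p := 0) (by omega) (s := 1 / 2) (by norm_num)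
          (by rw [zero_add, hl1]; norm_num)
        rw [lam_zero, zero_add] at f1
        rw [zero_add, zero_add] at f2
        rw [← f1]; exact f2
    · exfalso
      by_cases hlt : s ≤ 1 / 2
      · refine nofree 1 0 1 (Or.inl rfl) (hdir 1)
          ⟨by linarith, by linarith, by linarith, by linarith⟩ ?_
        rintro r - ⟨-, hc⟩
        rw [mul_zero, add_zero] at hc
        exact ht hc
      · refine nofree (-1) 0 (-1) (Or.inr rfl) (hdir _)
          ⟨by linarith, by linarith, by linarith, by linarith⟩ ?_
        rintro r - ⟨-, hc⟩
        rw [mul_zero, add_zero] at hc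
        exact ht hc

/-- Corners are extreme points: if the segment met one, the functionals of both adjacent edges would
vanish at `x`, which would then lie on two different edges without being a corner. -/
theorem segment_not_corner {x y : Plane} (hx : x ∈ polygon n true) (hy : y ∈ polygon n true)
    (hcx : x ∉ corners n true) (hcy : y ∉ corners n true) {r : ℝ} (hr : r ∈ Set.Icc (0 : ℝ) 1) :
    (1 - r) • x + r • y ∉ corners n true := by
  have h3 : 3 ≤ n := three_le
  intro hc
  rcases hr.1.eq_or_lt with rfl | h0
  · simp at hc; exact hcx hc
  rcases hr.2.eq_or_lt with rfl | h1
  · simp at hc; exact hcy hc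
  obtain ⟨i, hi⟩ := mem_corners_iff.1 hc
  have key : ∀ j, FF n j (V n i) = 0 → FF n j x = 0 := by
    intro j hj
    rw [← hi, FF_comb j (by ring)] at hj
    have a1 := FF_nonneg j hx
    have a2 := FF_nonneg j hy
    have h4 : 0 < 1 - r := by linarith
    nlinarith [mul_nonneg h4.le a1, mul_nonneg h0.le a2]
  have k1 := (mem_edge_iff hx).2 (key i ((FF_V_eq_zero_iff _ _).2 (by simp)))
  have k2 := (mem_edge_iff hx).2 (key (i - 1) ((FF_V_eq_zero_iff _ _).2 (by simp)))
  have := lbl_eq_iff.1 (edge_unique k1 k2 hcx)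
  rw [sub_sub_cancel] at this
  have := Int.le_of_dvd (by norm_num) this
  omega

/-- The surface has no translations. -/
theorem translation_eq_id {Ψ : Surface n ≃ₜ Surface n} (hΨ : IsAffineAut n Ψ 1) (X : Surface n) :
    Ψ X = X := by
  have h3 : 3 ≤ n := three_le
  by_cases hX : IsVertex n X
  · exact isVertex_unique ((hΨ.vertex_iff X).2 hX) hX
  have hfix := translation_fix_mid 0 hΨ
  have hl1 : lam n 1 = 1 := lam_one
  have hl2 : 0 ≤ lam n 2 := lam_nonneg (by omega)
  have hmid : InRect n 1 (1 / 2) 0 := ⟨by norm_num, by rw [hl1]; norm_num, le_rfl, hl2⟩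
  have hmidT : InTri n 1 (1 / 2) 0 := hmid.lower (by
    rw [hl1, show 1 + 1 = 2 by rfl]; linarith)
  have hPm := Tri_mem 0 (by omega : 1 < n) hmidT
  have hmv : ¬ IsVertex n (rho n 0 1 (1 / 2) 0) := by
    rw [isVertex_rho_iff 0 (by omega) hmid]
    rintro ⟨h | h, -⟩
    · norm_num at h
    · rw [hl1] at h; norm_num at h
  have hedge : Tri n 0 1 (1 / 2) 0 ∈ edge n (lab n 0 0) := by
    rw [edge_lab, ← zig_one, zero_add, ← Tri_zero_zero 0 1, ← Tri_lam_zero]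
    refine ⟨1 / 2, 1 / 2, by norm_num, by norm_num, by norm_num, ?_⟩
    rw [Tri_comb _ _ (by norm_num), hl1]; norm_num
  obtain ⟨b, x, hx, rfl⟩ := exists_pt X
  -- The fixed midpoint lies on an edge and hence in both polygons, so it can be joined to any point
  -- by a segment inside one polygon. The translation fixes the start and the velocity of this
  -- segment, hence its end.
  obtain ⟨c, hc, hmc⟩ : ∃ c ∈ polygon n true, rho n 0 1 (1 / 2) 0 = pt n b c := by
    rw [rho_lower 0 hmidT]
    by_cases hb : b = par 1
    · exact ⟨_, hPm, by rw [hb]⟩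
    · rw [Bool.eq_not_of_ne hb]
      exact ⟨_, edge_subset_polygon _ (turn_mem_edge hedge), (pt_turn hedge).symm⟩
  rw [hmc, isVertex_pt hc] at hmv
  rw [isVertex_pt hx] at hX
  have hend : c + (1 : ℝ) • (sgn b • (sgn b • (x - c))) = x := by simp
  have hpath := isPath_pt (b := b) (v := sgn b • (x - c)) hc (hend.symm ▸ hx) zero_le_one
  have hnv : ∀ r ∈ Set.Icc (0 : ℝ) 1,
      ¬ IsVertex n (pt n b (c + r • (sgn b • (sgn b • (x - c))))) := by
    intro r hr
    have e : c + r • (sgn b • (sgn b • (x - c))) = (1 - r) • c + r • x := by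
      rw [sgn_smul_sgn_smul]; module
    have hm : (1 - r) • c + r • x ∈ polygon n true :=
      convex_polygon true hc hx (by linarith [hr.2]) hr.1 (by ring)
    rw [e, isVertex_pt hm]
    exact segment_not_corner hc hx hmv hX hr
  have hpath' := hΨ.isPath hpath hnv
  rw [one_mulVec] at hpath'
  have := hpath.eq hpath' hnv (by simpa [← hmc] using hfix.symm) 1 ⟨zero_le_one, le_rfl⟩
  simp only [Function.comp_apply] at this
  rw [hend] at this
  exact this.symm

theorem mul_self_eq_one {m : ℤ} {A : Matrix (Fin 2) (Fin 2) ℝ}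
    (hA : ∀ p, A *ᵥ drc n m p = sgn (par p) • drc n m p) : A * A = 1 := by
  have h : ∀ u : Plane, (A * A) *ᵥ u = u := by
    intro u
    rw [eq_drc (n := n) m 0 u, ← mulVec_mulVec]
    simp only [mulVec_add, mulVec_smul, hA, smul_smul, mul_assoc, sgn_mul_self, mul_one]
  ext i j
  have := congrFun (h (Pi.single j 1)) i
  rw [mulVec_single_one] at this
  simpa [Matrix.col, Pi.single_apply, Matrix.one_apply] using this

theorem reflect_reflect (m : ℤ) (X : Surface n) : reflect n m (reflect n m X) = X := by
  obtain ⟨p, s, t, h1, h2, h, rfl⟩ := exists_rho m X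
  rw [reflect_rho m h1 h2 h]
  unfold rhoF
  split_ifs with he
  · rw [reflect_rho m h1 h2 ⟨h.s_nonneg, h.s_le, h.compl.t_nonneg, h.compl.t_le⟩, rhoF, if_pos he,
      sub_sub_cancel]
  · rw [reflect_rho m h1 h2 ⟨h.compl.s_nonneg, h.compl.s_le, h.t_nonneg, h.t_le⟩, rhoF, if_neg he,
      sub_sub_cancel]

/-- `A` is an involution, so the composite of `reflect` and `Φ` has derivative `1` and is the
identity. -/
theorem eq_reflect {m : ℤ} {A : Matrix (Fin 2) (Fin 2) ℝ}
    (hA : ∀ p, A *ᵥ drc n m p = sgn (par p) • drc n m p) {Φ : Surface n ≃ₜ Surface n}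
    (hΦ : IsAffineAut n Φ A) (X : Surface n) : Φ X = reflect n m X := by
  have h := (isAffineAut_reflect hA).trans hΦ
  rw [mul_self_eq_one hA] at h
  have := translation_eq_id h (reflect n m X)
  rwa [Homeomorph.trans_apply, reflect_reflect] at this

end Uniqueness

end DoubleGon

end

noncomputable section

namespace DoubleGon

/-! ### Passages of a trajectory through the parallelograms -/

section Passages

variable {n : ℕ} [Fact (3 ≤ n)] [Fact (Odd n)]

/-- The velocity `a h + b u`, where `h` and `u` are the two directions of the zigzag. -/
def vel (n : ℕ) (m : ℤ) (a b : ℝ) : Plane := a • drc n m 1 + b • drc n m 0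

/-- The component of the velocity along `drc p`. -/
def spd (a b : ℝ) (p : ℕ) : ℝ := if Even p then b else a

theorem spd_add_two (a b : ℝ) (p : ℕ) : spd a b (p + 2) = spd a b p := by
  simp [spd, Nat.even_add]

theorem vel_eq (m : ℤ) (a b : ℝ) (p : ℕ) :
    vel n m a b = spd a b p • drc n m p + spd a b (p + 1) • drc n m (p + 1) := by
  induction p with
  | zero => simp [vel, spd, add_comm]
  | succ p ih => rw [ih, show p + 1 + 1 = p + 2 by ring, drc_add_two, spd_add_two, add_comm]

theorem spd_nonneg {a b : ℝ} (ha : 0 ≤ a) (hb : 0 ≤ b) (p : ℕ) : 0 ≤ spd a b p := by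
  unfold spd; split_ifs <;> assumption

theorem spd_pos_of_eq_zero {m : ℤ} {a b : ℝ} (ha : 0 ≤ a) (hb : 0 ≤ b)
    (hv : vel n m a b ≠ 0) {p : ℕ} (h : spd a b p = 0) : 0 < spd a b (p + 1) := by
  refine lt_of_le_of_ne (spd_nonneg ha hb _) fun h' => hv ?_
  rw [vel_eq m a b p, h, ← h', zero_smul, zero_smul, add_zero]

/-- Reversing time and applying the half-turn keeps the velocity, so statements about the past
follow from those about the future. -/
theorem IsTrajectory.reverse {τ : ℝ → Surface n} {v : Plane} (h : IsTrajectory n τ v) :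
    IsTrajectory n (fun r => halfTurn n (τ (-r))) v := by
  intro t
  refine ⟨fun hv => (h (-t)).1 ((isVertex_halfTurn _).1 hv), ?_⟩
  have tend : Tendsto (fun r : ℝ => -r) (𝓝 0) (𝓝 0) := by simpa using (continuous_neg (G := ℝ)).tendsto 0
  filter_upwards [tend.eventually (h (-t)).2] with r hr
  have := hr.halfTurn
  rwa [neg_smul, neg_neg, ← neg_add] at this

theorem IsTrajectory.eq_rho {τ : ℝ → Surface n} {m : ℤ} {a b : ℝ}
    (h : IsTrajectory n τ (vel n m a b)) {p : ℕ} (hp : p < n) {T S s t : ℝ}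
    (hR : InRect n p s t)
    (hR' : InRect n p (s + S * spd a b p) (t + S * spd a b (p + 1)))
    (hT : τ T = rho n m p s t) {r : ℝ} (hr : r ∈ Set.Icc 0 S) :
    τ (T + r) = rho n m p (s + r * spd a b p) (t + r * spd a b (p + 1)) := by
  have h1 := h.isPath T S
  have h2 := isPath_rho m hp hR hR'
  rw [← vel_eq] at h2
  exact h1.eq h2 (fun t _ => (h _).1) (by simpa using hT) r hr

/-- The exit of a trajectory from a parallelogram. -/
theorem IsTrajectory.exists_exit {τ : ℝ → Surface n} {m : ℤ} {a b : ℝ} (ha : 0 ≤ a) (hb : 0 ≤ b)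
    (hv : vel n m a b ≠ 0) (h : IsTrajectory n τ (vel n m a b)) {p : ℕ} (hp : p < n) {T s t : ℝ}
    (hR : InRect n p s t) (hT : τ T = rho n m p s t) :
    ∃ D, 0 ≤ D ∧ InRect n p (s + D * spd a b p) (t + D * spd a b (p + 1)) ∧
      ((s + D * spd a b p = lam n p ∧ 0 < t + D * spd a b (p + 1) ∧
        t + D * spd a b (p + 1) < lam n (p + 1)) ∨
      (t + D * spd a b (p + 1) = lam n (p + 1) ∧ 0 < s + D * spd a b p ∧
        s + D * spd a b p < lam n p)) ∧ ((p = 0 ∨ p + 1 = n) → D = 0) := by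
  have key : ∀ D, 0 ≤ D → InRect n p (s + D * spd a b p) (t + D * spd a b (p + 1)) →
      ¬ IsCrn n p (s + D * spd a b p) (t + D * spd a b (p + 1)) := by
    intro D hD hR' hc
    have := h.eq_rho hp hR hR' hT (r := D) ⟨hD, le_rfl⟩
    rw [← isVertex_rho_iff m hp hR', ← this] at hc
    exact (h _).1 hc
  have w0 := spd_nonneg ha hb p
  have w1 := spd_nonneg ha hb (p + 1)
  have hs0 := hR.s_nonneg
  have hs1 := hR.s_le
  have ht0 := hR.t_nonneg
  have ht1 := hR.t_le
  have lft : ∀ D, 0 ≤ D → s + D * spd a b p = lam n p →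
      t + D * spd a b (p + 1) ≤ lam n (p + 1) → ((p = 0 ∨ p + 1 = n) → D = 0) →
      ∃ D, 0 ≤ D ∧ InRect n p (s + D * spd a b p) (t + D * spd a b (p + 1)) ∧
      ((s + D * spd a b p = lam n p ∧ 0 < t + D * spd a b (p + 1) ∧
        t + D * spd a b (p + 1) < lam n (p + 1)) ∨
      (t + D * spd a b (p + 1) = lam n (p + 1) ∧ 0 < s + D * spd a b p ∧
        s + D * spd a b p < lam n p)) ∧ ((p = 0 ∨ p + 1 = n) → D = 0) := by
    intro D hD e1 e2 e3
    have hR' : InRect n p (s + D * spd a b p) (t + D * spd a b (p + 1)) :=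
      ⟨by positivity, e1.le, by positivity, e2⟩
    have hc := key D hD hR'
    refine ⟨D, hD, hR', Or.inl ⟨e1, lt_of_le_of_ne hR'.t_nonneg fun e => ?_,
      lt_of_le_of_ne e2 fun e => ?_⟩, e3⟩
    · exact hc ⟨Or.inr e1, Or.inl e.symm⟩
    · exact hc ⟨Or.inr e1, Or.inr e⟩
  have top : ∀ D, 0 ≤ D → t + D * spd a b (p + 1) = lam n (p + 1) →
      s + D * spd a b p ≤ lam n p → ((p = 0 ∨ p + 1 = n) → D = 0) →
      ∃ D, 0 ≤ D ∧ InRect n p (s + D * spd a b p) (t + D * spd a b (p + 1)) ∧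
      ((s + D * spd a b p = lam n p ∧ 0 < t + D * spd a b (p + 1) ∧
        t + D * spd a b (p + 1) < lam n (p + 1)) ∨
      (t + D * spd a b (p + 1) = lam n (p + 1) ∧ 0 < s + D * spd a b p ∧
        s + D * spd a b p < lam n p)) ∧ ((p = 0 ∨ p + 1 = n) → D = 0) := by
    intro D hD e1 e2 e3
    have hR' : InRect n p (s + D * spd a b p) (t + D * spd a b (p + 1)) :=
      ⟨by positivity, e2, by positivity, e1.le⟩
    have hc := key D hD hR'
    refine ⟨D, hD, hR', Or.inr ⟨e1, lt_of_le_of_ne hR'.s_nonneg fun e => ?_,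
      lt_of_le_of_ne e2 fun e => ?_⟩, e3⟩
    · exact hc ⟨Or.inl e.symm, Or.inr e1⟩
    · exact hc ⟨Or.inr e, Or.inr e1⟩
  have z0 : p = 0 → lam n p - s = 0 := by rintro rfl; rw [lam_zero] at *; linarith
  have z1 : p + 1 = n → lam n (p + 1) - t = 0 := by
    intro e
    have h0 : lam n (p + 1) = 0 := by rw [e, lam_n]
    linarith
  rcases w0.eq_or_lt with e0 | e0
  · have e1 := spd_pos_of_eq_zero ha hb hv e0.symm
    refine top ((lam n (p + 1) - t) / spd a b (p + 1)) (div_nonneg (by linarith) w1)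
      (by field_simp; ring) (by rw [← e0]; linarith) ?_
    rintro (e | e)
    -- The velocity would be parallel to the edge to which the parallelogram degenerates, and the
    -- trajectory would run into its endpoint.
    · exfalso
      refine key ((lam n (p + 1) - t) / spd a b (p + 1)) (div_nonneg (by linarith) w1) ?_ ?_
      · rw [← e0, div_mul_cancel₀ _ e1.ne']
        exact ⟨by linarith, by linarith, by linarith, by linarith⟩
      · rw [← e0, div_mul_cancel₀ _ e1.ne']
        exact ⟨Or.inr (by linarith [z0 e]), Or.inr (by ring)⟩
    · rw [z1 e, zero_div]
  rcases w1.eq_or_lt with e1 | e1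
  · refine lft ((lam n p - s) / spd a b p) (div_nonneg (by linarith) w0)
      (by field_simp; ring) (by rw [← e1]; linarith) ?_
    rintro (e | e)
    · rw [z0 e, zero_div]
    · exfalso
      refine key ((lam n p - s) / spd a b p) (div_nonneg (by linarith) w0) ?_ ?_
      · rw [← e1, div_mul_cancel₀ _ e0.ne']
        exact ⟨by linarith, by linarith, by linarith, by linarith⟩
      · rw [← e1, div_mul_cancel₀ _ e0.ne']
        exact ⟨Or.inr (by ring), Or.inr (by linarith [z1 e])⟩
  have n0 : 0 ≤ (lam n p - s) / spd a b p := div_nonneg (by linarith) w0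
  have n1 : 0 ≤ (lam n (p + 1) - t) / spd a b (p + 1) := div_nonneg (by linarith) w1
  -- The exit time is the smaller of the times at which the right and the top side are reached.
  rcases le_total ((lam n p - s) / spd a b p) ((lam n (p + 1) - t) / spd a b (p + 1)) with hle | hle
  · refine lft _ n0 (by field_simp; ring) ?_ ?_
    · rw [le_div_iff₀ e1] at hle; linarith
    · rintro (e | e)
      · rw [z0 e, zero_div]
      · rw [z1 e, zero_div] at hle
        exact le_antisymm hle n0
  · refine top _ n1 (by field_simp; ring) ?_ ?_
    · rw [le_div_iff₀ e0] at hle; linarith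
    · rintro (e | e)
      · rw [z0 e, zero_div] at hle
        exact le_antisymm hle n1
      · rw [z1 e, zero_div]

/-- The entry of a trajectory into a parallelogram. -/
theorem IsTrajectory.exists_entry {τ : ℝ → Surface n} {m : ℤ} {a b : ℝ} (ha : 0 ≤ a) (hb : 0 ≤ b)
    (hv : vel n m a b ≠ 0) (h : IsTrajectory n τ (vel n m a b)) {p : ℕ} (hp : p < n) {T s t : ℝ}
    (hR : InRect n p s t) (hT : τ T = rho n m p s t) :
    ∃ D, 0 ≤ D ∧ InRect n p (s - D * spd a b p) (t - D * spd a b (p + 1)) ∧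
      τ (T - D) = rho n m p (s - D * spd a b p) (t - D * spd a b (p + 1)) ∧
      ((s - D * spd a b p = 0 ∧ 0 < t - D * spd a b (p + 1) ∧
        t - D * spd a b (p + 1) < lam n (p + 1)) ∨
      (t - D * spd a b (p + 1) = 0 ∧ 0 < s - D * spd a b p ∧
        s - D * spd a b p < lam n p)) ∧ ((p = 0 ∨ p + 1 = n) → D = 0) := by
  have hT' : (fun r => halfTurn n (τ (-r))) (-T) = rho n m p (lam n p - s) (lam n (p + 1) - t) := by
    simp only [neg_neg, hT]
    exact halfTurn_rho m hp hR
  obtain ⟨D, hD, hR', hex, hdeg⟩ := h.reverse.exists_exit ha hb hv hp hR.compl hT'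
  have hτ := h.reverse.eq_rho hp hR.compl hR' hT' (r := D) ⟨hD, le_rfl⟩
  have e1 : lam n p - (lam n p - s + D * spd a b p) = s - D * spd a b p := by ring
  have e2 : lam n (p + 1) - (lam n (p + 1) - t + D * spd a b (p + 1)) =
      t - D * spd a b (p + 1) := by ring
  have hc := hR'.compl
  rw [e1, e2] at hc
  refine ⟨D, hD, hc, ?_, ?_, hdeg⟩
  · have := congrArg (halfTurn n) hτ
    simp only [halfTurn_halfTurn, neg_add, neg_neg] at this
    rw [halfTurn_rho m hp hR', e1, e2] at this
    rw [sub_eq_add_neg T]; exact this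
  · rcases hex with ⟨x1, x2, x3⟩ | ⟨x1, x2, x3⟩
    · exact Or.inl ⟨by linarith, by linarith, by linarith⟩
    · exact Or.inr ⟨by linarith, by linarith, by linarith⟩

/-- A passage of the trajectory `τ` through the parallelogram at position `p`, from the time `T`
to the time `T + D`. -/
structure Passage (n : ℕ) [Fact (3 ≤ n)] (m : ℤ) (a b : ℝ) (τ : ℝ → Surface n) where
  /-- the entry time -/
  T : ℝ
  /-- the duration -/
  D : ℝ
  /-- the position of the parallelogram -/
  p : ℕ
  /-- the first parameter of the entry point -/
  s : ℝ
  /-- the second parameter of the entry point -/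
  t : ℝ
  /-- the first parameter of the exit point -/
  s' : ℝ
  /-- the second parameter of the exit point -/
  t' : ℝ
  hp : p < n
  hD : 0 ≤ D
  hs' : s' = s + D * spd a b p
  ht' : t' = t + D * spd a b (p + 1)
  inRect : InRect n p s t
  inRect' : InRect n p s' t'
  entry : (s = 0 ∧ 0 < t ∧ t < lam n (p + 1)) ∨ (t = 0 ∧ 0 < s ∧ s < lam n p)
  exit : (s' = lam n p ∧ 0 < t' ∧ t' < lam n (p + 1)) ∨ (t' = lam n (p + 1) ∧ 0 < s' ∧ s' < lam n p)
  deg : (p = 0 ∨ p + 1 = n) → D = 0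
  hτ : τ T = rho n m p s t

variable {m : ℤ} {a b : ℝ} {τ : ℝ → Surface n}

/-- The passage `y` follows the passage `x`. -/
def Passage.Next (x y : Passage n m a b τ) : Prop :=
  y.T = x.T + x.D ∧
    ((y.p = x.p + 1 ∧ x.s' = lam n x.p ∧ 0 < x.t' ∧ x.t' < lam n (x.p + 1) ∧ y.s = x.t' ∧ y.t = 0) ∨
    (x.p = y.p + 1 ∧ x.t' = lam n (x.p + 1) ∧ 0 < x.s' ∧ x.s' < lam n x.p ∧ y.s = 0 ∧ y.t = x.s'))

theorem Passage.apply (x : Passage n m a b τ) (h : IsTrajectory n τ (vel n m a b)) {r : ℝ}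
    (hr : r ∈ Set.Icc 0 x.D) :
    τ (x.T + r) = rho n m x.p (x.s + r * spd a b x.p) (x.t + r * spd a b (x.p + 1)) :=
  h.eq_rho x.hp x.inRect (by rw [← x.hs', ← x.ht']; exact x.inRect') x.hτ hr

theorem Passage.apply_exit (x : Passage n m a b τ) (h : IsTrajectory n τ (vel n m a b)) :
    τ (x.T + x.D) = rho n m x.p x.s' x.t' := by
  rw [x.apply h ⟨x.hD, le_rfl⟩, x.hs', x.ht']

theorem exists_passage (ha : 0 ≤ a) (hb : 0 ≤ b) (hv : vel n m a b ≠ 0)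
    (h : IsTrajectory n τ (vel n m a b)) : Nonempty (Passage n m a b τ) := by
  obtain ⟨p, s, t, h1, h2, hR, hT⟩ := exists_rho m (τ 0)
  have hp : p < n := by omega
  obtain ⟨D, hD, hR', hex, -⟩ := h.exists_exit ha hb hv hp hR hT
  obtain ⟨D', hD', hR'', hτ, hen, -⟩ := h.exists_entry ha hb hv hp hR hT
  exact ⟨⟨0 - D', D' + D, p, s - D' * spd a b p, t - D' * spd a b (p + 1), s + D * spd a b p,
    t + D * spd a b (p + 1), hp, by positivity, by ring, by ring, hR'', hR', hen, hex,
    fun hd => by omega, hτ⟩⟩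

/-- Leaving by the right side enters `p + 1` at the bottom, leaving by the top enters `p - 1` on the
left. The strict inequalities in `exit` exclude the right side at `p = n - 1` and the top at `p =
0`, where these sides have length `0`. -/
theorem Passage.exists_next (ha : 0 ≤ a) (hb : 0 ≤ b) (hv : vel n m a b ≠ 0)
    (h : IsTrajectory n τ (vel n m a b)) (x : Passage n m a b τ) :
    ∃ y : Passage n m a b τ, x.Next y := by
  have hxp := x.hp
  have hE := x.apply_exit h
  rcases x.exit with ⟨e1, e2, e3⟩ | ⟨e1, e2, e3⟩
  · have hp : x.p + 1 < n := by
      by_contra hge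
      have : x.p + 1 = n := by omega
      rw [this, lam_n] at e3
      linarith
    have hR : InRect n (x.p + 1) x.t' 0 := ⟨e2.le, e3.le, le_rfl, lam_nonneg (by omega)⟩
    have hT : τ (x.T + x.D) = rho n m (x.p + 1) x.t' 0 := by
      rw [hE, e1, rho_right m hp e2.le e3.le]
    obtain ⟨D, hD, hR', hex, hdeg⟩ := h.exists_exit ha hb hv hp hR hT
    exact ⟨⟨x.T + x.D, D, x.p + 1, x.t', 0, _, _, hp, hD, rfl, rfl, hR, hR',
      Or.inr ⟨rfl, e2, e3⟩, hex, hdeg, hT⟩, rfl, Or.inl ⟨rfl, e1, e2, e3, rfl, rfl⟩⟩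
  · obtain ⟨q, hq⟩ : ∃ q, x.p = q + 1 := by
      refine ⟨x.p - 1, ?_⟩
      by_contra hne
      have : x.p = 0 := by omega
      rw [this, lam_zero] at e3
      linarith
    have hqn : q + 1 < n := by omega
    have e3' := e3
    rw [hq] at e3'
    have hR : InRect n q 0 x.s' := ⟨le_rfl, lam_nonneg (by omega), e2.le, e3'.le⟩
    have hT : τ (x.T + x.D) = rho n m q 0 x.s' := by
      rw [hE, e1, hq, show q + 1 + 1 = q + 2 by ring, rho_top m hqn e2.le e3'.le]
    obtain ⟨D, hD, hR', hex, hdeg⟩ := h.exists_exit ha hb hv (by omega : q < n) hR hT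
    exact ⟨⟨x.T + x.D, D, q, 0, x.s', _, _, by omega, hD, rfl, rfl, hR, hR',
      Or.inl ⟨rfl, e2, e3'⟩, hex, hdeg, hT⟩, rfl, Or.inr ⟨hq, e1, e2, e3, rfl, rfl⟩⟩

theorem Passage.exists_prev (ha : 0 ≤ a) (hb : 0 ≤ b) (hv : vel n m a b ≠ 0)
    (h : IsTrajectory n τ (vel n m a b)) (y : Passage n m a b τ) :
    ∃ x : Passage n m a b τ, x.Next y := by
  have hyp := y.hp
  rcases y.entry with ⟨e1, e2, e3⟩ | ⟨e1, e2, e3⟩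
  · have hp : y.p + 1 < n := by
      by_contra hge
      have : y.p + 1 = n := by omega
      rw [this, lam_n] at e3
      linarith
    have hR : InRect n (y.p + 1) y.t (lam n (y.p + 2)) :=
      ⟨e2.le, e3.le, lam_nonneg (by omega), le_rfl⟩
    have hT : τ y.T = rho n m (y.p + 1) y.t (lam n (y.p + 2)) := by
      rw [y.hτ, e1, rho_top m hp e2.le e3.le]
    obtain ⟨D, hD, hR', hτ, hen, hdeg⟩ := h.exists_entry ha hb hv hp hR hT
    exact ⟨⟨y.T - D, D, y.p + 1, _, _, y.t, lam n (y.p + 2), hp, hD, by ring, by ring, hR', hR, hen,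
      Or.inr ⟨rfl, e2, e3⟩, hdeg, hτ⟩, by ring, Or.inr ⟨rfl, rfl, e2, e3, e1, rfl⟩⟩
  · obtain ⟨q, hq⟩ : ∃ q, y.p = q + 1 := by
      refine ⟨y.p - 1, ?_⟩
      by_contra hne
      have : y.p = 0 := by omega
      rw [this, lam_zero] at e3
      linarith
    have hqn : q + 1 < n := by omega
    rw [hq] at e3
    have hR : InRect n q (lam n q) y.s := ⟨lam_nonneg (by omega), le_rfl, e2.le, e3.le⟩
    have hT : τ y.T = rho n m q (lam n q) y.s := by
      rw [y.hτ, e1, hq, rho_right m hqn e2.le e3.le]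
    obtain ⟨D, hD, hR', hτ, hen, hdeg⟩ := h.exists_entry ha hb hv (by omega : q < n) hR hT
    exact ⟨⟨y.T - D, D, q, _, _, lam n q, y.s, by omega, hD, by ring, by ring, hR', hR, hen,
      Or.inl ⟨rfl, e2, e3⟩, hdeg, hτ⟩, by ring, Or.inl ⟨hq, rfl, e2, e3, rfl, e1⟩⟩

/-- A relation in which every element has a successor and a predecessor has bi-infinite chains. -/
theorem exists_int_chain {α : Type*} {R : α → α → Prop} (x : α) (hs : ∀ x, ∃ y, R x y)
    (hp : ∀ y, ∃ x, R x y) : ∃ f : ℤ → α, ∀ i, R (f i) (f (i + 1)) := by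
  choose S hS using hs
  choose P hP using hp
  refine ⟨fun i => Int.rec (fun k => S^[k] x) (fun k => P^[k + 1] x) i, fun i => ?_⟩
  rcases i with k | k
  · change R (S^[k] x) (S^[k + 1] x)
    rw [Function.iterate_succ_apply']
    exact hS _
  · rcases k with _ | k
    · change R (P^[1] x) (S^[0] x)
      exact hP _
    · have : Int.negSucc (k + 1) + 1 = Int.negSucc k := by omega
      rw [this]
      change R (P^[k + 2] x) (P^[k + 1] x)
      rw [Function.iterate_succ_apply' P (k + 1)]
      exact hP _

theorem exists_chain (ha : 0 ≤ a) (hb : 0 ≤ b) (hv : vel n m a b ≠ 0)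
    (h : IsTrajectory n τ (vel n m a b)) :
    ∃ c : ℤ → Passage n m a b τ, ∀ i, (c i).Next (c (i + 1)) := by
  obtain ⟨x⟩ := exists_passage ha hb hv h
  exact exists_int_chain x (fun x => x.exists_next ha hb hv h) (fun y => y.exists_prev ha hb hv h)

end Passages

end DoubleGon

end

noncomputable section

namespace DoubleGon

/-! ### Bi-infinite sequences -/

section Sequences

/-- Two increasing enumerations by `ℤ` of the same set differ by a shift. -/
theorem exists_shift {β : Type*} [LinearOrder β] {e e' : ℤ → β} (he : StrictMono e)
    (he' : StrictMono e') (h : Set.range e' = Set.range e) : ∃ c, ∀ j, e' j = e (j + c) := by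
  have h1 : ∀ j, ∃ i, e i = e' j := fun j => by
    have : e' j ∈ Set.range e := h ▸ Set.mem_range_self j
    exact this
  choose σ hσ using h1
  have mono : StrictMono σ := fun i j hij => by
    rw [← he.lt_iff_lt, hσ, hσ]; exact he' hij
  have surj : Function.Surjective σ := fun i => by
    have : e i ∈ Set.range e' := h ▸ Set.mem_range_self i
    obtain ⟨j, hj⟩ := this
    exact ⟨j, he.injective (by rw [hσ, hj])⟩
  have step : ∀ j, σ (j + 1) = σ j + 1 := fun j => by
    have h2 : σ j < σ (j + 1) := mono (by omega)
    obtain ⟨i, hi⟩ := surj (σ j + 1)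
    have h3 : j < i := by rw [← mono.lt_iff_lt]; omega
    have h4 : σ (j + 1) ≤ σ i := mono.monotone (by omega)
    omega
  refine ⟨σ 0, fun j => ?_⟩
  rw [← hσ]
  congr 1
  induction j using Int.induction_on with
  | zero => simp
  | succ i ih => rw [step, ih]; ring
  | pred i ih =>
    have := step (-(i : ℤ) - 1)
    rw [sub_add_cancel] at this
    omega

/-- A set of integers unbounded in both directions has an increasing enumeration by `ℤ`. -/
theorem exists_enum {S : Set ℤ} (hu : ∀ B, ∃ i ∈ S, B < i) (hl : ∀ B, ∃ i ∈ S, i < B) :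
    ∃ f : ℤ → ℤ, StrictMono f ∧ Set.range f = S := by
  classical
  have : Nonempty S := let ⟨i, hi, _⟩ := hu 0; ⟨⟨i, hi⟩⟩
  have : NoMaxOrder S := ⟨fun a => let ⟨i, hi, h⟩ := hu a; ⟨⟨i, hi⟩, h⟩⟩
  have : NoMinOrder S := ⟨fun a => let ⟨i, hi, h⟩ := hl a; ⟨⟨i, hi⟩, h⟩⟩
  -- A locally finite linear order without extreme elements is isomorphic to `ℤ`.
  let _ : LocallyFiniteOrder S := Subtype.instLocallyFiniteOrder (fun i => i ∈ S)
  let _ : SuccOrder S := LinearLocallyFiniteOrder.succOrder S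
  let _ : PredOrder S := LinearLocallyFiniteOrder.predOrder S
  let φ : S ≃o ℤ := orderIsoIntOfLinearSuccPredArch
  refine ⟨fun j => φ.symm j, fun i j hij => φ.symm.strictMono hij, ?_⟩
  ext i
  constructor
  · rintro ⟨j, rfl⟩; exact (φ.symm j).2
  · intro hi; exact ⟨φ ⟨i, hi⟩, by simp⟩

theorem IsKsl.shift {α : Type*} {s s' : ℤ → α} (c : ℤ) (h : IsKsl s s') :
    IsKsl (fun j => s (j + c)) s' := by
  obtain ⟨f, hf, hr, hs⟩ := h
  refine ⟨fun j => f j - c, fun i j hij => by have := hf hij; simp only; omega, ?_, fun j => ?_⟩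
  · ext i
    have : (∃ j, f j = i + c) ↔ s (i + c - 1) = s (i + c + 1) := by
      change i + c ∈ Set.range f ↔ _
      rw [hr]; rfl
    simp only [Set.mem_range, Set.mem_ofPred_eq, sub_eq_iff_eq_add, this]
    rw [show i + c - 1 = i - 1 + c by ring, show i + c + 1 = i + 1 + c by ring]
  · simp only [sub_add_cancel, hs]

theorem isKsl_shift_iff {α : Type*} {s s' : ℤ → α} (c : ℤ) :
    IsKsl (fun j => s (j + c)) s' ↔ IsKsl s s' := by
  refine ⟨fun h => ?_, IsKsl.shift c⟩
  have := h.shift (-c)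
  simpa using this

/-- A nearest-neighbour walk in a bounded set of integers turns back after any time. -/
theorem exists_turn {q : ℤ → ℤ} {N : ℤ} (h0 : ∀ i, 0 ≤ q i) (h1 : ∀ i, q i < N)
    (hq : ∀ i, q (i + 1) = q i + 1 ∨ q i = q (i + 1) + 1) (B : ℤ) :
    ∃ i, B < i ∧ q (i - 1) = q (i + 1) := by
  by_contra! hcon
  -- Without a turn after `B` the increment stays equal to `1` or to `-1`, so the walk has left the
  -- interval after `N` steps.
  have key : ∀ k : ℕ, q (B + k + 1) - q (B + k) = q (B + 1) - q B := by
    intro k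
    induction k with
    | zero => simp
    | succ k ih =>
      have h := hcon (B + k + 1) (by omega)
      have e1 := hq (B + k)
      have e2 := hq (B + k + 1)
      rw [show B + k + 1 - 1 = B + k by ring] at h
      push_cast
      rw [show B + (k + 1) + 1 = B + k + 1 + 1 by ring, show B + ((k : ℤ) + 1) = B + k + 1 by ring]
      omega
  have sum : ∀ k : ℕ, q (B + k) = q B + k * (q (B + 1) - q B) := by
    intro k
    induction k with
    | zero => simp
    | succ k ih =>
      have := key k
      push_cast
      rw [← add_assoc, add_mul, one_mul]
      linarith
  have hN : 0 < N := (h0 0).trans_lt (h1 0)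
  have e := sum N.toNat
  have hc : (N.toNat : ℤ) = N := Int.toNat_of_nonneg hN.le
  rw [hc] at e
  have a1 := h0 (B + N)
  have a2 := h1 (B + N)
  have a3 := h0 B
  have a4 := h1 B
  rcases hq B with h | h
  · rw [show q (B + 1) - q B = 1 by omega] at e; omega
  · rw [show q (B + 1) - q B = -1 by omega] at e; omega

theorem exists_turn_lt {q : ℤ → ℤ} {N : ℤ} (h0 : ∀ i, 0 ≤ q i) (h1 : ∀ i, q i < N)
    (hq : ∀ i, q (i + 1) = q i + 1 ∨ q i = q (i + 1) + 1) (B : ℤ) :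
    ∃ i, i < B ∧ q (i - 1) = q (i + 1) := by
  obtain ⟨i, hi, h⟩ := exists_turn (q := fun i => q (-i)) (fun i => h0 _) (fun i => h1 _)
    (fun i => by
      have := hq (-(i + 1))
      rw [show -(i + 1) + 1 = -i by ring] at this
      exact this.symm) (-B)
  refine ⟨-i, by omega, ?_⟩
  rw [show -i - 1 = -(i + 1) by ring, show -i + 1 = -(i - 1) by ring]
  exact h.symm

end Sequences

/-! ### Cutting sequences and derived sequences up to a shift -/

section CuttingSequences

variable {n : ℕ} [Fact (3 ≤ n)] [Fact (Odd n)]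

theorem IsCuttingSeq.exists_eq_shift {τ : ℝ → Surface n} (hτ : ∀ t, ¬ IsVertex n (τ t))
    {s s' : ℤ → Fin n} (h : IsCuttingSeq n τ s) (h' : IsCuttingSeq n τ s') :
    ∃ c, ∀ j, s' j = s (j + c) := by
  obtain ⟨e, he, hr, hs⟩ := h
  obtain ⟨e', he', hr', hs'⟩ := h'
  obtain ⟨c, hc⟩ := exists_shift he he' (hr'.trans hr.symm)
  refine ⟨c, fun j => onEdge_unique (hτ (e' j)) (hs' j) ?_⟩
  rw [hc]; exact hs _

theorem IsCuttingSeq.shift {τ : ℝ → Surface n} {s : ℤ → Fin n} (h : IsCuttingSeq n τ s) (c : ℤ) :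
    IsCuttingSeq n τ (fun j => s (j + c)) := by
  obtain ⟨e, he, hr, hs⟩ := h
  refine ⟨fun j => e (j + c), fun i j hij => he (by omega), ?_, fun i => hs _⟩
  rw [← hr]
  exact (Equiv.addRight c).surjective.range_comp e

theorem IsKsl.exists_eq_shift {α : Type*} {s s₁ s₂ : ℤ → α} (h : IsKsl s s₁) (h' : IsKsl s s₂) :
    ∃ c, ∀ j, s₂ j = s₁ (j + c) := by
  obtain ⟨f, hf, hr, hs⟩ := h
  obtain ⟨f', hf', hr', hs'⟩ := h'
  obtain ⟨c, hc⟩ := exists_shift hf hf' (hr'.trans hr.symm)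
  exact ⟨c, fun j => by rw [hs', hc, hs]⟩

theorem IsKsl.comp_shift {α : Type*} {s s' : ℤ → α} (h : IsKsl s s') (c : ℤ) :
    IsKsl s (fun j => s' (j + c)) := by
  obtain ⟨f, hf, hr, hs⟩ := h
  refine ⟨fun j => f (j + c), fun i j hij => hf (by omega), ?_, fun i => hs _⟩
  rw [← hr]
  exact (Equiv.addRight c).surjective.range_comp f

/-- If `τ'` crosses the edges `l i` at the times `w i`, for the sandwiched letters `l i` of a
cutting sequence `l` of `τ`, then the cutting sequences of `τ'` are those derived from the cutting
sequences of `τ`. -/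
theorem IsCuttingSeq.ksl {τ τ' : ℝ → Surface n} (hτ : ∀ t, ¬ IsVertex n (τ t))
    (hτ' : ∀ t, ¬ IsVertex n (τ' t)) {l : ℤ → Fin n} (hl : IsCuttingSeq n τ l) {w : ℤ → ℝ}
    (hw : StrictMonoOn w {i | l (i - 1) = l (i + 1)})
    (him : w '' {i | l (i - 1) = l (i + 1)} = {t | ∃ k, OnEdge n k (τ' t)})
    (hon : ∀ i, l (i - 1) = l (i + 1) → OnEdge n (l i) (τ' (w i)))
    (hu : ∀ B, ∃ i, B < i ∧ l (i - 1) = l (i + 1)) (hb : ∀ B, ∃ i, i < B ∧ l (i - 1) = l (i + 1))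
    {s : ℤ → Fin n} (hs : IsCuttingSeq n τ s) :
    (∃ s', IsKsl s s') ∧ ∀ s', IsCuttingSeq n τ' s' ↔ IsKsl s s' := by
  obtain ⟨c, hc⟩ := hl.exists_eq_shift hτ hs
  obtain rfl : s = fun j => l (j + c) := funext hc
  simp only [isKsl_shift_iff]
  obtain ⟨f, hf, hr⟩ := exists_enum (S := {i | l (i - 1) = l (i + 1)})
    (fun B => let ⟨i, h1, h2⟩ := hu B; ⟨i, h2, h1⟩) (fun B => let ⟨i, h1, h2⟩ := hb B; ⟨i, h2, h1⟩)
  have hmem : ∀ j, f j ∈ {i | l (i - 1) = l (i + 1)} := fun j => hr ▸ Set.mem_range_self j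
  have hk : IsKsl l (l ∘ f) := ⟨f, hf, hr, fun _ => rfl⟩
  have hcut : IsCuttingSeq n τ' (l ∘ f) := by
    refine ⟨w ∘ f, fun i j hij => hw (hmem i) (hmem j) (hf hij), ?_, fun i => hon _ (hmem i)⟩
    rw [Set.range_comp, hr, him]
  refine ⟨⟨_, hk⟩, fun s' => ⟨fun h => ?_, fun h => ?_⟩⟩
  · obtain ⟨d, hd⟩ := hcut.exists_eq_shift hτ' h
    obtain rfl : s' = fun j => (l ∘ f) (j + d) := funext hd
    exact hk.comp_shift d
  · obtain ⟨d, hd⟩ := hk.exists_eq_shift h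
    obtain rfl : s' = fun j => (l ∘ f) (j + d) := funext hd
    exact hcut.shift d

end CuttingSequences

end DoubleGon

end

noncomputable section

namespace DoubleGon

/-! ### The crossings of a trajectory and of its reflection -/

section Crossings

variable {n : ℕ} [Fact (3 ≤ n)] [Fact (Odd n)]

/-- The degenerate parallelograms are sides of their neighbours, so the formula for the reflection
extends to them. -/
theorem reflect_rho_of_lt (m : ℤ) {p : ℕ} (hp : p < n) {s t : ℝ} (h : InRect n p s t) :
    reflect n m (rho n m p s t) = rhoF n m p s t := by
  have h3 : 3 ≤ n := three_le
  have h0 := h.s_nonneg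
  have h1 := h.s_le
  have h0' := h.t_nonneg
  have h1' := h.t_le
  rcases Nat.eq_zero_or_pos p with rfl | hpos
  · rw [lam_zero] at h1
    obtain rfl : s = lam n 0 := by rw [lam_zero]; linarith
    rw [rho_right m (by omega) h0' h1', rhoF_right m (by omega) h0' h1',
      reflect_rho m le_rfl (by omega) ⟨h0', h1', le_rfl, lam_nonneg (by omega)⟩]
  rcases Nat.lt_or_ge n (p + 2) with hlt | hge
  · obtain ⟨q, rfl⟩ : ∃ q, p = q + 1 := ⟨p - 1, by omega⟩
    have hq : q + 1 + 1 = n := by omega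
    rw [hq, lam_n] at h1'
    obtain rfl : t = 0 := by linarith
    rw [← rho_right m hp h0 h1, ← rhoF_right m hp h0 h1,
      reflect_rho m (by omega) (by omega) ⟨lam_nonneg (by omega), le_rfl, h0, h1⟩]
  · exact reflect_rho m hpos hge h

/-- The reflection exchanges the diagonals, so the image is on the edge at position `p` when the
point is on the other diagonal. -/
theorem onEdge_rhoF_cases {m : ℤ} {p : ℕ} (h1 : 1 ≤ p) (h2 : p + 2 ≤ n) {s t : ℝ}
    (h : InRect n p s t) (hc : ¬ IsCrn n p s t) {k : Fin n} (hk : OnEdge n k (rhoF n m p s t)) :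
    (k = lab n m p ∧ s * lam n (p + 1) = t * lam n p) ∨
    (p = 1 ∧ (t = 0 ∨ t = lam n (p + 1))) ∨ (p + 2 = n ∧ (s = 0 ∨ s = lam n p)) := by
  rw [← isVertex_rhoF_iff m (by omega) h] at hc
  have hR := h.compl
  unfold rhoF at hk hc
  split_ifs at hk hc
  · have hR' : InRect n p s (lam n (p + 1) - t) := ⟨h.s_nonneg, h.s_le, hR.t_nonneg, hR.t_le⟩
    rw [isVertex_rho_iff m (by omega) hR'] at hc
    rcases onEdge_rho_cases h1 h2 hR' hc hk with ⟨rfl, e⟩ | ⟨e1, -, e⟩ | ⟨e1, -, e⟩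
    · exact Or.inl ⟨rfl, by linarith⟩
    · exact Or.inr (Or.inl ⟨e1, e.symm.imp (fun e => by linarith) (fun e => by linarith)⟩)
    · exact Or.inr (Or.inr ⟨e1, e⟩)
  · have hR' : InRect n p (lam n p - s) t := ⟨hR.s_nonneg, hR.s_le, h.t_nonneg, h.t_le⟩
    rw [isVertex_rho_iff m (by omega) hR'] at hc
    rcases onEdge_rho_cases h1 h2 hR' hc hk with ⟨rfl, e⟩ | ⟨e1, -, e⟩ | ⟨e1, -, e⟩
    · exact Or.inl ⟨rfl, by linarith⟩
    · exact Or.inr (Or.inl ⟨e1, e⟩)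
    · exact Or.inr (Or.inr ⟨e1, e.symm.imp (fun e => by linarith) (fun e => by linarith)⟩)

theorem onEdge_rhoF_of_eq {m : ℤ} {p : ℕ} (hp : p < n) {s t : ℝ} (h : InRect n p s t)
    (he : s * lam n (p + 1) = t * lam n p) : OnEdge n (lab n m p) (rhoF n m p s t) := by
  have hR := h.compl
  unfold rhoF
  split_ifs
  · exact onEdge_rho_of_eq hp ⟨h.s_nonneg, h.s_le, hR.t_nonneg, hR.t_le⟩ (by linarith)
  · exact onEdge_rho_of_eq hp ⟨hR.s_nonneg, hR.s_le, h.t_nonneg, h.t_le⟩ (by linarith)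

theorem exists_zero_of_neg_of_pos {x y D : ℝ} (hD : 0 ≤ D) (h0 : x < 0) (h1 : 0 < x + D * y) :
    ∃ r, 0 < r ∧ r < D ∧ x + r * y = 0 ∧ ∀ r', x + r' * y = 0 → r' = r := by
  have hy : 0 < y := by
    by_contra hy
    nlinarith [mul_nonneg hD (neg_nonneg.2 (not_lt.1 hy))]
  refine ⟨-x / y, div_pos (by linarith) hy, by rw [div_lt_iff₀ hy]; linarith, by field_simp; ring,
    fun r' h => ?_⟩
  rw [eq_div_iff hy.ne']; linarith

theorem exists_zero_of_pos_of_neg {x y D : ℝ} (hD : 0 ≤ D) (h0 : 0 < x) (h1 : x + D * y < 0) :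
    ∃ r, 0 < r ∧ r < D ∧ x + r * y = 0 ∧ ∀ r', x + r' * y = 0 → r' = r := by
  obtain ⟨r, h2, h3, h4, h5⟩ := exists_zero_of_neg_of_pos (x := -x) (y := -y) hD (by linarith)
    (by linarith)
  exact ⟨r, h2, h3, by linarith, fun r' h => h5 r' (by linarith)⟩

theorem add_mul_pos {x y D r : ℝ} (h0 : 0 < x) (h1 : 0 < x + D * y) (hr : r ∈ Set.Icc 0 D) :
    0 < x + r * y := by
  rcases le_total 0 y with hy | hy
  · nlinarith [mul_nonneg hr.1 hy]
  · nlinarith [mul_nonneg (sub_nonneg.2 hr.2) (neg_nonneg.2 hy)]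

variable {m : ℤ} {a b : ℝ} {τ : ℝ → Surface n}

namespace Passage

variable (x : Passage n m a b τ)

/-- The first parameter of the point reached after a time `r`. -/
def sAt (r : ℝ) : ℝ := x.s + r * spd a b x.p

/-- The second parameter of the point reached after a time `r`. -/
def tAt (r : ℝ) : ℝ := x.t + r * spd a b (x.p + 1)

/-- The parallelogram of the passage is degenerate. -/
def Deg : Prop := x.p = 0 ∨ x.p + 1 = n

variable {x}

theorem lam_pos_of_not_deg (h : ¬ x.Deg) : 0 < lam n x.p ∧ 0 < lam n (x.p + 1) := by
  have := x.hp
  unfold Deg at h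
  push Not at h
  exact ⟨lam_pos (by omega) (by omega), lam_pos (by omega) (by omega)⟩

theorem inRect_at {r : ℝ} (hr : r ∈ Set.Icc 0 x.D) : InRect n x.p (x.sAt r) (x.tAt r) :=
  x.inRect.segment (by rw [← x.hs', ← x.ht']; exact x.inRect') hr

theorem sAt_D : x.sAt x.D = x.s' := x.hs'.symm

theorem tAt_D : x.tAt x.D = x.t' := x.ht'.symm

/-- In the degenerate case, the parallelogram coincides with both of its diagonals. -/
theorem deg_eq (h : x.Deg) : x.D = 0 ∧
    x.s * lam n (x.p + 1) + x.t * lam n x.p = lam n x.p * lam n (x.p + 1) ∧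
    x.s * lam n (x.p + 1) = x.t * lam n x.p := by
  have h0 := x.inRect.s_nonneg
  have h1 := x.inRect.s_le
  have h0' := x.inRect.t_nonneg
  have h1' := x.inRect.t_le
  refine ⟨x.deg h, ?_⟩
  rcases h with h | h
  · have hl : lam n x.p = 0 := by rw [h, lam_zero]
    obtain hs : x.s = 0 := by linarith
    simp [hl, hs]
  · have hl : lam n (x.p + 1) = 0 := by rw [h, lam_n]
    obtain ht : x.t = 0 := by linarith
    simp [hl, ht]

/-- The left and bottom sides lie strictly below the diagonal formed by the edge and the right and
top sides strictly above it, apart from corners, so every passage crosses it exactly once. -/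
theorem exists_crossing (x : Passage n m a b τ) : ∃ r ∈ Set.Icc 0 x.D,
    x.sAt r * lam n (x.p + 1) + x.tAt r * lam n x.p = lam n x.p * lam n (x.p + 1) ∧
    (¬ x.Deg → 0 < r ∧ r < x.D) ∧
    ∀ r' ∈ Set.Icc 0 x.D,
      x.sAt r' * lam n (x.p + 1) + x.tAt r' * lam n x.p = lam n x.p * lam n (x.p + 1) → r' = r := by
  by_cases hd : x.Deg
  · obtain ⟨hD, h1, h2⟩ := x.deg_eq hd
    refine ⟨0, ⟨le_rfl, x.hD⟩, by simpa [sAt, tAt] using h1, fun h => absurd hd h, fun r' hr _ => ?_⟩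
    rw [hD] at hr
    exact le_antisymm hr.2 hr.1
  · obtain ⟨l0, l1⟩ := lam_pos_of_not_deg hd
    have e : ∀ r, x.sAt r * lam n (x.p + 1) + x.tAt r * lam n x.p - lam n x.p * lam n (x.p + 1) =
        (x.s * lam n (x.p + 1) + x.t * lam n x.p - lam n x.p * lam n (x.p + 1)) +
        r * (spd a b x.p * lam n (x.p + 1) + spd a b (x.p + 1) * lam n x.p) := by
      intro r; unfold sAt tAt; ring
    have h0 : x.s * lam n (x.p + 1) + x.t * lam n x.p - lam n x.p * lam n (x.p + 1) < 0 := by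
      rcases x.entry with ⟨e1, e2, e3⟩ | ⟨e1, e2, e3⟩
      · rw [e1]; nlinarith [mul_pos l0 (sub_pos.2 e3)]
      · rw [e1]; nlinarith [mul_pos l1 (sub_pos.2 e3)]
    have h1 := e x.D
    rw [sAt_D, tAt_D] at h1
    have h2 : 0 < x.s' * lam n (x.p + 1) + x.t' * lam n x.p - lam n x.p * lam n (x.p + 1) := by
      rcases x.exit with ⟨e1, e2, e3⟩ | ⟨e1, e2, e3⟩
      · rw [e1]; nlinarith [mul_pos l0 e2]
      · rw [e1]; nlinarith [mul_pos l1 e2]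
    rw [h1] at h2
    obtain ⟨r, r0, r1, hr, hu⟩ := exists_zero_of_neg_of_pos x.hD h0 h2
    rw [← e] at hr
    exact ⟨r, ⟨r0.le, r1.le⟩, by linarith, fun _ => ⟨r0, r1⟩,
      fun r' _ h => hu r' (by rw [← e]; linarith)⟩

/-- The passage joins opposite sides of the parallelogram. -/
def Straight (x : Passage n m a b τ) : Prop :=
  (x.s = 0 ∧ 0 < x.t ∧ x.s' = lam n x.p ∧ x.t' < lam n (x.p + 1)) ∨
  (x.t = 0 ∧ 0 < x.s ∧ x.t' = lam n (x.p + 1) ∧ x.s' < lam n x.p)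

/-- Opposite sides of the parallelogram are separated by the other diagonal. -/
theorem Straight.exists_crossing (hx : x.Straight) : ∃ r ∈ Set.Icc 0 x.D,
    x.sAt r * lam n (x.p + 1) = x.tAt r * lam n x.p ∧ (¬ x.Deg → 0 < r ∧ r < x.D) ∧
    ∀ r' ∈ Set.Icc 0 x.D, x.sAt r' * lam n (x.p + 1) = x.tAt r' * lam n x.p → r' = r := by
  by_cases hd : x.Deg
  · obtain ⟨hD, h1, h2⟩ := x.deg_eq hd
    refine ⟨0, ⟨le_rfl, x.hD⟩, by simpa [sAt, tAt] using h2, fun h => absurd hd h, fun r' hr _ => ?_⟩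
    rw [hD] at hr
    exact le_antisymm hr.2 hr.1
  · obtain ⟨l0, l1⟩ := lam_pos_of_not_deg hd
    have e : ∀ r, x.sAt r * lam n (x.p + 1) - x.tAt r * lam n x.p =
        (x.s * lam n (x.p + 1) - x.t * lam n x.p) +
        r * (spd a b x.p * lam n (x.p + 1) - spd a b (x.p + 1) * lam n x.p) := by
      intro r; unfold sAt tAt; ring
    have h1 := e x.D
    rw [sAt_D, tAt_D] at h1
    have main : ∃ r, 0 < r ∧ r < x.D ∧ (x.s * lam n (x.p + 1) - x.t * lam n x.p) +
        r * (spd a b x.p * lam n (x.p + 1) - spd a b (x.p + 1) * lam n x.p) = 0 ∧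
        ∀ r', (x.s * lam n (x.p + 1) - x.t * lam n x.p) +
        r' * (spd a b x.p * lam n (x.p + 1) - spd a b (x.p + 1) * lam n x.p) = 0 → r' = r := by
      rcases hx with ⟨e1, e2, e3, e4⟩ | ⟨e1, e2, e3, e4⟩
      · apply exists_zero_of_neg_of_pos x.hD
        · rw [e1]; nlinarith [mul_pos e2 l0]
        · rw [← h1, e3]; nlinarith [mul_pos l0 (sub_pos.2 e4)]
      · apply exists_zero_of_pos_of_neg x.hD
        · rw [e1]; nlinarith [mul_pos e2 l1]
        · rw [← h1, e3]; nlinarith [mul_pos l1 (sub_pos.2 e4)]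
    obtain ⟨r, r0, r1, hr, hu⟩ := main
    rw [← e] at hr
    exact ⟨r, ⟨r0.le, r1.le⟩, by linarith, fun _ => ⟨r0, r1⟩,
      fun r' _ h => hu r' (by rw [← e]; linarith)⟩

/-- A passage from left to top or from bottom to right has both ends strictly on the same side of
the other diagonal and cannot meet it. -/
theorem straight_of_eq (hd : ¬ x.Deg) {r : ℝ} (hr : r ∈ Set.Icc 0 x.D)
    (h : x.sAt r * lam n (x.p + 1) = x.tAt r * lam n x.p) : x.Straight := by
  obtain ⟨l0, l1⟩ := lam_pos_of_not_deg hd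
  have e : ∀ r, x.sAt r * lam n (x.p + 1) - x.tAt r * lam n x.p =
      (x.s * lam n (x.p + 1) - x.t * lam n x.p) +
      r * (spd a b x.p * lam n (x.p + 1) - spd a b (x.p + 1) * lam n x.p) := by
    intro r; unfold sAt tAt; ring
  have h1 := e x.D
  rw [sAt_D, tAt_D] at h1
  have h2 := e r
  rcases x.entry with ⟨e1, e2, e3⟩ | ⟨e1, e2, e3⟩ <;>
    rcases x.exit with ⟨f1, f2, f3⟩ | ⟨f1, f2, f3⟩
  · exact Or.inl ⟨e1, e2, f1, f3⟩
  · exfalso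
    have := add_mul_pos (x := -(x.s * lam n (x.p + 1) - x.t * lam n x.p))
      (y := -(spd a b x.p * lam n (x.p + 1) - spd a b (x.p + 1) * lam n x.p))
      (by rw [e1]; nlinarith [mul_pos e2 l0])
      (by rw [f1] at h1; nlinarith [mul_pos l1 (sub_pos.2 f3)]) hr
    linarith
  · exfalso
    have := add_mul_pos (x := (x.s * lam n (x.p + 1) - x.t * lam n x.p))
      (y := (spd a b x.p * lam n (x.p + 1) - spd a b (x.p + 1) * lam n x.p))
      (by rw [e1]; nlinarith [mul_pos e2 l1])
      (by rw [f1] at h1; nlinarith [mul_pos l0 (sub_pos.2 f3)]) hr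
    linarith
  · exact Or.inr ⟨e1, e2, f1, f3⟩

/-- The left and right sides both border the position `p + 1`, the bottom and top sides both border
`p - 1`. So joining opposite sides means returning to the position one came from. This is the
geometric meaning of a sandwiched letter. -/
theorem Next.straight_iff {y z : Passage n m a b τ} (h : Next x y) (h' : Next y z) :
    y.Straight ↔ x.p = z.p := by
  obtain ⟨-, h⟩ := h
  obtain ⟨-, h'⟩ := h'
  have hy := y.hp
  unfold Straight
  rcases h with ⟨h1, h2, h3, h4, h5, h6⟩ | ⟨h1, h2, h3, h4, h5, h6⟩ <;>
    rcases h' with ⟨g1, g2, g3, g4, g5, g6⟩ | ⟨g1, g2, g3, g4, g5, g6⟩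
  · refine ⟨fun h => ?_, fun h => by omega⟩
    rcases h with h | h
    · linarith [h.2.1]
    · linarith [h.2.2.1]
  · exact ⟨fun _ => by omega, fun _ => Or.inr ⟨h6, by linarith, g2, g4⟩⟩
  · exact ⟨fun _ => by omega, fun _ => Or.inl ⟨h5, by linarith, g2, g4⟩⟩
  · refine ⟨fun h => ?_, fun h => by omega⟩
    rcases h with h | h
    · linarith [h.2.2.1]
    · linarith [h.2.1]

theorem Next.not_deg {y : Passage n m a b τ} (h : Next x y) (hx : x.Deg) : ¬ y.Deg := by
  have h3 : 3 ≤ n := three_le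
  unfold Deg at *
  rcases h.2 with h | h <;> omega

theorem Next.eq_add_one {y : Passage n m a b τ} (h : Next x y) :
    (y.p : ℤ) = x.p + 1 ∨ (x.p : ℤ) = y.p + 1 := by
  rcases h.2 with h | h <;> omega

end Passage

end Crossings

end DoubleGon

end

noncomputable section

namespace DoubleGon

/-! ### The cutting sequence of a trajectory and of its reflection -/

section Chains

variable {n : ℕ} [Fact (3 ≤ n)] [Fact (Odd n)]

/-- If the crossing times were bounded they would accumulate at their supremum, against
`eventually_not_onEdge`. -/
theorem IsTrajectory.exists_lt_crossing {τ : ℝ → Surface n} {v : Plane} (h : IsTrajectory n τ v)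
    (hv : v ≠ 0) {e : ℤ → ℝ} (he : StrictMono e) (hon : ∀ i, ∃ k, OnEdge n k (τ (e i))) (B : ℝ) :
    ∃ i, B < e i := by
  by_contra! hB
  have hbdd : BddAbove (Set.range e) := ⟨B, by rintro _ ⟨i, rfl⟩; exact hB i⟩
  have hlim := tendsto_atTop_ciSup he.monotone hbdd
  set L := ⨆ i, e i
  have hlt : ∀ i, e i < L := fun i => (he (lt_add_one i)).trans_le (le_ciSup hbdd (i + 1))
  have htend : Tendsto (fun i => e i - L) atTop (𝓝[≠] 0) := by
    rw [tendsto_nhdsWithin_iff]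
    exact ⟨by simpa using hlim.sub_const L, Eventually.of_forall fun i => (sub_neg.2 (hlt i)).ne⟩
  obtain ⟨i, hi⟩ := (htend.eventually (h.eventually_not_onEdge hv L)).exists
  obtain ⟨k, hk⟩ := hon i
  exact hi k (by rwa [add_sub_cancel])

theorem IsTrajectory.exists_crossing_lt {τ : ℝ → Surface n} {v : Plane} (h : IsTrajectory n τ v)
    (hv : v ≠ 0) {e : ℤ → ℝ} (he : StrictMono e) (hon : ∀ i, ∃ k, OnEdge n k (τ (e i))) (B : ℝ) :
    ∃ i, e i < B := by
  obtain ⟨i, hi⟩ := h.reverse.exists_lt_crossing hv (e := fun i => -e (-i))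
    (fun i j hij => neg_lt_neg (he (neg_lt_neg hij)))
    (fun i => by
      obtain ⟨k, hk⟩ := hon (-i)
      refine ⟨k, ?_⟩
      rw [neg_neg]
      exact onEdge_halfTurn.2 hk) (-B)
  exact ⟨-i, by linarith⟩

variable {m : ℤ} {a b : ℝ} {τ : ℝ → Surface n} {c : ℤ → Passage n m a b τ}

/-- A point of a passage on a side of the surface is a point of a degenerate passage. -/
theorem exists_deg (hc : ∀ i, (c i).Next (c (i + 1))) (i : ℤ) {r : ℝ}
    (hr : r ∈ Set.Icc 0 (c i).D)
    (h : ((c i).p = 1 ∧ ((c i).tAt r = 0 ∨ (c i).tAt r = lam n ((c i).p + 1))) ∨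
      ((c i).p + 2 = n ∧ ((c i).sAt r = 0 ∨ (c i).sAt r = lam n (c i).p))) :
    ∃ j, (c j).Deg ∧ (c j).T = (c i).T + r := by
  have h3 : 3 ≤ n := three_le
  have hprev := hc (i - 1)
  rw [sub_add_cancel] at hprev
  have hnext := hc i
  have hd : ¬ (c i).Deg := by unfold Passage.Deg; omega
  obtain ⟨l0, l1⟩ := Passage.lam_pos_of_not_deg hd
  have hexit := (c i).exit
  have hentry := (c i).entry
  have hs' := (c i).hs'
  have ht' := (c i).ht'
  -- An affine parameter that is nonnegative at entry and positive at exit can vanish only at entry.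
  -- Together with `finish`, this shows that a side is met only at the ends of the passage, where
  -- the neighbouring passage is degenerate.
  have start : ∀ x y : ℝ, 0 ≤ x → 0 < x + (c i).D * y → x + r * y = 0 → r = 0 ∧ x = 0 := by
    intro x y hx h1 h2
    rcases lt_or_ge 0 y with hy | hy
    · have := mul_nonneg hr.1 hy.le
      have h0 : r * y = 0 := by linarith
      exact ⟨(mul_eq_zero.1 h0).resolve_right hy.ne', by linarith⟩
    · nlinarith [mul_nonneg (sub_nonneg.2 hr.2) (neg_nonneg.2 hy)]
  have finish : ∀ x y z : ℝ, x < z → x + (c i).D * y ≤ z → x + r * y = z →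
      r = (c i).D ∧ x + (c i).D * y = z := by
    intro x y z hx h1 h2
    have hy : 0 < y := by
      by_contra hy
      nlinarith [mul_nonneg hr.1 (neg_nonneg.2 (not_lt.1 hy))]
    have : (c i).D ≤ r := le_of_mul_le_mul_right (by linarith) hy
    have : r = (c i).D := le_antisymm hr.2 this
    exact ⟨this, by rw [← this, h2]⟩
  rcases h with ⟨hp, h | h⟩ | ⟨hp, h | h⟩
  · obtain ⟨rfl, ht⟩ := start _ _ (c i).inRect.t_nonneg
      (by rw [← ht']; rcases hexit with h | h <;> linarith [h.1, h.2.1]) h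
    refine ⟨i - 1, ?_⟩
    rcases hprev.2 with g | g
    · have hg : (c (i - 1)).Deg := Or.inl (by omega)
      exact ⟨hg, by rw [hprev.1, (c (i - 1)).deg hg]; ring⟩
    · linarith [g.2.2.1, g.2.2.2.2.2]
  · obtain ⟨rfl, ht⟩ := finish _ _ _ (by rcases hentry with h | h <;> linarith [h.1, h.2.2])
      (by rw [← ht']; exact (c i).inRect'.t_le) h
    rw [← ht'] at ht
    refine ⟨i + 1, ?_, hnext.1⟩
    rcases hnext.2 with g | g
    · linarith [g.2.2.2.1]
    · exact Or.inl (by omega)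
  · obtain ⟨rfl, ht⟩ := start _ _ (c i).inRect.s_nonneg
      (by rw [← hs']; rcases hexit with h | h <;> linarith [h.1, h.2.1]) h
    refine ⟨i - 1, ?_⟩
    rcases hprev.2 with g | g
    · linarith [g.2.2.1, g.2.2.2.2.1]
    · have hg : (c (i - 1)).Deg := Or.inr (by omega)
      exact ⟨hg, by rw [hprev.1, (c (i - 1)).deg hg]; ring⟩
  · obtain ⟨rfl, ht⟩ := finish _ _ _ (by rcases hentry with h | h <;> linarith [h.1, h.2.2])
      (by rw [← hs']; exact (c i).inRect'.s_le) h
    rw [← hs'] at ht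
    refine ⟨i + 1, ?_, hnext.1⟩
    rcases hnext.2 with g | g
    · exact Or.inr (by omega)
    · linarith [g.2.2.2.1]

theorem monotone_time (hc : ∀ i, (c i).Next (c (i + 1))) : Monotone fun i => (c i).T :=
  monotone_int_of_le_succ fun i => by rw [(hc i).1]; linarith [(c i).hD]

theorem Passage.apply_at (x : Passage n m a b τ) (h : IsTrajectory n τ (vel n m a b)) {r : ℝ}
    (hr : r ∈ Set.Icc 0 x.D) : τ (x.T + r) = rho n m x.p (x.sAt r) (x.tAt r) :=
  x.apply h hr

theorem Passage.reflect_apply_at (x : Passage n m a b τ) (h : IsTrajectory n τ (vel n m a b))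
    {r : ℝ} (hr : r ∈ Set.Icc 0 x.D) :
    reflect n m (τ (x.T + r)) = rhoF n m x.p (x.sAt r) (x.tAt r) := by
  rw [x.apply_at h hr, reflect_rho_of_lt m x.hp (Passage.inRect_at hr)]

theorem Passage.not_isCrn (x : Passage n m a b τ) (h : IsTrajectory n τ (vel n m a b))
    {r : ℝ} (hr : r ∈ Set.Icc 0 x.D) : ¬ IsCrn n x.p (x.sAt r) (x.tAt r) := by
  rw [← isVertex_rho_iff m x.hp (Passage.inRect_at hr), ← x.apply_at h hr]
  exact (h _).1

/-- The cutting sequences of a trajectory `τ` in the cone spanned by the directions of a zigzag,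
and those of the image of `τ` under the reflection. -/
theorem IsTrajectory.reflect_ksl (ha : 0 ≤ a) (hb : 0 ≤ b) (hv : vel n m a b ≠ 0)
    (h : IsTrajectory n τ (vel n m a b)) :
    (∃ s, IsCuttingSeq n τ s) ∧ ∀ s, IsCuttingSeq n τ s →
      (∃ s', IsKsl s s') ∧ ∀ s', IsCuttingSeq n (reflect n m ∘ τ) s' ↔ IsKsl s s' := by
  obtain ⟨c, hc⟩ := exists_chain ha hb hv h
  have h3 : 3 ≤ n := three_le
  have hT := monotone_time hc
  have hprev : ∀ i, (c (i - 1)).Next (c i) := fun i => by simpa using hc (i - 1)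
  choose r hr hre hr0 hru using fun i => (c i).exists_crossing
  have hon : ∀ i, OnEdge n (lab n m (c i).p) (τ ((c i).T + r i)) := fun i => by
    rw [(c i).apply_at h (hr i)]
    exact onEdge_rho_of_eq (c i).hp (Passage.inRect_at (hr i)) (hre i)
  -- Non-degenerate passages are crossed at an interior time, and two consecutive passages are never
  -- both degenerate, so consecutive crossing times differ.
  have hmono : StrictMono fun i => (c i).T + r i := by
    refine strictMono_int_of_lt_succ fun i => ?_
    have e := (hc i).1
    have h1 := (hr i).2
    have h2 := (hr (i + 1)).1
    by_cases hd : (c i).Deg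
    · have := (hr0 (i + 1) ((hc i).not_deg hd)).1
      linarith
    · have := (hr0 i hd).2
      linarith
  have hD0 : ∀ i, ¬ (c i).Deg → 0 < (c i).D := fun i hd => (hr0 i hd).1.trans (hr0 i hd).2
  -- The crossing times are unbounded in both directions, so the chain of passages covers the whole
  -- time axis and no crossing is missed.
  have hcov : ∀ t, ∃ i, ∃ q ∈ Set.Icc 0 (c i).D, t = (c i).T + q := by
    intro t
    obtain ⟨i₁, hi₁⟩ := h.exists_lt_crossing hv hmono (fun i => ⟨_, hon i⟩) t
    obtain ⟨i₂, hi₂⟩ := h.exists_crossing_lt hv hmono (fun i => ⟨_, hon i⟩) t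
    obtain ⟨i, hi, hmax⟩ := Int.exists_greatest_of_bdd (P := fun i => (c i).T ≤ t)
      ⟨i₁ + 1, fun z hz => by
        by_contra hlt
        have h1 := hT (show i₁ + 1 ≤ z by omega)
        have h2 := (hc i₁).1
        have h4 := (hr i₁).2
        simp only at h1
        linarith⟩ ⟨i₂, by linarith [(hr i₂).1]⟩
    refine ⟨i, t - (c i).T, ⟨by linarith, ?_⟩, by ring⟩
    by_contra hlt
    have := hmax (i + 1) (by rw [(hc i).1]; linarith)
    omega
  have hdeg : ∀ i, (c i).Deg → r i = 0 := fun i hd => by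
    have := hr i
    rw [(c i).deg hd] at this
    exact le_antisymm this.2 this.1
  have hcut : IsCuttingSeq n τ fun i => lab n m (c i).p := by
    refine ⟨_, hmono, Set.Subset.antisymm ?_ ?_, hon⟩
    · rintro _ ⟨i, rfl⟩
      exact ⟨_, hon i⟩
    · rintro t ⟨k, hk⟩
      obtain ⟨i, q, hq, rfl⟩ := hcov t
      by_cases hd : (c i).Deg
      · refine ⟨i, ?_⟩
        rw [(c i).deg hd] at hq
        simp only [hdeg i hd, le_antisymm hq.2 hq.1]
      · have hpn := (c i).hp
        rw [(c i).apply_at h hq] at hk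
        unfold Passage.Deg at hd
        rcases onEdge_rho_cases (by omega) (by omega) (Passage.inRect_at hq) ((c i).not_isCrn h hq) hk
          with ⟨-, e⟩ | ⟨e1, -, e2⟩ | ⟨e1, -, e2⟩
        · exact ⟨i, by simp only [hru i q hq e]⟩
        · obtain ⟨j, hj, hjT⟩ := exists_deg hc i hq (Or.inl ⟨e1, e2⟩)
          exact ⟨j, by simp only [hdeg j hj, hjT, add_zero]⟩
        · obtain ⟨j, hj, hjT⟩ := exists_deg hc i hq (Or.inr ⟨e1, e2⟩)
          exact ⟨j, by simp only [hdeg j hj, hjT, add_zero]⟩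
  -- Labels determine positions, so equality of the neighbouring letters is equality of the
  -- neighbouring positions.
  have hstr : ∀ i, (lab n m (c (i - 1)).p = lab n m (c (i + 1)).p) ↔ (c i).Straight := fun i => by
    rw [(hprev i).straight_iff (hc i)]
    exact ⟨lab_inj (c _).hp (c _).hp, fun e => by rw [e]⟩
  -- The ends `0` and `n - 1` of the chain have only one neighbour each, so the end letters are
  -- always sandwiched.
  have hdstr : ∀ i, (c i).Deg → (c i).Straight := fun i hd => by
    rw [(hprev i).straight_iff (hc i)]
    have h1 := (hprev i).eq_add_one
    have h2 := (hc i).eq_add_one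
    have h4 := (c (i - 1)).hp
    have h5 := (c (i + 1)).hp
    unfold Passage.Deg at hd
    omega
  have hex : ∀ i, ∃ w, (c i).Straight → w ∈ Set.Icc 0 (c i).D ∧
      (c i).sAt w * lam n ((c i).p + 1) = (c i).tAt w * lam n (c i).p ∧
      (¬ (c i).Deg → 0 < w ∧ w < (c i).D) ∧
      ∀ r' ∈ Set.Icc 0 (c i).D,
        (c i).sAt r' * lam n ((c i).p + 1) = (c i).tAt r' * lam n (c i).p → r' = w := fun i => by
    by_cases hs : (c i).Straight
    · obtain ⟨w, h1, h2⟩ := hs.exists_crossing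
      exact ⟨w, fun _ => ⟨h1, h2⟩⟩
    · exact ⟨0, fun h => absurd h hs⟩
  choose w hw using hex
  have hwdeg : ∀ i, (c i).Deg → w i = 0 := fun i hd => by
    have := (hw i (hdstr i hd)).1
    rw [(c i).deg hd] at this
    exact le_antisymm this.2 this.1
  have hwon : ∀ i, (c i).Straight →
      OnEdge n (lab n m (c i).p) ((reflect n m ∘ τ) ((c i).T + w i)) := fun i hs => by
    obtain ⟨h1, h2, -⟩ := hw i hs
    rw [Function.comp_apply, (c i).reflect_apply_at h h1]
    exact onEdge_rhoF_of_eq (c i).hp (Passage.inRect_at h1) h2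
  refine ⟨⟨_, hcut⟩, fun s hs => hcut.ksl (w := fun i => (c i).T + w i) (fun t => (h t).1)
    (fun t => by rw [Function.comp_apply, isVertex_reflect]; exact (h t).1) ?_ ?_
    (fun i hi => hwon i ((hstr i).1 hi)) ?_ ?_ hs⟩
  · intro i hi j hj hij
    have hi' := hw i ((hstr i).1 hi)
    have hj' := hw j ((hstr j).1 hj)
    have e := (hc i).1
    have h1 := hi'.1.2
    have h2 := hj'.1.1
    have h4 := hT (show i + 1 ≤ j by omega)
    simp only at h4 ⊢
    by_cases hdi : (c i).Deg
    · have hd := (hc i).not_deg hdi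
      by_cases hdj : (c j).Deg
      · have hne : i + 1 ≠ j := by rintro rfl; exact hd hdj
        have h5 := hT (show i + 1 + 1 ≤ j by omega)
        have h6 := (hc (i + 1)).1
        have h7 := hD0 _ hd
        simp only at h5
        linarith
      · linarith [(hj'.2.2.1 hdj).1]
    · linarith [(hi'.2.2.1 hdi).2]
  · refine Set.Subset.antisymm ?_ ?_
    · rintro _ ⟨i, hi, rfl⟩
      exact ⟨_, hwon i ((hstr i).1 hi)⟩
    · rintro t ⟨k, hk⟩
      obtain ⟨i, q, hq, rfl⟩ := hcov t
      by_cases hd : (c i).Deg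
      · refine ⟨i, (hstr i).2 (hdstr i hd), ?_⟩
        rw [(c i).deg hd] at hq
        simp only [hwdeg i hd, le_antisymm hq.2 hq.1]
      · have hpn := (c i).hp
        rw [Function.comp_apply, (c i).reflect_apply_at h hq] at hk
        have hd' := hd
        unfold Passage.Deg at hd'
        rcases onEdge_rhoF_cases (by omega) (by omega) (Passage.inRect_at hq)
          ((c i).not_isCrn h hq) hk with ⟨-, e⟩ | e
        · have hs := Passage.straight_of_eq hd hq e
          exact ⟨i, (hstr i).2 hs, by simp only [(hw i hs).2.2.2 q hq e]⟩
        · obtain ⟨j, hj, hjT⟩ := exists_deg hc i hq e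
          exact ⟨j, (hstr j).2 (hdstr j hj), by simp only [hwdeg j hj, hjT, add_zero]⟩
  · intro B
    obtain ⟨i, h1, h2⟩ := exists_turn (q := fun i => ((c i).p : ℤ)) (N := n) (fun i => by positivity)
      (fun i => by exact_mod_cast (c i).hp) (fun i => (hc i).eq_add_one) B
    exact ⟨i, h1, by rw [Nat.cast_inj.1 h2]⟩
  · intro B
    obtain ⟨i, h1, h2⟩ := exists_turn_lt (q := fun i => ((c i).p : ℤ)) (N := n)
      (fun i => by positivity) (fun i => by exact_mod_cast (c i).hp) (fun i => (hc i).eq_add_one) B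
    exact ⟨i, h1, by rw [Nat.cast_inj.1 h2]⟩

end Chains

end DoubleGon

end

noncomputable section

namespace DoubleGon

/-! ### Affine automorphisms and cutting sequences -/

section Automorphisms

variable {n : ℕ} [Fact (3 ≤ n)] [Fact (Odd n)]

theorem isCuttingSeq_congr {τ τ' : ℝ → Surface n}
    (h : ∀ k t, OnEdge n k (τ t) ↔ OnEdge n k (τ' t)) (s : ℤ → Fin n) :
    IsCuttingSeq n τ s ↔ IsCuttingSeq n τ' s := by
  simp only [IsCuttingSeq, h]

theorem reflect_halfTurn (m : ℤ) (X : Surface n) :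
    reflect n m (halfTurn n X) = halfTurn n (reflect n m X) := by
  obtain ⟨p, s, t, h1, h2, h, rfl⟩ := exists_rho m X
  rw [halfTurn_rho m (by omega) h, reflect_rho m h1 h2 h.compl, reflect_rho m h1 h2 h,
    halfTurn_rhoF m (by omega) h]

/-- The half-turn preserves labels and commutes with the reflection, so the signs of the derivative
and of the velocity do not affect cutting sequences. -/
theorem affineAut_ksl {m : ℤ} {A B : Matrix (Fin 2) (Fin 2) ℝ}
    (hB : ∀ p, B *ᵥ drc n m p = sgn (par p) • drc n m p) (hA : A = B ∨ A = -B) :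
    (∃ Φ : Surface n ≃ₜ Surface n, IsAffineAut n Φ A) ∧
    ∀ Φ : Surface n ≃ₜ Surface n, IsAffineAut n Φ A →
      ∀ (τ : ℝ → Surface n) (v : Plane) (a b : ℝ), 0 ≤ a → 0 ≤ b → v ≠ 0 →
        (v = vel n m a b ∨ v = -vel n m a b) → IsTrajectory n τ v →
        IsTrajectory n (Φ ∘ τ) (A *ᵥ v) ∧
        (∃ s, IsCuttingSeq n τ s) ∧
        ∀ s, IsCuttingSeq n τ s →
          (∃ s', IsKsl s s') ∧ ∀ s', IsCuttingSeq n (Φ ∘ τ) s' ↔ IsKsl s s' := by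
  have hR := isAffineAut_reflect hB
  refine ⟨?_, fun Φ hΦ τ v a b ha hb hv0 hv hτ => ⟨hΦ.isTrajectory hτ, ?_⟩⟩
  · rcases hA with rfl | rfl
    · exact ⟨_, hR⟩
    · exact ⟨_, by simpa using hR.trans isAffineAut_halfTurn⟩
  have hedge : ∀ k X, OnEdge n k (Φ X) ↔ OnEdge n k (reflect n m X) := by
    intro k X
    rcases hA with rfl | rfl
    · rw [eq_reflect hB hΦ]
    · have := eq_reflect hB (by simpa using hΦ.trans isAffineAut_halfTurn) X
      rw [← this]
      exact onEdge_halfTurn.symm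
  have hcut : ∀ s, IsCuttingSeq n (Φ ∘ τ) s ↔ IsCuttingSeq n (reflect n m ∘ τ) s :=
    isCuttingSeq_congr fun k t => hedge k (τ t)
  simp only [hcut]
  rcases hv with rfl | rfl
  · exact hτ.reflect_ksl ha hb hv0
  · have hτ' := isAffineAut_halfTurn.isTrajectory hτ
    rw [neg_mulVec, one_mulVec, neg_neg] at hτ'
    have h1 : ∀ s, IsCuttingSeq n τ s ↔ IsCuttingSeq n (halfTurn n ∘ τ) s :=
      isCuttingSeq_congr fun k t => onEdge_halfTurn.symm
    have h2 : ∀ s, IsCuttingSeq n (reflect n m ∘ τ) s ↔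
        IsCuttingSeq n (reflect n m ∘ (halfTurn n ∘ τ)) s :=
      isCuttingSeq_congr fun k t => by
        simp only [Function.comp_apply, reflect_halfTurn, onEdge_halfTurn]
    simp only [h1, h2]
    exact hτ'.reflect_ksl ha hb (neg_ne_zero.1 hv0)

/-! ### Eigenvectors of the derivatives and the zigzag of a given direction -/

theorem rot_mulVec_dir (φ θ : ℝ) : rot φ *ᵥ dir θ = dir (φ + θ) := by
  apply plane_ext
  · simp [rot, dir, Real.cos_add, mulVec, dotProduct, Fin.sum_univ_two]; ring
  · simp [rot, dir, Real.sin_add, mulVec, dotProduct, Fin.sum_univ_two]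

theorem rot_conj_mulVec_dir (C : Matrix (Fin 2) (Fin 2) ℝ) (φ θ : ℝ) :
    (rot φ * C * rot (-φ)) *ᵥ dir (φ + θ) = rot φ *ᵥ (C *ᵥ dir θ) := by
  rw [← mulVec_mulVec, ← mulVec_mulVec, rot_mulVec_dir, neg_add_cancel_left]

theorem cot_ang_mul_sin : Real.cot (Real.pi / n) * Real.sin (ang n) = Real.cos (ang n) := by
  have h := (sin_ang_pos (n := n)).ne'
  unfold ang at *
  rw [Real.cot_eq_cos_div_sin]
  field_simp

theorem hflip_shear_dir_zero : (hflip * shear n) *ᵥ dir 0 = -dir 0 := by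
  apply plane_ext <;>
    simp [hflip, shear, dir, mulVec, dotProduct, Fin.sum_univ_two, Matrix.mul_apply]

/-- Shearing by twice the cotangent changes the sign of the first coordinate of this vector, and the
flip restores it. So the Veech element is an affine reflection whose two eigendirections are `π / n`
apart. -/
theorem hflip_shear_dir_neg : (hflip * shear n) *ᵥ dir (-ang n) = dir (-ang n) := by
  have h := cot_ang_mul_sin (n := n)
  apply plane_ext
  · simp [hflip, shear, dir, mulVec, dotProduct, Fin.sum_univ_two, Matrix.mul_apply]
    linarith
  · simp [hflip, shear, dir, mulVec, dotProduct, Fin.sum_univ_two, Matrix.mul_apply]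

theorem shear_hflip_dir_zero : (shear n * hflip) *ᵥ dir 0 = -dir 0 := by
  apply plane_ext <;>
    simp [hflip, shear, dir, mulVec, dotProduct, Fin.sum_univ_two, Matrix.mul_apply]

theorem shear_hflip_dir : (shear n * hflip) *ᵥ dir (ang n) = dir (ang n) := by
  have h := cot_ang_mul_sin (n := n)
  apply plane_ext
  · simp [hflip, shear, dir, mulVec, dotProduct, Fin.sum_univ_two, Matrix.mul_apply]
    linarith
  · simp [hflip, shear, dir, mulVec, dotProduct, Fin.sum_univ_two, Matrix.mul_apply]

/-- Any two consecutive multiples of the angle `π / n` are, up to a common half-turn, the angles of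
the directions of a zigzag. -/
theorem exists_frame (K : ℤ) : ∃ m : ℤ,
    (drc n m 1 = dir (K * ang n) ∧ drc n m 0 = dir ((K - 1) * ang n)) ∨
    (drc n m 1 = -dir (K * ang n) ∧ drc n m 0 = -dir ((K - 1) * ang n)) := by
  have h1 : ∀ m : ℤ, drc n m 1 = dir (2 * m * ang n) := fun m => by simp [drc, par, del]
  have h0 : ∀ m : ℤ, drc n m 0 = dir ((2 * m - 1) * ang n) := fun m => by simp [drc, par, del]
  obtain ⟨N, hN, -⟩ := exists_half (n := n)
  rcases Int.even_or_odd' K with ⟨m, rfl | rfl⟩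
  · exact ⟨m, Or.inl ⟨by rw [h1]; push_cast; rfl, by rw [h0]; push_cast; rfl⟩⟩
  -- `2 (m + N + 1) = K + n`, and adding `n` to the index turns the direction by `π`.
  · refine ⟨m + N + 1, Or.inr ⟨?_, ?_⟩⟩
    · rw [h1, ← dir_add_pi, ← n_mul_ang (n := n), hN]
      congr 1; push_cast; ring
    · rw [h0, ← dir_add_pi, ← n_mul_ang (n := n), hN]
      congr 1; push_cast; ring

/-- The law of sines gives the components along the two directions; they are nonnegative for `r > 0`
and `θ` between these directions. -/
theorem smul_dir_eq (r θ α : ℝ) :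
    r • dir θ = (r * Real.sin (θ - (α - ang n)) / Real.sin (ang n)) • dir α +
      (r * Real.sin (α - θ) / Real.sin (ang n)) • dir (α - ang n) := by
  have h := (sin_ang_pos (n := n)).ne'
  have hs := Real.sin_sq_add_cos_sq α
  apply plane_ext
  · simp only [Pi.smul_apply, Pi.add_apply, smul_eq_mul, dir_zero_apply, Real.sin_sub, Real.cos_sub]
    field_simp
    linear_combination (-r * Real.cos θ * Real.sin (ang n)) * hs
  · simp only [Pi.smul_apply, Pi.add_apply, smul_eq_mul, dir_one_apply, Real.sin_sub, Real.cos_sub]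
    field_simp
    linear_combination (-r * Real.sin θ * Real.sin (ang n)) * hs

theorem smul_dir_ne_zero {r : ℝ} (hr : 0 < r) (θ : ℝ) : r • dir θ ≠ 0 := by
  intro h
  have h0 := congrFun h 0
  have h1 := congrFun h 1
  simp only [Pi.smul_apply, smul_eq_mul, Pi.zero_apply, dir_zero_apply, dir_one_apply,
    mul_eq_zero, hr.ne', false_or] at h0 h1
  have := Real.sin_sq_add_cos_sq θ
  rw [h0, h1] at this
  norm_num at this

theorem mulVec_drc {m : ℤ} {B : Matrix (Fin 2) (Fin 2) ℝ} (h1 : B *ᵥ drc n m 1 = -drc n m 1)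
    (h0 : B *ᵥ drc n m 0 = drc n m 0) (p : ℕ) : B *ᵥ drc n m p = sgn (par p) • drc n m p := by
  induction p using Nat.twoStepInduction with
  | zero => simpa [par] using h0
  | one => simpa [par] using h1
  | more p ih _ => rw [drc_add_two, ih, par_succ, par_succ, Bool.not_not]

/-- Automorphisms whose derivative is, up to sign, the reflection that fixes the direction
`(K - 1) π / n` and negates the direction `K π / n`, and trajectories between these directions. -/
theorem affineAut_ksl_dir {K : ℤ} {A B : Matrix (Fin 2) (Fin 2) ℝ}
    (h1 : B *ᵥ dir (K * ang n) = -dir (K * ang n))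
    (h0 : B *ᵥ dir ((K - 1) * ang n) = dir ((K - 1) * ang n)) (hA : A = B ∨ A = -B) :
    (∃ Φ : Surface n ≃ₜ Surface n, IsAffineAut n Φ A) ∧
    ∀ Φ : Surface n ≃ₜ Surface n, IsAffineAut n Φ A →
      ∀ (τ : ℝ → Surface n) (r θ : ℝ), 0 < r → θ ∈ Set.Icc ((K - 1) * ang n) (K * ang n) →
        IsTrajectory n τ (r • dir θ) →
        IsTrajectory n (Φ ∘ τ) (A *ᵥ (r • dir θ)) ∧
        (∃ s, IsCuttingSeq n τ s) ∧
        ∀ s, IsCuttingSeq n τ s →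
          (∃ s', IsKsl s s') ∧ ∀ s', IsCuttingSeq n (Φ ∘ τ) s' ↔ IsKsl s s' := by
  obtain ⟨m, hm⟩ := exists_frame (n := n) K
  have hB : ∀ p, B *ᵥ drc n m p = sgn (par p) • drc n m p := by
    apply mulVec_drc
    · rcases hm with ⟨e1, e0⟩ | ⟨e1, e0⟩ <;> simp [e1, h1, mulVec_neg]
    · rcases hm with ⟨e1, e0⟩ | ⟨e1, e0⟩ <;> simp [e0, h0, mulVec_neg]
  obtain ⟨hex, hall⟩ := affineAut_ksl hB hA
  refine ⟨hex, fun Φ hΦ τ r θ hr hθ hτ => ?_⟩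
  have hs := sin_ang_pos (n := n)
  have hpi : ang n ≤ Real.pi := by
    rw [← n_mul_ang (n := n)]
    have h3 : (1 : ℝ) ≤ n := by exact_mod_cast (by have := three_le (n := n); omega : 1 ≤ n)
    have : 0 ≤ ang n := by unfold ang; positivity
    nlinarith
  have hsin : ∀ x, 0 ≤ x → x ≤ ang n → 0 ≤ Real.sin x := fun x hx hx' =>
    Real.sin_nonneg_of_nonneg_of_le_pi hx (hx'.trans hpi)
  have hk : ((K : ℝ) - 1) * ang n = K * ang n - ang n := by ring
  rw [hk] at hθ
  have e := smul_dir_eq (n := n) r θ (K * ang n)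
  rw [← hk] at e
  refine hall Φ hΦ τ _ (r * Real.sin (θ - (K - 1) * ang n) / Real.sin (ang n))
    (r * Real.sin (K * ang n - θ) / Real.sin (ang n))
    (div_nonneg (mul_nonneg hr.le (hsin _ (by linarith [hθ.1]) (by linarith [hθ.2]))) hs.le)
    (div_nonneg (mul_nonneg hr.le (hsin _ (by linarith [hθ.2]) (by linarith [hθ.1]))) hs.le)
    (smul_dir_ne_zero hr θ) ?_ hτ
  rw [e]
  rcases hm with ⟨e1, e0⟩ | ⟨e1, e0⟩
  · left; rw [vel, e1, e0]
  · right; rw [vel, e1, e0]; simp only [smul_neg]; abel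

end Automorphisms

end DoubleGon

end

open DoubleGon in
/-- For `k = 0` the element `A` is `diag(-1,1) * M_n`, for trajectories with angle in `(-π/n, 0]`,
or its mirror image `M_n * diag(-1,1)`, for trajectories with angle in `[0, π/n)`; the other values
of `k` are the rotated copies, which together treat every direction. -/
theorem theorem6p3 (n : ℕ) (hn : Odd n) (h3 : 3 ≤ n) (k : ℤ)
    (A : Matrix (Fin 2) (Fin 2) ℝ) (I : Set ℝ)
    (hAI :
      (A = rot (k * Real.pi / n) * (hflip * shear n) * rot (-(k * Real.pi / n)) ∧
        I = Set.Ioc ((k - 1) * Real.pi / n) (k * Real.pi / n)) ∨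
      (A = rot (k * Real.pi / n) * (shear n * hflip) * rot (-(k * Real.pi / n)) ∧
        I = Set.Ico (k * Real.pi / n) ((k + 1) * Real.pi / n))) :
    (∃ Φ : Surface n ≃ₜ Surface n, IsAffineAut n Φ A) ∧
    ∀ Φ : Surface n ≃ₜ Surface n, IsAffineAut n Φ A →
      ∀ (τ : ℝ → Surface n) (r θ : ℝ), 0 < r → θ ∈ I → IsTrajectory n τ (r • dir θ) →
        IsTrajectory n (Φ ∘ τ) (A *ᵥ (r • dir θ)) ∧
        (∃ s, IsCuttingSeq n τ s) ∧
        ∀ s, IsCuttingSeq n τ s →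
          (∃ s', IsKsl s s') ∧ ∀ s', IsCuttingSeq n (Φ ∘ τ) s' ↔ IsKsl s s' := by
  have : Fact (3 ≤ n) := ⟨h3⟩
  have : Fact (Odd n) := ⟨hn⟩
  have e : ∀ x : ℝ, x * Real.pi / n = x * ang n := fun x => mul_div_assoc _ _ _
  simp only [e] at hAI
  rcases hAI with ⟨hA, rfl⟩ | ⟨hA, rfl⟩
  · have h1 : A *ᵥ dir (k * ang n) = -dir (k * ang n) := by
      have := rot_conj_mulVec_dir (hflip * shear n) (k * ang n) 0
      rwa [hflip_shear_dir_zero, mulVec_neg, rot_mulVec_dir, add_zero, ← hA] at this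
    have h0 : A *ᵥ dir ((k - 1) * ang n) = dir ((k - 1) * ang n) := by
      have := rot_conj_mulVec_dir (hflip * shear n) (k * ang n) (-ang n)
      rwa [hflip_shear_dir_neg, rot_mulVec_dir, ← hA,
        show (k : ℝ) * ang n + -ang n = (k - 1) * ang n by ring] at this
    obtain ⟨hex, hall⟩ := affineAut_ksl_dir h1 h0 (Or.inl rfl)
    exact ⟨hex, fun Φ hΦ τ r θ hr hθ hτ => hall Φ hΦ τ r θ hr ⟨hθ.1.le, hθ.2⟩ hτ⟩
  -- The mirror image negates the lower direction and fixes the upper one, so `-A` is the reflection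
  -- for `K = k + 1`.
  · have h1 : (-A) *ᵥ dir ((k + 1 : ℤ) * ang n) = -dir ((k + 1 : ℤ) * ang n) := by
      have := rot_conj_mulVec_dir (shear n * hflip) (k * ang n) (ang n)
      rw [shear_hflip_dir, rot_mulVec_dir, ← hA,
        show (k : ℝ) * ang n + ang n = (k + 1 : ℤ) * ang n by push_cast; ring] at this
      rw [neg_mulVec, this]
    have h0 : (-A) *ᵥ dir (((k + 1 : ℤ) - 1) * ang n) = dir (((k + 1 : ℤ) - 1) * ang n) := by
      have := rot_conj_mulVec_dir (shear n * hflip) (k * ang n) 0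
      rw [shear_hflip_dir_zero, mulVec_neg, rot_mulVec_dir, ← hA,
        show (k : ℝ) * ang n + 0 = ((k + 1 : ℤ) - 1) * ang n by push_cast; ring] at this
      rw [neg_mulVec, this, neg_neg]
    obtain ⟨hex, hall⟩ := affineAut_ksl_dir h1 h0 (Or.inr (neg_neg A).symm)
    refine ⟨hex, fun Φ hΦ τ r θ hr hθ hτ => hall Φ hΦ τ r θ hr ⟨?_, ?_⟩ hτ⟩
    · push_cast; rw [add_sub_cancel_right]; exact hθ.1
    · push_cast; exact hθ.2.le
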